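/- Let $\square(q)=\sum_{n\in\mathbb Z}q^{n^2}$ for $|q|<1$. For integers $0\le r\le n$ and $\lambda\in\mathbb Z^r$ let $$Q_\lambda(x_1,\dots,x_n)=2^r\sum_{\sigma\in S_n/S_{n-r}}\sigma\Bigg(x_1^{\lambda_1}\cdots x_r^{\lambda_r}\prod_{\substack{1\le i\le r\\ i<j\le n}}\frac{x_i+x_j}{x_i-x_j}\Bigg),$$ where $S_n$ permutes the variables and $S_{n-r}$ is the subgroup permuting $x_{r+1},\dots,x_n$. The singularities at $x_i=x_j$ are removable at the point $(1,\dots,1)$, and $Q_\lambda(1^n)$ denotes the value at $x_1=\dots=x_n=1$, that is, the limit of $Q_\lambda(x)$ as $x\to(1,\dots,1)$ through points of $\mathbb R^n$ with distinct coordinates (this limit exists). Then, for every integer $m\ge 0$ and every real $q$ with $|q|<1$, $$\square(q)^{4m^2}=\sum_{s=0}^m\frac1{2^s}\sum_{k_1>\dots>k_s\ge1}\ \prod_{i=1}^s\frac{q^{k_i}}{1+(-q)^{k_i}}\;Q_{(k_1,\dots,k_s,-k_s,\dots,-k_1)}(1^{2m}),$$ $$\square(q)^{4m(m+1)}=\sum_{s=0}^m\frac{(-1)^s}{2^s}\sum_{k_1>\dots>k_s\ge1}\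 \prod_{i=1}^s\frac{q^{k_i}}{1-(-q)^{k_i}}\;Q_{(k_1,\dots,k_s,-k_s,\dots,-k_1)}(1^{2m+1}),$$ where the inner sums run over integers $k_1,\dots,k_s$, converge absolutely, and for $s=0$ consist of the single term $1$. -/

import Mathlib

open Filter Topology

noncomputable section

namespace SumsOfSquares

/-- The generating function of squares, the two-sided sum of `q ^ (n ^ 2)` over all integers `n`.
It converges for `|q| < 1`, see `summable_square`. -/
def square (q : ℝ) : ℝ := ∑' n : ℤ, q ^ (n.natAbs ^ 2)

theorem summable_square {q : ℝ} (hq : |q| < 1) : Summable fun n : ℤ => q ^ (n.natAbs ^ 2) := by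
  have key : Summable fun n : ℕ => q ^ (n ^ 2) := by
    refine Summable.of_norm_bounded (summable_geometric_of_lt_one (abs_nonneg q) hq) fun n => ?_
    rw [norm_pow, Real.norm_eq_abs]
    exact pow_le_pow_of_le_one (abs_nonneg q) hq.le (Nat.le_self_pow two_ne_zero n)
  exact Summable.of_nat_of_neg (by simpa using key) (by simpa using key)

/-- The product of `(x_i + x_j) / (x_i - x_j)` over `1 ≤ i ≤ m`, `i < j ≤ n`, times the monomial
`x_1 ^ λ_1 ⋯ x_m ^ λ_m` (with `λ` any vector of integers of length `m ≤ n`). -/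
def schurQTerm {m n : ℕ} (hmn : m ≤ n) (lam : Fin m → ℤ) (x : Fin n → ℝ) : ℝ :=
  (∏ i : Fin m, x (Fin.castLE hmn i) ^ lam i) *
    ∏ i : Fin m, ∏ j ∈ Finset.Ioi (Fin.castLE hmn i),
      (x (Fin.castLE hmn i) + x j) / (x (Fin.castLE hmn i) - x j)

/-- The Schur `Q`-polynomial `Q_λ(x_1, …, x_n)` for `λ ∈ ℤ ^ m`, `m ≤ n`, at a point with distinct
nonzero coordinates: `2 ^ m` times the sum of the permuted terms `schurQTerm` over `S_n / S_{n-m}`,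
where `S_{n-m}` permutes the last `n - m` variables. As the term is symmetric in these variables,
the sum over the cosets is the sum over `S_n` divided by `(n - m)!`. -/
def schurQ {m n : ℕ} (hmn : m ≤ n) (lam : Fin m → ℤ) (x : Fin n → ℝ) : ℝ :=
  2 ^ m * ((∑ σ : Equiv.Perm (Fin n), schurQTerm hmn lam fun i => x (σ i)) /
    ((n - m).factorial : ℝ))

/-- The points with distinct coordinates that tend to `(1, …, 1)`. -/
def nearOne (n : ℕ) : Filter (Fin n → ℝ) := 𝓝[{x | Function.Injective x}] (fun _ => 1)

/-- `Q_λ(1 ^ n)`: the singularities of `Q_λ` at `x_i = x_j` are removable (`Q_λ` is a Laurent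
polynomial), and this is the value at `(1, …, 1)`, the limit of `Q_λ` through points with distinct
coordinates. -/
def schurQOne {m n : ℕ} (hmn : m ≤ n) (lam : Fin m → ℤ) : ℝ :=
  limUnder (nearOne n) (schurQ hmn lam)

/-- The tuples of integers `k_1 > k_2 > ⋯ > k_s ≥ 1`. -/
abbrev DecTuple (s : ℕ) : Type := {k : Fin s → ℕ // StrictAnti k ∧ ∀ i, 1 ≤ k i}

/-- The vector `(k_1, …, k_s, -k_s, …, -k_1)`. -/
def symmetrize {s : ℕ} (k : Fin s → ℕ) : Fin (s + s) → ℤ :=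
  Fin.append (fun i => (k i : ℤ)) (fun i => -(k i.rev : ℤ))

/-- The summand of the first formula for the tuple `k`, with `s ≤ m`:
`∏ q ^ k_i / (1 + (-q) ^ k_i)` times `Q` at `1 ^ (2 m)`. -/
def evenTerm (m : ℕ) (q : ℝ) (s : Fin (m + 1)) (k : DecTuple s) : ℝ :=
  (∏ i, q ^ k.1 i / (1 + (-q) ^ k.1 i)) *
    schurQOne (n := 2 * m) (by omega) (symmetrize k.1)

/-- The summand of the second formula for the tuple `k`, with `s ≤ m`:
`∏ q ^ k_i / (1 - (-q) ^ k_i)` times `Q` at `1 ^ (2 m + 1)`. -/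
def oddTerm (m : ℕ) (q : ℝ) (s : Fin (m + 1)) (k : DecTuple s) : ℝ :=
  (∏ i, q ^ k.1 i / (1 - (-q) ^ k.1 i)) *
    schurQOne (n := 2 * m + 1) (by omega) (symmetrize k.1)

end SumsOfSquares

end

/-! The right-hand sides are expansions of pfaffians. By Schur's pfaffian, the product of (x_i -
x_j)/(x_i + x_j) over pairs is the pfaffian of that kernel, or a bordered one for an odd number of
variables. Hence Q at (k_1, …, k_s, -k_s, …, -k_1), times that product over all pairs, is up to a
constant an alternating sum of products over m disjoint pairs of variables: s pairs carry
(x_i/x_j)^k, the others carry Schur's kernel (`schurQ_symmetrize`). Summing over the k and over s is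
a binomial expansion, and it collapses to the pfaffian of one kernel (y - 1)/(y + 1) + 2ε ∑ c_k (y^k
- y^{-k}) with y = x_i/x_j and ε = ±1 (`sum_tsum_schurQ`).

For c_k = q^k/(1 + ε(-q)^k) and p = -q, these kernels are -2 `ellK p (-y)` for ε = 1 and -2 `ellL p
(-y)` for ε = -1. The first is of the type of Jacobi's sn, the second of zeta type. Multiplying
Laurent series gives their addition formula (`ellK_mul_ellK`), and these relations, collected in
`AddSystem`, again make the pfaffians factor: the even one of the first kernel and the bordered odd
one of the second are both the product of the first kernel over all pairs (`alt_pairing_even`,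
`alt_pairing_odd`).

It remains to let x tend to (1, …, 1). The elliptic kernel divided by Schur's kernel tends to 4
`ellConst p`, which is □(q)^4 by `ellConst_eq`, itself a consequence of the two-square identity
`sechSum_eq`. With kernels normalized by □(q)^2, each of the n(n-1)/2 pairs contributes □(q)^2 and
so does each of the m factors of a pairing, which gives the exponent 2m + n(n-1). Limit and infinite
sum are exchanged by dominated convergence, based on the uniform bound `exists_schurQ_bound`. -/

/-! ### Partial fractions for kernels with an addition formula. -/

/-- An antisymmetric kernel `g` together with an antisymmetric `l` obeying the addition formula and
the four-term relation of the elliptic function `sn`. -/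
structure AddSystem {ι 𝕜 : Type*} [Field 𝕜] (g l : ι → ι → 𝕜) : Prop where
  anti : ∀ a b, g a b = -g b a
  ne_zero : ∀ a b, a ≠ b → g a b ≠ 0
  add : ∀ a b c, a ≠ b → b ≠ c → a ≠ c → g a b * g b c * g a c = l a b + l b c - l a c
  four_term : ∀ x a b c, x ≠ a → x ≠ b → x ≠ c → a ≠ b → b ≠ c → a ≠ c →
    g x a * g b c - g x b * g a c + g x c * g a b =
      g x a * g x b * g x c * g a b * g a c * g b c

namespace AddSystem

variable {ι 𝕜 : Type*} [Field 𝕜] [DecidableEq ι] {g l : ι → ι → 𝕜}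

/-- The residue coefficient at `b` of the partial fraction expansion with nodes in `S`. -/
def coeff (g : ι → ι → 𝕜) (S : Finset ι) (b : ι) : 𝕜 := ∏ j ∈ S.erase b, (g b j)⁻¹

theorem coeff_insert {S : Finset ι} {a b : ι} (ha : a ∉ S) (hb : b ≠ a) :
    coeff g (insert a S) b = (g b a)⁻¹ * coeff g S b := by
  unfold coeff
  rw [Finset.erase_insert_of_ne hb.symm, Finset.prod_insert]
  simp [ha]

theorem coeff_insert_self {S : Finset ι} {a : ι} (ha : a ∉ S) :
    coeff g (insert a S) a = ∏ j ∈ S, (g a j)⁻¹ := by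
  unfold coeff
  rw [Finset.erase_insert ha]

/-- Induction step of a partial fraction expansion, adding two nodes. The three-node identity `h3`,
multiplied by the old coefficient at j, splits the new sum into three sums over S, namely the known
expansions of φ and of the inverse rows at a and b. It serves for both φ = g x and its inverse. -/
theorem sum_coeff_step {S : Finset ι} {a b : ι} (ha : a ∉ S) (hb : b ∉ S) (hab : a ≠ b)
    {φ : ι → 𝕜} (h : ∑ j ∈ S, φ j * coeff g S j = ∏ j ∈ S, φ j)
    (hWa : ∑ j ∈ S, (g a j)⁻¹ * coeff g S j = ∏ j ∈ S, (g a j)⁻¹)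
    (hWb : ∑ j ∈ S, (g b j)⁻¹ * coeff g S j = ∏ j ∈ S, (g b j)⁻¹)
    (h3 : ∀ j ∈ S, φ j * φ a * φ b = φ j * (g j a)⁻¹ * (g j b)⁻¹ + φ a * (g a j)⁻¹ * (g a b)⁻¹ +
      φ b * (g b j)⁻¹ * (g b a)⁻¹) :
    ∑ j ∈ insert a (insert b S), φ j * coeff g (insert a (insert b S)) j =
      ∏ j ∈ insert a (insert b S), φ j := by
  have ha' : a ∉ insert b S := by simp [ha, hab]
  rw [Finset.prod_insert ha', Finset.prod_insert hb, Finset.sum_insert ha', Finset.sum_insert hb,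
    coeff_insert_self ha', coeff_insert ha' hab.symm, coeff_insert_self hb, Finset.prod_insert hb]
  have e : ∀ j ∈ S, φ j * coeff g (insert a (insert b S)) j =
      φ a * φ b * (φ j * coeff g S j) - φ a * (g a b)⁻¹ * ((g a j)⁻¹ * coeff g S j)
        - φ b * (g b a)⁻¹ * ((g b j)⁻¹ * coeff g S j) := by
    intro j hj
    have hja : j ≠ a := fun e => ha (e ▸ hj)
    have hjb : j ≠ b := fun e => hb (e ▸ hj)
    rw [coeff_insert ha' hja, coeff_insert hb hjb]
    linear_combination (-coeff g S j) * h3 j hj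
  rw [Finset.sum_congr rfl e, Finset.sum_sub_distrib, Finset.sum_sub_distrib, ← Finset.mul_sum,
    ← Finset.mul_sum, ← Finset.mul_sum, h, hWa, hWb]
  ring

theorem exists_insert_insert {S : Finset ι} {k : ℕ} (h : S.card = k + 2) :
    ∃ a b T, a ∉ T ∧ b ∉ T ∧ a ≠ b ∧ T.card = k ∧ S = insert a (insert b T) := by
  obtain ⟨a, U, haU, rfl, hU⟩ := Finset.card_eq_succ.1 h
  obtain ⟨b, T, hbT, rfl, hT⟩ := Finset.card_eq_succ.1 hU
  simp only [Finset.mem_insert, not_or] at haU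
  exact ⟨a, b, T, haU.2, hbT, haU.1, hT, rfl⟩

/-- After clearing denominators, the three-node identity is the alternating sum of the addition
formula over the four triples from x, j, a, b, in which all values of l cancel. The number of nodes
stays odd because they enter two at a time. -/
theorem sum_inv_mul_coeff (H : AddSystem g l) (k : ℕ) :
    ∀ S : Finset ι, S.card = 2 * k + 1 → ∀ x ∉ S,
      ∑ j ∈ S, (g x j)⁻¹ * coeff g S j = ∏ j ∈ S, (g x j)⁻¹ := by
  induction k with
  | zero =>
    intro S hS x _
    obtain ⟨b, rfl⟩ := Finset.card_eq_one.1 hS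
    simp [coeff]
  | succ k ih =>
    intro S hS x hx
    obtain ⟨a, b, T, ha, hb, hab, hT, rfl⟩ := exists_insert_insert (k := 2 * k + 1) hS
    simp only [Finset.mem_insert, not_or] at hx
    refine sum_coeff_step ha hb hab (ih T hT x hx.2.2) (ih T hT a ha) (ih T hT b hb) ?_
    intro j hj
    have hja : j ≠ a := fun e => ha (e ▸ hj)
    have hjb : j ≠ b := fun e => hb (e ▸ hj)
    have hxj : x ≠ j := fun e => hx.2.2 (e ▸ hj)
    have n1 := H.ne_zero _ _ hja
    have n2 := H.ne_zero _ _ hjb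
    have n3 := H.ne_zero _ _ hab
    have n4 := H.ne_zero _ _ hxj
    have n5 := H.ne_zero _ _ hx.1
    have n6 := H.ne_zero _ _ hx.2.1
    rw [H.anti a j, H.anti b j, H.anti b a]
    have e1 := H.add j a b hja hab hjb
    have e2 := H.add x a b hx.1 hab hx.2.1
    have e3 := H.add x j b hxj hjb hx.2.1
    have e4 := H.add x j a hxj hja hx.1
    field_simp
    linear_combination e1 - e2 + e3 - e4

/-- Here the three-node identity is the four-term relation; the rows at the two new nodes are still
expanded by `sum_inv_mul_coeff`. -/
theorem sum_mul_coeff (H : AddSystem g l) (k : ℕ) :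
    ∀ S : Finset ι, S.card = 2 * k + 1 → ∀ x ∉ S,
      ∑ j ∈ S, g x j * coeff g S j = ∏ j ∈ S, g x j := by
  induction k with
  | zero =>
    intro S hS x _
    obtain ⟨b, rfl⟩ := Finset.card_eq_one.1 hS
    simp [coeff]
  | succ k ih =>
    intro S hS x hx
    obtain ⟨a, b, T, ha, hb, hab, hT, rfl⟩ := exists_insert_insert (k := 2 * k + 1) hS
    simp only [Finset.mem_insert, not_or] at hx
    refine sum_coeff_step ha hb hab (ih T hT x hx.2.2) (H.sum_inv_mul_coeff k T hT a ha)
      (H.sum_inv_mul_coeff k T hT b hb) ?_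
    intro j hj
    have hja : j ≠ a := fun e => ha (e ▸ hj)
    have hjb : j ≠ b := fun e => hb (e ▸ hj)
    have hxj : x ≠ j := fun e => hx.2.2 (e ▸ hj)
    have n1 := H.ne_zero _ _ hja
    have n2 := H.ne_zero _ _ hjb
    have n3 := H.ne_zero _ _ hab
    rw [H.anti a j, H.anti b j, H.anti b a]
    have e1 := H.four_term x j a b hxj hx.1 hx.2.1 hja hab hjb
    field_simp
    linear_combination -e1

/-- The weight of the pair `a, b` in the expansion of a pfaffian over the nodes `S`. -/
def pairWeight (g : ι → ι → 𝕜) (S : Finset ι) (a b : ι) : 𝕜 :=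
  ∏ j ∈ (S.erase a).erase b, (g a j)⁻¹ * (g b j)⁻¹

theorem pairWeight_eq (H : AddSystem g l) {S : Finset ι} {a b : ι} (hb : b ∈ S)
    (hab : a ≠ b) :
    pairWeight g S a b = g a b * coeff g S a * coeff g (S.erase a) b := by
  have hn := H.ne_zero a b hab
  unfold pairWeight coeff
  rw [Finset.prod_mul_distrib, ← Finset.mul_prod_erase (S.erase a) (fun j => (g a j)⁻¹)
    (Finset.mem_erase.2 ⟨hab.symm, hb⟩)]
  field_simp

/-- Every a contributes 1: by `sum_mul_coeff` with nodes S \ {a}, the sum over b is the product of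
the g a j, which cancels `coeff g S a`. -/
theorem sum_pairWeight_even (H : AddSystem g l) {S : Finset ι} {k : ℕ} (hS : S.card = 2 * k) :
    ∑ a ∈ S, ∑ b ∈ S.erase a, pairWeight g S a b = S.card := by
  rw [Finset.card_eq_sum_ones, Nat.cast_sum]
  refine Finset.sum_congr rfl fun a ha => ?_
  obtain ⟨k, rfl⟩ : ∃ k', k = k' + 1 := by
    refine Nat.exists_eq_add_one.2 ?_
    have := Finset.card_pos.2 ⟨a, ha⟩
    omega
  rw [Finset.sum_congr rfl fun b hb => H.pairWeight_eq (Finset.mem_of_mem_erase hb)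
    (Finset.ne_of_mem_erase hb).symm]
  have := H.sum_mul_coeff k (S.erase a) (by rw [Finset.card_erase_of_mem ha]; omega) a (by simp)
  have e : ∀ b ∈ S.erase a, g a b * coeff g S a * coeff g (S.erase a) b =
      coeff g S a * (g a b * coeff g (S.erase a) b) := fun b _ => by ring
  rw [Finset.sum_congr rfl e, ← Finset.mul_sum, this]
  unfold coeff
  rw [← Finset.prod_mul_distrib, Finset.prod_eq_one, Nat.cast_one]
  intro j hj
  exact inv_mul_cancel₀ (H.ne_zero _ _ (Finset.ne_of_mem_erase hj).symm)

/-- Separating one node x, the other coefficients sum by `sum_inv_mul_coeff` to minus the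
coefficient at x, the sign coming from g b x = -g x b. -/
theorem sum_coeff_eq_zero (H : AddSystem g l) {S : Finset ι} {k : ℕ} (hS : S.card = 2 * k + 2) :
    ∑ a ∈ S, coeff g S a = 0 := by
  obtain ⟨x, T, hx, rfl, hT⟩ := Finset.card_eq_succ.1 hS
  rw [Finset.sum_insert hx, coeff_insert_self hx, ← H.sum_inv_mul_coeff k T hT x hx,
    ← Finset.sum_add_distrib]
  refine Finset.sum_eq_zero fun b hb => ?_
  have hbx : b ≠ x := fun e => hx (e ▸ hb)
  rw [coeff_insert hx hbx, H.anti b x, inv_neg]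
  ring

theorem pairWeight_comm (S : Finset ι) (a b : ι) : pairWeight g S a b = pairWeight g S b a := by
  unfold pairWeight
  rw [Finset.erase_right_comm]
  exact Finset.prod_congr rfl fun j _ => mul_comm _ _

/-- Fix a node z and use the addition formula to write l a b as g a b · g b z · g a z plus terms
depending on a alone or b alone. The latter drop out by `sum_coeff_eq_zero`. In the former, g a z ·
g b z removes z from the weight, leaving the even case on the remaining nodes. -/
theorem sum_pairWeight_odd (H : AddSystem g l) {S : Finset ι} {k : ℕ} (hS : S.card = 2 * k + 1)
    (hll : ∀ a b, l a b = -l b a) :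
    ∑ a ∈ S, ∑ b ∈ S.erase a, l a b / g a b * pairWeight g S a b = S.card - 1 := by
  obtain ⟨z, T, hz, rfl, hT⟩ := Finset.card_eq_succ.1 hS
  set S := insert z T with hSdef
  have hzS : z ∈ S := by simp [hSdef]
  -- the part of `l a b` depending on one of the points only does not contribute
  have hrow : ∀ a ∈ S, ∑ b ∈ S.erase a, (g a b)⁻¹ * pairWeight g S a b = 0 := by
    intro a ha
    rw [Finset.sum_congr rfl (g := fun b => coeff g S a * coeff g (S.erase a) b)]
    · rw [← Finset.mul_sum]
      rcases Nat.eq_zero_or_pos k with rfl | hk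
      · have : S.erase a = ∅ := by
          rw [← Finset.card_eq_zero, Finset.card_erase_of_mem ha]; omega
        simp [this]
      · obtain ⟨k, rfl⟩ := Nat.exists_eq_add_of_lt hk
        rw [H.sum_coeff_eq_zero (k := k) (by rw [Finset.card_erase_of_mem ha]; omega), mul_zero]
    · intro b hb
      have hab := (Finset.ne_of_mem_erase hb).symm
      have := H.ne_zero a b hab
      rw [H.pairWeight_eq (Finset.mem_of_mem_erase hb) hab]
      field_simp
  have key : ∀ a ∈ S, ∀ b ∈ S.erase a, l a b / g a b * pairWeight g S a b =
      (if a = z ∨ b = z then 0 else g b z * g a z * pairWeight g S a b) +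
      (if a = z then 0 else l a z) * ((g a b)⁻¹ * pairWeight g S a b) +
      (if b = z then 0 else l b z) * ((g b a)⁻¹ * pairWeight g S b a) := by
    intro a ha b hb
    have hab := (Finset.ne_of_mem_erase hb).symm
    have n := H.ne_zero a b hab
    rw [pairWeight_comm S b a, H.anti b a]
    by_cases h1 : a = z
    · subst h1
      have hb : b ≠ a := hab.symm
      simp [hb]
      rw [hll a b]
      ring
    by_cases h2 : b = z
    · subst h2
      simp [h1]
      ring
    have e := H.add a b z hab h2 h1
    simp only [h1, h2, or_self, if_false, inv_neg]
    field_simp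
    linear_combination (-pairWeight g S a b) * e
  have hswap : ∀ F : ι → ι → 𝕜, ∑ a ∈ S, ∑ b ∈ S.erase a, F a b =
      ∑ b ∈ S, ∑ a ∈ S.erase b, F a b := by
    intro F
    refine Finset.sum_comm' ?_
    intro x y
    simp only [Finset.mem_erase]
    tauto
  rw [Finset.sum_congr rfl fun a ha => Finset.sum_congr rfl (key a ha)]
  simp only [Finset.sum_add_distrib]
  rw [hswap fun a b => (if b = z then 0 else l b z) * ((g b a)⁻¹ * pairWeight g S b a)]
  simp only [← Finset.mul_sum]
  rw [Finset.sum_congr rfl fun a ha => congrArg _ (hrow a ha)]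
  simp only [mul_zero, Finset.sum_const_zero, add_zero]
  have hcard : (S.card : 𝕜) - 1 = T.card := by
    rw [Finset.card_insert_of_notMem hz]; push_cast; ring
  rw [hcard, ← H.sum_pairWeight_even hT, Finset.sum_insert hz]
  simp only [true_or, if_true, Finset.sum_const_zero, zero_add]
  refine Finset.sum_congr rfl fun a ha => ?_
  have haz : a ≠ z := fun e => hz (e ▸ ha)
  have hST : S.erase a = insert z (T.erase a) := by
    rw [hSdef, Finset.erase_insert_of_ne haz.symm]
  rw [hST, Finset.sum_insert (by simp [hz])]
  simp only [or_true, if_true, zero_add]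
  refine Finset.sum_congr rfl fun b hb => ?_
  have hbT := Finset.mem_of_mem_erase hb
  have hbz : b ≠ z := fun e => hz (e ▸ hbT)
  simp only [haz, hbz, or_self, if_false]
  unfold pairWeight
  rw [hST, Finset.erase_insert_of_ne hbz.symm, Finset.prod_insert (by simp [hz])]
  have n1 := H.ne_zero a z haz
  have n2 := H.ne_zero b z hbz
  field_simp

end AddSystem

/-! ### Pfaffians as alternating sums, and their evaluation. -/

section Alternant

open Equiv

variable {ι 𝕜 : Type*} [Field 𝕜]

/-- The alternating sum of `F (x ∘ σ)` over all permutations `σ` of the positions. -/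
def alt {n : ℕ} (F : (Fin n → ι) → 𝕜) (x : Fin n → ι) : 𝕜 :=
  ∑ σ : Perm (Fin n), ((Perm.sign σ : ℤ) : 𝕜) * F (x ∘ σ)

theorem alt_congr {n : ℕ} {F G : (Fin n → ι) → 𝕜} {x : Fin n → ι}
    (h : ∀ σ : Perm (Fin n), F (x ∘ σ) = G (x ∘ σ)) : alt F x = alt G x := by
  simp only [alt, h]

theorem alt_comp {n : ℕ} (F : (Fin n → ι) → 𝕜) (x : Fin n → ι) (ρ : Perm (Fin n)) :
    alt (fun y => F (y ∘ ρ)) x = ((Perm.sign ρ : ℤ) : 𝕜) * alt F x := by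
  unfold alt
  rw [Finset.mul_sum]
  symm
  rw [← Equiv.sum_comp (Equiv.mulRight ρ)]
  refine Finset.sum_congr rfl fun σ _ => ?_
  rw [Equiv.coe_mulRight, Perm.sign_mul, Perm.coe_mul]
  change _ * (_ * F (x ∘ (σ ∘ ρ))) = _ * F (x ∘ (σ ∘ ρ))
  have : ((Perm.sign ρ : ℤ) : 𝕜) * ((Perm.sign ρ : ℤ) : 𝕜) = 1 := by
    rw [← Int.cast_mul, ← Units.val_mul, Int.units_mul_self]; simp
  push_cast
  linear_combination (((Perm.sign σ : ℤ) : 𝕜) * F (x ∘ (σ ∘ ρ))) * this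

theorem alt_smul {n : ℕ} (c : 𝕜) (F : (Fin n → ι) → 𝕜) (x : Fin n → ι) :
    alt (fun y => c * F y) x = c * alt F x := by
  simp only [alt, Finset.mul_sum]
  exact Finset.sum_congr rfl fun σ _ => by ring

theorem alt_sum {n : ℕ} {κ : Type*} (s : Finset κ) (F : κ → (Fin n → ι) → 𝕜) (x : Fin n → ι) :
    alt (fun y => ∑ k ∈ s, F k y) x = ∑ k ∈ s, alt (F k) x := by
  simp only [alt, Finset.mul_sum]
  exact Finset.sum_comm

/-- Replacing a factor depending on the last positions only by its alternating sum. -/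
theorem alt_mul_alt {r k : ℕ} (A : (Fin r → ι) → 𝕜) (B : (Fin k → ι) → 𝕜) (x : Fin (r + k) → ι) :
    alt (fun y => A (y ∘ Fin.castAdd k) * alt B (y ∘ Fin.natAdd r)) x =
      k.factorial * alt (fun y => A (y ∘ Fin.castAdd k) * B (y ∘ Fin.natAdd r)) x := by
  have h1 : ∀ y : Fin (r + k) → ι, A (y ∘ Fin.castAdd k) * alt B (y ∘ Fin.natAdd r) =
      ∑ τ : Perm (Fin k), ((Perm.sign τ : ℤ) : 𝕜) *
        (A (y ∘ Fin.castAdd k) * B (y ∘ Fin.natAdd r ∘ τ)) := by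
    intro y
    rw [alt, Finset.mul_sum]
    exact Finset.sum_congr rfl fun τ _ => by rw [Function.comp_assoc]; ring
  simp only [h1]
  rw [alt_sum]
  have h2 : ∀ τ : Perm (Fin k), alt (fun y : Fin (r + k) → ι => ((Perm.sign τ : ℤ) : 𝕜) *
        (A (y ∘ Fin.castAdd k) * B (y ∘ Fin.natAdd r ∘ τ))) x =
      alt (fun y => A (y ∘ Fin.castAdd k) * B (y ∘ Fin.natAdd r)) x := by
    intro τ
    rw [alt_smul]
    set ρ : Perm (Fin (r + k)) := finSumFinEquiv.permCongr (Perm.sumCongr 1 τ) with hρ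
    have hl : (ρ : Fin (r + k) → Fin (r + k)) ∘ Fin.castAdd k = Fin.castAdd k := by
      ext i; simp [hρ, Equiv.permCongr_apply]
    have hr : (ρ : Fin (r + k) → Fin (r + k)) ∘ Fin.natAdd r = Fin.natAdd r ∘ τ := by
      ext i; simp [hρ, Equiv.permCongr_apply]
    have hs : Perm.sign ρ = Perm.sign τ := by
      rw [hρ, Perm.sign_permCongr, Perm.sign_sumCongr]; simp
    have := alt_comp (fun y : Fin (r + k) → ι =>
      A (y ∘ Fin.castAdd k) * B (y ∘ Fin.natAdd r)) x ρ
    simp only [Function.comp_assoc, hl, hr, hs] at this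
    rw [this, ← mul_assoc, ← Int.cast_mul, ← Units.val_mul, Int.units_mul_self]
    simp
  rw [Finset.sum_congr rfl fun τ _ => h2 τ]
  simp [Finset.card_univ, Fintype.card_perm]

/-- The product of `g` over the pairs of positions. -/
def pairs {n : ℕ} (g : ι → ι → 𝕜) (y : Fin n → ι) : 𝕜 :=
  ∏ i, ∏ j ∈ Finset.Ioi i, g (y i) (y j)

theorem pairs_comp {n : ℕ} {g : ι → ι → 𝕜} (hg : ∀ a b, g a b = -g b a) (x : Fin n → ι)
    (σ : Perm (Fin n)) : pairs g (x ∘ σ) = ((Perm.sign σ : ℤ) : 𝕜) * pairs g x :=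
  σ.prod_Ioi_comp_eq_sign_mul_prod (f := fun i j => g (x i) (x j)) fun _ _ => hg _ _

theorem pairs_eq_ite {n : ℕ} (g : ι → ι → 𝕜) (y : Fin n → ι) :
    pairs g y = ∏ i, ∏ j, if i < j then g (y i) (y j) else 1 := by
  unfold pairs
  refine Finset.prod_congr rfl fun i _ => ?_
  rw [← Finset.filter_lt_eq_Ioi, Finset.prod_filter]

theorem pairs_add {r k : ℕ} (g : ι → ι → 𝕜) (y : Fin (r + k) → ι) :
    pairs g y = (∏ i : Fin r, ∏ j ∈ Finset.Ioi (Fin.castAdd k i), g (y (Fin.castAdd k i)) (y j)) *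
      pairs g (y ∘ Fin.natAdd r) := by
  rw [pairs_eq_ite, pairs_eq_ite, Fin.prod_univ_add]
  congr 1
  · refine Finset.prod_congr rfl fun i _ => ?_
    rw [← Finset.filter_lt_eq_Ioi, Finset.prod_filter]
  · refine Finset.prod_congr rfl fun i _ => ?_
    rw [Fin.prod_univ_add, Finset.prod_eq_one, one_mul]
    · simp
    · intro j _
      rw [if_neg]
      simp only [Fin.lt_def, Fin.val_natAdd, Fin.val_castAdd]
      omega

theorem pairs_ne_zero {n : ℕ} {g : ι → ι → 𝕜} (hg : ∀ a b, a ≠ b → g a b ≠ 0) {x : Fin n → ι}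
    (hx : Function.Injective x) : pairs g x ≠ 0 :=
  Finset.prod_ne_zero_iff.2 fun _ _ => Finset.prod_ne_zero_iff.2 fun _ hj =>
    hg _ _ (hx.ne (Finset.mem_Ioi.1 hj).ne)

/-- The product of `∏ i, U i` over the pairs of positions `(0, 1), (2, 3), …, (2 m - 2, 2 m - 1)`. -/
def pairing {n m : ℕ} (h : 2 * m ≤ n) (U : Fin m → ι → ι → 𝕜) (y : Fin n → ι) : 𝕜 :=
  ∏ i : Fin m, U i (y ⟨2 * i, by omega⟩) (y ⟨2 * i + 1, by omega⟩)

theorem sum_perm_apply_zero_one {n : ℕ} (φ : Fin (n + 2) → Fin (n + 2) → 𝕜) :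
    ∑ σ : Perm (Fin (n + 2)), φ (σ 0) (σ 1) =
      n.factorial * ∑ a, ∑ b ∈ Finset.univ.erase a, φ a b := by
  rw [← Equiv.sum_comp Perm.decomposeFin.symm, Fintype.sum_prod_type, Finset.mul_sum]
  refine Finset.sum_congr rfl fun p _ => ?_
  simp only [Perm.decomposeFin_symm_apply_zero, Perm.decomposeFin_symm_apply_one]
  rw [← Equiv.sum_comp Perm.decomposeFin.symm, Fintype.sum_prod_type]
  simp only [Perm.decomposeFin_symm_apply_zero]
  simp only [Finset.sum_const, Finset.card_univ, Fintype.card_perm, Fintype.card_fin,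
    nsmul_eq_mul]
  rw [← Finset.mul_sum]
  congr 1
  refine Finset.sum_bij (fun q _ => swap 0 p q.succ) ?_ ?_ ?_ ?_
  · intro q _
    refine Finset.mem_erase.2 ⟨fun e => ?_, Finset.mem_univ _⟩
    have : q.succ = 0 := by
      rw [← (swap 0 p).injective.eq_iff, e, swap_apply_left]
    exact Fin.succ_ne_zero _ this
  · intro q _ q' _ e
    exact Fin.succ_injective _ ((swap 0 p).injective e)
  · intro b hb
    have hb : b ≠ p := Finset.ne_of_mem_erase hb
    have : swap 0 p b ≠ 0 := fun e => hb (by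
      rw [← (swap 0 p).injective.eq_iff, e, swap_apply_right])
    obtain ⟨q, hq⟩ := Fin.exists_succ_eq.2 this
    exact ⟨q, Finset.mem_univ _, by rw [hq, swap_apply_self]⟩
  · intro q _
    rfl

theorem pairing_succ {k m : ℕ} (h : 2 * (m + 1) ≤ 2 + k) (U : ι → ι → 𝕜) (y : Fin (2 + k) → ι) :
    pairing h (fun _ => U) y = U (y (Fin.castAdd k 0)) (y (Fin.castAdd k 1)) *
      pairing (m := m) (n := k) (by omega) (fun _ => U) (y ∘ Fin.natAdd 2) := by
  unfold pairing
  rw [Fin.prod_univ_succ]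
  congr 1
  refine Finset.prod_congr rfl fun i _ => ?_
  simp only [Function.comp]
  congr 2 <;> ext <;> simp <;> omega

variable [DecidableEq ι] {g l : ι → ι → 𝕜}

/-- Deleting the first two positions divides the product by g at that pair and by every factor
joining the pair to the rest. This turns the pfaffian recursion into a sum of pair weights. -/
theorem AddSystem.pairs_two_add (H : AddSystem g l) {k : ℕ} {y : Fin (2 + k) → ι}
    (hy : Function.Injective y) :
    pairs g (y ∘ Fin.natAdd 2) = pairs g y *
      ((g (y (Fin.castAdd k 0)) (y (Fin.castAdd k 1)))⁻¹ *
      AddSystem.pairWeight g (Finset.univ.image y) (y (Fin.castAdd k 0)) (y (Fin.castAdd k 1))) := by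
  have h01 : y (Fin.castAdd k 0) ≠ y (Fin.castAdd k 1) := hy.ne (by simp [Fin.ext_iff])
  have hw : AddSystem.pairWeight g (Finset.univ.image y) (y (Fin.castAdd k 0))
      (y (Fin.castAdd k 1)) = ∏ j : Fin k, (g (y (Fin.castAdd k 0)) (y (Fin.natAdd 2 j)))⁻¹ *
        (g (y (Fin.castAdd k 1)) (y (Fin.natAdd 2 j)))⁻¹ := by
    unfold AddSystem.pairWeight
    have : ((Finset.univ.image y).erase (y (Fin.castAdd k 0))).erase (y (Fin.castAdd k 1)) =
        Finset.univ.image (fun j : Fin k => y (Fin.natAdd 2 j)) := by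
      ext b
      simp only [Finset.mem_erase, Finset.mem_image, Finset.mem_univ, true_and]
      constructor
      · rintro ⟨h1, h0, a, rfl⟩
        induction a using Fin.addCases with
        | left i =>
          fin_cases i
          · exact absurd rfl h0
          · exact absurd rfl h1
        | right j => exact ⟨j, rfl⟩
      · rintro ⟨j, rfl⟩
        refine ⟨hy.ne ?_, hy.ne ?_, _, rfl⟩ <;> (simp [Fin.ext_iff]; try omega)
    rw [this, Finset.prod_image]
    intro a _ b _ e
    simpa using hy e
  have h0 : Finset.Ioi (Fin.castAdd k (0 : Fin 2)) =
      insert (Fin.castAdd k 1) (Finset.univ.image (Fin.natAdd (m := k) 2)) := by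
    ext b
    induction b using Fin.addCases with
    | left i => fin_cases i <;> simp [Fin.ext_iff, Fin.lt_def]
    | right j => simp [Fin.ext_iff, Fin.lt_def]
  have h1 : Finset.Ioi (Fin.castAdd k (1 : Fin 2)) =
      Finset.univ.image (Fin.natAdd (m := k) 2) := by
    ext b
    induction b using Fin.addCases with
    | left i => fin_cases i <;> (simp [Fin.ext_iff, Fin.lt_def]; try omega)
    | right j => simp [Fin.ext_iff, Fin.lt_def]; omega
  have hinj : Function.Injective (Fin.natAdd (m := k) 2) := fun a b e => by simpa using e
  rw [hw, pairs_add, Fin.prod_univ_two, h0, h1, Finset.prod_insert, Finset.prod_image hinj.injOn,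
    Finset.prod_image hinj.injOn, Finset.prod_mul_distrib, Finset.prod_inv_distrib,
    Finset.prod_inv_distrib]
  · have n0 := H.ne_zero _ _ h01
    have n1 : ∏ j : Fin k, g (y (Fin.castAdd k 0)) (y (Fin.natAdd 2 j)) ≠ 0 :=
      Finset.prod_ne_zero_iff.2 fun j _ => H.ne_zero _ _ (hy.ne (by simp [Fin.ext_iff]; omega))
    have n2 : ∏ j : Fin k, g (y (Fin.castAdd k 1)) (y (Fin.natAdd 2 j)) ≠ 0 :=
      Finset.prod_ne_zero_iff.2 fun j _ => H.ne_zero _ _ (hy.ne (by simp [Fin.ext_iff]; omega))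
    field_simp
  · simp [Fin.ext_iff]; omega

/-- The recursion step common to the two pfaffian evaluations. -/
theorem AddSystem.alt_pairing_step (H : AddSystem g l) {k m : ℕ} (hm : 2 * m ≤ k) {U : ι → ι → 𝕜}
    (C w : 𝕜) (ih : ∀ x : Fin k → ι, Function.Injective x →
      alt (pairing hm fun _ => U) x = C * pairs g x)
    {x : Fin (2 + k) → ι} (hx : Function.Injective x)
    (hw : ∑ a ∈ Finset.univ.image x, ∑ b ∈ (Finset.univ.image x).erase a,
      U a b / g a b * AddSystem.pairWeight g (Finset.univ.image x) a b = w) [CharZero 𝕜] :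
    alt (pairing (m := m + 1) (by omega) fun _ => U) x = w * C * pairs g x := by
  have hk : (k.factorial : 𝕜) ≠ 0 := Nat.cast_ne_zero.2 k.factorial_ne_zero
  -- The factor k! produced by `alt_mul_alt` is also the number of permutations with prescribed
  -- values at the first two positions.
  refine mul_left_cancel₀ hk ?_
  have e1 := alt_mul_alt (fun z : Fin 2 → ι => U (z 0) (z 1)) (pairing hm fun _ => U) x
  have e2 : alt (pairing (m := m + 1) (by omega) fun _ => U) x =
      alt (fun y : Fin (2 + k) → ι => U ((y ∘ Fin.castAdd k) 0) ((y ∘ Fin.castAdd k) 1) *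
        pairing hm (fun _ => U) (y ∘ Fin.natAdd 2)) x :=
    alt_congr fun σ => pairing_succ (by omega) U _
  rw [e2, ← e1]
  set S := Finset.univ.image x with hS
  have e3 : ∀ σ : Perm (Fin (2 + k)), ((Perm.sign σ : ℤ) : 𝕜) *
      (U (((x ∘ σ) ∘ Fin.castAdd k) 0) (((x ∘ σ) ∘ Fin.castAdd k) 1) *
        alt (pairing hm fun _ => U) ((x ∘ σ) ∘ Fin.natAdd 2)) = C * pairs g x *
      (fun a b => U (x a) (x b) / g (x a) (x b) * AddSystem.pairWeight g S (x a) (x b))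
        (σ (Fin.castAdd k 0)) (σ (Fin.castAdd k 1)) := by
    intro σ
    have hy : Function.Injective (x ∘ σ) := hx.comp σ.injective
    have himg : Finset.univ.image (x ∘ σ) = S := by
      rw [hS, ← Finset.image_image, Finset.image_univ_of_surjective σ.surjective]
    rw [ih _ (hy.comp fun a b e => by simpa using e), H.pairs_two_add hy, pairs_comp H.anti, himg]
    have : ((Perm.sign σ : ℤ) : 𝕜) * ((Perm.sign σ : ℤ) : 𝕜) = 1 := by
      rw [← Int.cast_mul, ← Units.val_mul, Int.units_mul_self]; simp
    simp only [Function.comp]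
    linear_combination (C * pairs g x * U (x (σ (Fin.castAdd k 0))) (x (σ (Fin.castAdd k 1))) *
      ((g (x (σ (Fin.castAdd k 0))) (x (σ (Fin.castAdd k 1))))⁻¹ *
      AddSystem.pairWeight g S (x (σ (Fin.castAdd k 0))) (x (σ (Fin.castAdd k 1))))) * this
  rw [alt, Finset.sum_congr rfl fun σ _ => e3 σ, ← Finset.mul_sum]
  have count : ∀ (N : ℕ) (hN : N = k + 2) (φ : Fin N → Fin N → 𝕜),
      ∑ σ : Perm (Fin N), φ (σ ⟨0, by omega⟩) (σ ⟨1, by omega⟩) =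
        k.factorial * ∑ a, ∑ b ∈ Finset.univ.erase a, φ a b := by
    rintro N rfl φ
    exact sum_perm_apply_zero_one φ
  have e4 := count (2 + k) (by omega) fun a b =>
    U (x a) (x b) / g (x a) (x b) * AddSystem.pairWeight g S (x a) (x b)
  have e5 : ∑ a, ∑ b ∈ Finset.univ.erase a,
      U (x a) (x b) / g (x a) (x b) * AddSystem.pairWeight g S (x a) (x b) = w := by
    rw [← hw, hS, Finset.sum_image hx.injOn]
    refine Finset.sum_congr rfl fun a _ => ?_
    rw [← Finset.image_erase hx, Finset.sum_image hx.injOn]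
  rw [e5] at e4
  refine (congrArg _ e4).trans ?_
  ring

/-- Evaluation of the pfaffian of `g`, in even dimension. -/
theorem AddSystem.alt_pairing_even (H : AddSystem g l) [CharZero 𝕜] (m : ℕ) :
    ∀ {n : ℕ} (hn : n = 2 * m) (x : Fin n → ι), Function.Injective x →
      alt (pairing hn.ge fun _ => g) x = 2 ^ m * m.factorial * pairs g x := by
  induction m with
  | zero =>
    rintro _ rfl x _
    simp [alt, pairing, pairs]
  | succ m ih =>
    intro n hn x hx
    obtain ⟨k, rfl⟩ : ∃ k, n = 2 + k := ⟨n - 2, by omega⟩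
    have hk : k = 2 * m := by omega
    rw [H.alt_pairing_step hk.ge _ (2 + k : ℕ) (ih hk) hx]
    · subst hk; push_cast [Nat.factorial_succ]; ring
    · have hc : (Finset.univ.image x).card = 2 + k := by
        rw [Finset.card_image_of_injective _ hx]; simp
      rw [← congrArg (Nat.cast (R := 𝕜)) hc,
        ← H.sum_pairWeight_even (S := Finset.univ.image x) (k := m + 1) (by omega)]
      refine Finset.sum_congr rfl fun a _ => Finset.sum_congr rfl fun b hb => ?_
      rw [div_self (H.ne_zero _ _ (Finset.ne_of_mem_erase hb).symm), one_mul]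

/-- Evaluation of the bordered pfaffian of `l`, in odd dimension. -/
theorem AddSystem.alt_pairing_odd (H : AddSystem g l) [CharZero 𝕜] (hl : ∀ a b, l a b = -l b a)
    (m : ℕ) : ∀ {n : ℕ} (hn : n = 2 * m + 1) (x : Fin n → ι), Function.Injective x →
      alt (pairing (m := m) (by omega) fun _ => l) x = 2 ^ m * m.factorial * pairs g x := by
  induction m with
  | zero =>
    rintro _ rfl x _
    simp [alt, pairing, pairs]
  | succ m ih =>
    intro n hn x hx
    obtain ⟨k, rfl⟩ : ∃ k, n = 2 + k := ⟨n - 2, by omega⟩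
    have hk : k = 2 * m + 1 := by omega
    -- With k = 2m + 1 the total weight is (2 + k) - 1 = 2(m + 1), as in the even case, so both
    -- evaluations have the same constant.
    rw [H.alt_pairing_step _ _ ((2 + k : ℕ) - 1) (ih hk) hx]
    · subst hk; push_cast [Nat.factorial_succ]; ring
    · have hc : (Finset.univ.image x).card = 2 + k := by
        rw [Finset.card_image_of_injective _ hx]; simp
      refine (H.sum_pairWeight_odd (S := Finset.univ.image x) (k := m + 1) (by omega) hl).trans ?_
      rw [hc]

end Alternant

/-! ### Symmetries of alternating sums over pairings. -/

section PairPermutations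

open Equiv

variable {ι 𝕜 : Type*} [Field 𝕜]

/-- Exchanging two whole pairs is a product of two transpositions, so any rearrangement of the pairs
is even. -/
theorem exists_pair_perm {n m : ℕ} (h : 2 * m ≤ n) (π : Perm (Fin m)) :
    ∃ ρ : Perm (Fin n), Perm.sign ρ = 1 ∧ ∀ i : Fin m,
      ρ ⟨2 * i, by omega⟩ = ⟨2 * π i, by omega⟩ ∧
      ρ ⟨2 * i + 1, by omega⟩ = ⟨2 * π i + 1, by omega⟩ := by
  induction π using Perm.swap_induction_on with
  | one => exact ⟨1, by simp, fun i => by simp⟩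
  | swap_mul f i j hij ih =>
    obtain ⟨ρ, hρ, hr⟩ := ih
    have hij' : (i : ℕ) ≠ j := fun e => hij (Fin.ext e)
    refine ⟨swap ⟨2 * i, by omega⟩ ⟨2 * j, by omega⟩ *
      swap ⟨2 * i + 1, by omega⟩ ⟨2 * j + 1, by omega⟩ * ρ, ?_, fun a => ?_⟩
    · rw [Perm.sign_mul, Perm.sign_mul, hρ, Perm.sign_swap (by simpa [Fin.ext_iff] using hij'),
        Perm.sign_swap (by simpa [Fin.ext_iff] using hij')]
      simp
    · simp only [Perm.mul_apply, (hr a).1, (hr a).2, swap_apply_def, Fin.ext_iff]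
      constructor <;> split_ifs <;> simp_all <;> omega

theorem alt_pairing_perm {n m : ℕ} (h : 2 * m ≤ n) (U : Fin m → ι → ι → 𝕜) (π : Perm (Fin m))
    (x : Fin n → ι) : alt (pairing h (U ∘ π)) x = alt (pairing h U) x := by
  obtain ⟨ρ, hρ, hr⟩ := exists_pair_perm h π⁻¹
  have := alt_comp (pairing h U) x ρ
  rw [hρ, Units.val_one, Int.cast_one, one_mul] at this
  rw [← this]
  refine alt_congr fun σ => ?_
  unfold pairing
  symm
  rw [← Equiv.prod_comp π]
  refine Finset.prod_congr rfl fun i _ => ?_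
  simp [hr]

/-- The hypothesis says that exchanging the first entries of pairs i and j preserves the product,
and this exchange is a transposition. It will hold for monomials with equal exponents. -/
theorem alt_pairing_eq_zero [CharZero 𝕜] {n m : ℕ} (h : 2 * m ≤ n) {U : Fin m → ι → ι → 𝕜}
    {i j : Fin m} (hij : i ≠ j)
    (hU : ∀ a b a' b', U i a b * U j a' b' = U i a' b * U j a b') (x : Fin n → ι) :
    alt (pairing h U) x = 0 := by
  have hij' : (i : ℕ) ≠ j := fun e => hij (Fin.ext e)
  have := alt_comp (pairing h U) x (swap ⟨2 * i, by omega⟩ ⟨2 * j, by omega⟩)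
  rw [Perm.sign_swap (by simpa [Fin.ext_iff] using hij')] at this
  have e : alt (fun y => pairing h U
      (y ∘ (swap ⟨2 * i, by omega⟩ ⟨2 * j, by omega⟩ : Perm (Fin n)))) x =
      alt (pairing h U) x := by
    refine alt_congr fun σ => ?_
    unfold pairing
    have hj : j ∈ Finset.univ.erase i := by simp [hij.symm]
    rw [← Finset.mul_prod_erase _ _ (Finset.mem_univ i), ← Finset.mul_prod_erase _ _ hj,
      ← Finset.mul_prod_erase _ _ (Finset.mem_univ i), ← Finset.mul_prod_erase _ _ hj,
      ← mul_assoc, ← mul_assoc]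
    congr 1
    · simp only [Function.comp]
      rw [swap_apply_left, swap_apply_right, swap_apply_of_ne_of_ne, swap_apply_of_ne_of_ne, hU]
      all_goals simp [Fin.ext_iff]; try omega
    · refine Finset.prod_congr rfl fun a ha => ?_
      simp only [Finset.mem_erase, Fin.ext_iff, ne_eq, Finset.mem_univ, and_true] at ha
      simp only [Function.comp]
      rw [swap_apply_of_ne_of_ne, swap_apply_of_ne_of_ne]
      all_goals simp [Fin.ext_iff]; omega
  rw [e] at this
  simp only [Units.val_neg, Units.val_one, Int.cast_neg, Int.cast_one, neg_mul, one_mul] at this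
  exact self_eq_neg.1 this

theorem pairing_update {n m : ℕ} (h : 2 * m ≤ n) (U : Fin m → ι → ι → 𝕜) (j : Fin m)
    (C : ι → ι → 𝕜) (y : Fin n → ι) :
    pairing h (Function.update U j C) y = C (y ⟨2 * j, by omega⟩) (y ⟨2 * j + 1, by omega⟩) *
      ∏ i ∈ Finset.univ.erase j, U i (y ⟨2 * i, by omega⟩) (y ⟨2 * i + 1, by omega⟩) := by
  unfold pairing
  rw [← Finset.mul_prod_erase _ _ (Finset.mem_univ j), Function.update_self]
  congr 1
  exact Finset.prod_congr rfl fun i hi => by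
    rw [Function.update_of_ne (Finset.ne_of_mem_erase hi)]

theorem alt_pairing_transpose {n m : ℕ} (h : 2 * m ≤ n) (U : Fin m → ι → ι → 𝕜) (j : Fin m)
    (C : ι → ι → 𝕜) (x : Fin n → ι) :
    alt (pairing h (Function.update U j fun a b => C b a)) x =
      -alt (pairing h (Function.update U j C)) x := by
  have := alt_comp (pairing h (Function.update U j C)) x
    (swap ⟨2 * j, by omega⟩ ⟨2 * j + 1, by omega⟩)
  rw [Perm.sign_swap (by simp [Fin.ext_iff])] at this
  simp only [Units.val_neg, Units.val_one, Int.cast_neg, Int.cast_one, neg_mul, one_mul] at this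
  rw [← this]
  refine alt_congr fun σ => ?_
  rw [pairing_update, pairing_update]
  congr 1
  · simp [swap_apply_left, swap_apply_right]
  · refine Finset.prod_congr rfl fun i hi => ?_
    simp only [Finset.mem_erase, Fin.ext_iff, ne_eq, Finset.mem_univ, and_true] at hi
    simp only [Function.comp]
    rw [swap_apply_of_ne_of_ne, swap_apply_of_ne_of_ne]
    all_goals simp [Fin.ext_iff]; omega

/-- Only the antisymmetric part of a kernel contributes, since transposing the kernel of one pair
changes the sign. The kernels are replaced one pair at a time. -/
theorem alt_pairing_antisymmetrize [CharZero 𝕜] {n m : ℕ} (h : 2 * m ≤ n) {M M' : ι → ι → 𝕜}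
    (hM : ∀ a b, 2 * M' a b = M a b - M b a) (x : Fin n → ι) :
    alt (pairing h fun _ => M') x = alt (pairing h fun _ => M) x := by
  have key : ∀ T : Finset (Fin m),
      alt (pairing h fun i => if i ∈ T then M' else M) x = alt (pairing h fun _ => M) x := by
    intro T
    induction T using Finset.induction_on with
    | empty => simp
    | insert j T hj ih =>
      rw [← ih]
      set U : Fin m → ι → ι → 𝕜 := fun i => if i ∈ T then M' else M with hU
      have h1 : (fun i => if i ∈ insert j T then M' else M) = Function.update U j M' := by
        ext i : 1
        by_cases e : i = j
        · subst e; simp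
        · simp [e, hU]
      have h2 : U = Function.update U j M := by
        rw [eq_comm, Function.update_eq_self_iff]; simp [hU, hj]
      rw [h1]
      conv_rhs => rw [h2]
      have h3 : 2 * alt (pairing h (Function.update U j M')) x =
          alt (pairing h (Function.update U j M)) x -
          alt (pairing h (Function.update U j fun a b => M b a)) x := by
        simp only [alt, Finset.mul_sum, ← Finset.sum_sub_distrib]
        refine Finset.sum_congr rfl fun σ _ => ?_
        rw [pairing_update, pairing_update, pairing_update]
        linear_combination (((Perm.sign σ : ℤ) : 𝕜) * ∏ i ∈ Finset.univ.erase j,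
          U i ((x ∘ σ) ⟨2 * i, by omega⟩) ((x ∘ σ) ⟨2 * i + 1, by omega⟩)) *
          hM ((x ∘ σ) ⟨2 * j, by omega⟩) ((x ∘ σ) ⟨2 * j + 1, by omega⟩)
      rw [alt_pairing_transpose h U j M] at h3
      refine mul_left_cancel₀ (two_ne_zero (α := 𝕜)) ?_
      rw [h3]; ring
  simpa using key Finset.univ

theorem exists_perm_mem_iff {m : ℕ} (T : Finset (Fin m)) :
    ∃ π : Perm (Fin m), ∀ i, π i ∈ T ↔ (i : ℕ) < T.card := by
  have hT : T.card ≤ m := by simpa using T.card_le_univ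
  have hc : Fintype.card {i : Fin m // (i : ℕ) < T.card} = Fintype.card {i // i ∈ T} := by
    rw [Fintype.card_coe]
    refine Eq.trans ?_ (Fintype.card_fin T.card)
    exact Fintype.card_congr (β := Fin T.card)
      ⟨fun i => ⟨i, i.2⟩, fun i => ⟨⟨i, by omega⟩, i.2⟩, fun _ => rfl, fun _ => rfl⟩
  let e := Fintype.equivOfCardEq hc
  refine ⟨e.extendSubtype, fun i => ⟨fun hi => ?_, fun hi => e.extendSubtype_mem _ hi⟩⟩
  by_contra hn
  exact e.extendSubtype_not_mem _ hn hi

/-- A binomial theorem: which pairs carry A is irrelevant by `alt_pairing_perm`, so only their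
number s matters and they may be taken to be the first ones. -/
theorem alt_pairing_add {n m : ℕ} (h : 2 * m ≤ n) (A B : ι → ι → 𝕜) (x : Fin n → ι) :
    alt (pairing h fun _ a b => A a b + B a b) x =
      ∑ s ∈ Finset.range (m + 1),
        (m.choose s : 𝕜) * alt (pairing h fun i => if (i : ℕ) < s then A else B) x := by
  have e : ∀ y : Fin n → ι, pairing h (fun _ a b => A a b + B a b) y =
      ∑ T ∈ (Finset.univ : Finset (Fin m)).powerset,
        pairing h (fun i => if i ∈ T then A else B) y := by
    intro y
    unfold pairing
    rw [Finset.prod_add]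
    refine Finset.sum_congr rfl fun T _ => ?_
    rw [← Finset.prod_sdiff (Finset.subset_univ T), mul_comm]
    congr 1
    · exact Finset.prod_congr rfl fun i hi => by simp [(Finset.mem_sdiff.1 hi).2]
    · exact Finset.prod_congr rfl fun i hi => by simp [hi]
  rw [alt_congr (G := fun y => ∑ T ∈ (Finset.univ : Finset (Fin m)).powerset,
        pairing h (fun i => if i ∈ T then A else B) y) fun σ => e _, alt_sum,
    Finset.sum_powerset]
  rw [Finset.card_univ, Fintype.card_fin]
  refine Finset.sum_congr rfl fun s _ => ?_
  have : ∀ T ∈ Finset.powersetCard s (Finset.univ : Finset (Fin m)),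
      alt (pairing h fun i => if i ∈ T then A else B) x =
        alt (pairing h fun i => if (i : ℕ) < s then A else B) x := by
    intro T hT
    obtain ⟨π, hπ⟩ := exists_perm_mem_iff T
    rw [(Finset.mem_powersetCard.1 hT).2] at hπ
    rw [← alt_pairing_perm h _ π]
    congr 2
    ext i : 1
    simp [hπ]
  rw [Finset.sum_congr rfl this, Finset.sum_const, Finset.card_powersetCard, Finset.card_univ,
    Fintype.card_fin, nsmul_eq_mul]

end PairPermutations

/-! ### Schur's Q-polynomials as alternating sums over pairings. -/

section SchurQ

open Equiv

/-- The positions 0, 1, 2, 3, … go to 0, r-1, 1, r-2, …, which brings the exponents k_i and -k_i of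
`symmetrize` side by side. In the induction, 0 stays fixed and the next position is carried to the
end by a cycle of odd length r + 1, an even permutation. -/
theorem exists_nested_perm (s : ℕ) : ∀ r, r = 2 * s → ∃ π : Perm (Fin r), Perm.sign π = 1 ∧
    ∀ i : Fin r, (π i : ℕ) = if (i : ℕ) % 2 = 0 then (i : ℕ) / 2 else r - 1 - (i : ℕ) / 2 := by
  induction s with
  | zero => rintro _ rfl; exact ⟨1, by simp, fun i => i.elim0⟩
  | succ s ih =>
    intro r hr
    obtain ⟨r, rfl⟩ : ∃ r', r = r' + 2 := ⟨r - 2, by omega⟩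
    obtain ⟨π, hs, hπ⟩ := ih r (by omega)
    refine ⟨Perm.decomposeFin.symm (0, (finRotate (r + 1))⁻¹ * Perm.decomposeFin.symm (0, π)),
      ?_, ?_⟩
    · have he : Even r := ⟨s, by omega⟩
      rw [Perm.decomposeFin.symm_sign, if_pos rfl, Perm.sign_mul, Perm.sign_inv, sign_finRotate,
        Perm.decomposeFin.symm_sign, if_pos rfl, hs]
      simp [he.neg_one_pow]
    · intro i
      refine Fin.cases ?_ (fun i => ?_) i
      · simp
      rw [Perm.decomposeFin_symm_apply_succ, swap_self, Perm.mul_apply]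
      refine Fin.cases ?_ (fun i => ?_) i
      · rw [Perm.decomposeFin_symm_apply_zero]
        have : (finRotate (r + 1))⁻¹ 0 = Fin.last r := by
          rw [Perm.inv_eq_iff_eq, finRotate_last]
        rw [this]
        simp
      · rw [Perm.decomposeFin_symm_apply_succ, swap_self]
        have : (finRotate (r + 1))⁻¹ (π i).succ = (π i).castSucc := by
          rw [Perm.inv_eq_iff_eq]
          ext
          simp
        simp only [Equiv.refl_apply, this, Fin.val_succ, Fin.val_castSucc, hπ]
        have := i.2
        split_ifs <;> omega

theorem alt_mul_comp_perm {ι 𝕜 : Type*} [Field 𝕜] {r k : ℕ} (A : (Fin r → ι) → 𝕜)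
    (B : (Fin k → ι) → 𝕜) (x : Fin (r + k) → ι) (π : Perm (Fin r)) :
    alt (fun y => A ((y ∘ Fin.castAdd k) ∘ π) * B (y ∘ Fin.natAdd r)) x =
      ((Perm.sign π : ℤ) : 𝕜) * alt (fun y => A (y ∘ Fin.castAdd k) * B (y ∘ Fin.natAdd r)) x := by
  set ρ : Perm (Fin (r + k)) := finSumFinEquiv.permCongr (Perm.sumCongr π 1) with hρ
  have hl : (ρ : Fin (r + k) → Fin (r + k)) ∘ Fin.castAdd k = Fin.castAdd k ∘ π := by
    ext i; simp [hρ, Equiv.permCongr_apply]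
  have hr : (ρ : Fin (r + k) → Fin (r + k)) ∘ Fin.natAdd r = Fin.natAdd r := by
    ext i; simp [hρ, Equiv.permCongr_apply]
  have hs : Perm.sign ρ = Perm.sign π := by
    rw [hρ, Perm.sign_permCongr, Perm.sign_sumCongr]; simp
  have := alt_comp (fun y : Fin (r + k) → ι =>
    A (y ∘ Fin.castAdd k) * B (y ∘ Fin.natAdd r)) x ρ
  simp only [Function.comp_assoc, hl, hr, hs] at this
  exact this

variable {ι : Type*} {v : ι → ℝ}

/-- The kernel of Schur's pfaffian. -/
noncomputable def schurKernel (v : ι → ℝ) (a b : ι) : ℝ := (v a - v b) / (v a + v b)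

theorem schurKernel_anti (a b : ι) : schurKernel v a b = -schurKernel v b a := by
  unfold schurKernel
  rw [add_comm (v b), ← neg_div, neg_sub]

/-- With v = e^u the kernel is tanh of half the difference of the u; its addition formula closes up
with l = g. This is also the elliptic system degenerated to q = 0. -/
theorem addSystem_schurKernel (hv : ∀ a, 0 < v a) (hi : Function.Injective v) :
    AddSystem (schurKernel v) (schurKernel v) where
  anti := schurKernel_anti
  ne_zero a b hab := div_ne_zero (sub_ne_zero.2 (hi.ne hab)) (add_pos (hv a) (hv b)).ne'
  add a b c _ _ _ := by
    have ha := hv a; have hb := hv b; have hc := hv c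
    unfold schurKernel
    field_simp
    ring
  four_term x a b c _ _ _ _ _ _ := by
    have hx := hv x; have ha := hv a; have hb := hv b; have hc := hv c
    unfold schurKernel
    field_simp
    ring

/-- The factors of Q are inverses of Schur's kernel, and those with i among the first r positions
are all pairs except the pairs inside the last k. So their product is a quotient of two products
over pairs; the denominator is alternating and leaves the sum up to the sign of σ. -/
theorem schurQ_eq_alt {r k n : ℕ} (hn : n = r + k) (h : r ≤ n) (lam : Fin r → ℤ)
    (hv : ∀ a, 0 < v a) (hi : Function.Injective v) {x : Fin (r + k) → ι}
    (hx : Function.Injective x) :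
    SumsOfSquares.schurQ h lam (v ∘ x ∘ Fin.cast hn) =
      2 ^ r / k.factorial * (pairs (schurKernel v) x)⁻¹ *
        alt (fun y => (∏ i, v ((y ∘ Fin.castAdd k) i) ^ lam i) *
          pairs (schurKernel v) (y ∘ Fin.natAdd r)) x := by
  classical
  subst hn
  have H := addSystem_schurKernel hv hi
  unfold SumsOfSquares.schurQ
  have key : ∀ σ : Perm (Fin (r + k)),
      SumsOfSquares.schurQTerm h lam (fun i => (v ∘ x ∘ Fin.cast rfl) (σ i)) =
      (pairs (schurKernel v) x)⁻¹ * (((Perm.sign σ : ℤ) : ℝ) *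
        ((∏ i, v (((x ∘ σ) ∘ Fin.castAdd k) i) ^ lam i) *
          pairs (schurKernel v) ((x ∘ σ) ∘ Fin.natAdd r))) := by
    intro σ
    have hy : Function.Injective (x ∘ σ) := hx.comp σ.injective
    unfold SumsOfSquares.schurQTerm
    have e1 : ∏ i : Fin r, ∏ j ∈ Finset.Ioi (Fin.castLE h i),
        ((v ∘ x ∘ Fin.cast rfl) (σ (Fin.castLE h i)) + (v ∘ x ∘ Fin.cast rfl) (σ j)) /
        ((v ∘ x ∘ Fin.cast rfl) (σ (Fin.castLE h i)) - (v ∘ x ∘ Fin.cast rfl) (σ j)) =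
        (∏ i : Fin r, ∏ j ∈ Finset.Ioi (Fin.castAdd k i),
          schurKernel v ((x ∘ σ) (Fin.castAdd k i)) ((x ∘ σ) j))⁻¹ := by
      rw [← Finset.prod_inv_distrib]
      refine Finset.prod_congr rfl fun i _ => ?_
      rw [← Finset.prod_inv_distrib]
      refine Finset.prod_congr rfl fun j _ => ?_
      rw [schurKernel, inv_div]
      rfl
    rw [e1]
    have e2 := pairs_add (schurKernel v) (x ∘ σ)
    have e3 := pairs_comp H.anti x σ
    have n1 := pairs_ne_zero H.ne_zero hx
    have n2 := pairs_ne_zero H.ne_zero hy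
    have n3 : pairs (schurKernel v) ((x ∘ σ) ∘ Fin.natAdd r) ≠ 0 :=
      pairs_ne_zero H.ne_zero (hy.comp fun a b e => by simpa using e)
    set P := ∏ i : Fin r, ∏ j ∈ Finset.Ioi (Fin.castAdd k i),
          schurKernel v ((x ∘ σ) (Fin.castAdd k i)) ((x ∘ σ) j)
    have n4 : P ≠ 0 := fun e => n2 (by rw [e2, e, zero_mul])
    have e4 : (pairs (schurKernel v) x)⁻¹ * (((Perm.sign σ : ℤ) : ℝ)) *
        pairs (schurKernel v) ((x ∘ σ) ∘ Fin.natAdd r) = P⁻¹ := by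
      have : ((Perm.sign σ : ℤ) : ℝ) * ((Perm.sign σ : ℤ) : ℝ) = 1 := by
        rw [← Int.cast_mul, ← Units.val_mul, Int.units_mul_self]; simp
      rw [e3] at e2
      field_simp
      linear_combination (-((Perm.sign σ : ℤ) : ℝ)) * e2 + pairs (schurKernel v) x * this
    rw [← e4]
    have e5 : ∏ i : Fin r, (v ∘ x ∘ Fin.cast rfl) (σ (Fin.castLE h i)) ^ lam i =
      ∏ i : Fin r, v (((x ∘ σ) ∘ Fin.castAdd k) i) ^ lam i := rfl
    rw [e5]
    ring
  rw [Finset.sum_congr rfl fun σ _ => key σ, ← Finset.mul_sum, alt, Nat.add_sub_cancel_left]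
  ring

/-- The pairwise monomials `(v a / v b) ^ k i`. -/
noncomputable def ratioPow (v : ι → ℝ) (k : ℕ) (a b : ι) : ℝ := (v a / v b) ^ k

/-- The first `s` pairs carry `U`, the others Schur's kernel. -/
noncomputable def mixed (v : ι → ℝ) {s : ℕ} (m : ℕ) (U : Fin s → ι → ι → ℝ) (i : Fin m) : ι → ι → ℝ :=
  if h : (i : ℕ) < s then U ⟨i, h⟩ else schurKernel v

theorem prod_symmetrize {s r : ℕ} (hr : r = s + s) (k : Fin s → ℕ)
    (π : Perm (Fin r)) (hπ : ∀ i : Fin r,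
      (π i : ℕ) = if (i : ℕ) % 2 = 0 then (i : ℕ) / 2 else r - 1 - (i : ℕ) / 2)
    (y : Fin r → ι) :
    ∏ i, v (y i) ^ SumsOfSquares.symmetrize k (Fin.cast hr i) =
      pairing (by omega) (fun i => ratioPow v (k i)) (y ∘ π) := by
  subst hr
  rw [Fin.prod_univ_add, ← Equiv.prod_comp (Fin.revPerm (n := s)) (fun i => v (y (Fin.natAdd s i)) ^
    SumsOfSquares.symmetrize k (Fin.cast rfl (Fin.natAdd s i))), ← Finset.prod_mul_distrib]
  unfold pairing
  refine Finset.prod_congr rfl fun i _ => ?_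
  have h0 : π ⟨2 * i, by omega⟩ = Fin.castAdd s i := by
    ext; rw [hπ]; simp
  have h1 : π ⟨2 * i + 1, by omega⟩ = Fin.natAdd s i.rev := by
    ext; rw [hπ]
    have := i.2
    simp only [Fin.val_natAdd, Fin.val_rev]
    split_ifs <;> omega
  simp only [Function.comp, h0, h1, SumsOfSquares.symmetrize, Fin.cast_eq_self, Fin.append_left,
    Fin.append_right, Fin.revPerm_apply, Fin.rev_rev, ratioPow, div_pow, zpow_neg, zpow_natCast]
  rw [div_eq_mul_inv]

/-- `Q` at `(k_1, …, k_s, -k_s, …, -k_1)` as an alternating sum of products over pairs. -/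
theorem schurQ_symmetrize [DecidableEq ι] {s u m n e : ℕ} (hm : m = s + u) (he : e ≤ 1)
    (hn : n = 2 * m + e) (h : s + s ≤ n) (k : Fin s → ℕ)
    (hv : ∀ a, 0 < v a) (hi : Function.Injective v) {x : Fin n → ι} (hx : Function.Injective x) :
    SumsOfSquares.schurQ h (SumsOfSquares.symmetrize k) (v ∘ x) =
      4 ^ s / (2 ^ u * u.factorial) * (pairs (schurKernel v) x)⁻¹ *
        alt (pairing (by omega) (mixed v m fun i => ratioPow v (k i))) x := by
  have H := addSystem_schurKernel hv hi
  obtain ⟨w, rfl⟩ : ∃ w, n = (s + s) + w := ⟨n - (s + s), by omega⟩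
  have hw : w = 2 * u + e := by omega
  have := schurQ_eq_alt (v := v) rfl h (SumsOfSquares.symmetrize k) hv hi hx
  rw [show x ∘ Fin.cast rfl = x from rfl] at this
  rw [this]
  obtain ⟨π, hs, hπ⟩ := exists_nested_perm s (s + s) (by omega)
  have e1 : alt (fun y => (∏ i, v ((y ∘ Fin.castAdd w) i) ^ SumsOfSquares.symmetrize k i) *
      pairs (schurKernel v) (y ∘ Fin.natAdd (s + s))) x =
      alt (fun y => pairing (n := s + s) (by omega) (fun i => ratioPow v (k i))
        (y ∘ Fin.castAdd w) * pairs (schurKernel v) (y ∘ Fin.natAdd (s + s))) x := by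
    have := alt_mul_comp_perm (pairing (n := s + s) (m := s) (by omega)
      (fun i => ratioPow v (k i))) (pairs (schurKernel v)) x π
    rw [hs] at this
    simp only [Units.val_one, Int.cast_one, one_mul] at this
    rw [← this]
    refine alt_congr fun σ => ?_
    rw [← prod_symmetrize rfl k π hπ]
    rfl
  rw [e1]
  -- Schur's pfaffian read backwards: the product over pairs of the last w positions becomes an
  -- alternating sum, which `alt_mul_alt` absorbs into the outer one.
  have e2 : alt (fun y => pairing (n := s + s) (by omega) (fun i => ratioPow v (k i))
        (y ∘ Fin.castAdd w) * pairs (schurKernel v) (y ∘ Fin.natAdd (s + s))) x =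
      (2 ^ u * u.factorial : ℝ)⁻¹ * (w.factorial *
        alt (fun y => pairing (n := s + s) (by omega) (fun i => ratioPow v (k i))
        (y ∘ Fin.castAdd w) * pairing (m := u) (by omega) (fun _ => schurKernel v)
          (y ∘ Fin.natAdd (s + s))) x) := by
    rw [← alt_mul_alt, ← alt_smul]
    refine alt_congr fun σ => ?_
    have hy : Function.Injective ((x ∘ σ) ∘ Fin.natAdd (s + s)) :=
      (hx.comp σ.injective).comp fun a b e => by simpa using e
    have hp : alt (pairing (n := w) (m := u) (by omega) (fun _ => schurKernel v))
        ((x ∘ σ) ∘ Fin.natAdd (s + s)) = 2 ^ u * u.factorial *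
          pairs (schurKernel v) ((x ∘ σ) ∘ Fin.natAdd (s + s)) := by
      obtain rfl | rfl : e = 0 ∨ e = 1 := by omega
      · exact H.alt_pairing_even u hw _ hy
      · exact H.alt_pairing_odd schurKernel_anti u hw _ hy
    rw [hp]
    have : (u.factorial : ℝ) ≠ 0 := Nat.cast_ne_zero.2 u.factorial_ne_zero
    field_simp
  rw [e2]
  have e3 : alt (fun y => pairing (n := s + s) (by omega) (fun i => ratioPow v (k i))
        (y ∘ Fin.castAdd w) * pairing (m := u) (by omega) (fun _ => schurKernel v)
          (y ∘ Fin.natAdd (s + s))) x =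
      alt (pairing (by omega) (mixed v m fun i => ratioPow v (k i))) x := by
    refine alt_congr fun σ => ?_
    subst hm
    unfold pairing
    rw [Fin.prod_univ_add]
    congr 1
    · refine Finset.prod_congr rfl fun i _ => ?_
      simp only [mixed, Fin.val_castAdd, i.2, dif_pos]
      rfl
    · refine Finset.prod_congr rfl fun i _ => ?_
      simp only [mixed, Fin.val_natAdd]
      rw [dif_neg (by omega)]
      simp only [Function.comp]
      congr 3 <;> ext <;> simp <;> omega
  rw [e3, show (4 : ℝ) = 2 * 2 by norm_num, mul_pow, ← pow_add]
  have : (w.factorial : ℝ) ≠ 0 := Nat.cast_ne_zero.2 w.factorial_ne_zero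
  field_simp

end SchurQ

/-! ### Summation over decreasing tuples. -/

section TupleSums

open Equiv

theorem summable_norm_prod_apply {s : ℕ} {f : Fin s → ℕ → ℝ} (hf : ∀ i, Summable fun k => ‖f i k‖) :
    (Summable fun k : Fin s → ℕ => ‖∏ i, f i (k i)‖) ∧
      ∑' k : Fin s → ℕ, ∏ i, f i (k i) = ∏ i, ∑' k, f i k := by
  induction s with
  | zero =>
    refine ⟨(hasSum_fintype _).summable, ?_⟩
    rw [tsum_fintype]; simp
  | succ s ih =>
    obtain ⟨h1, h2⟩ := ih (f := fun i => f i.succ) fun i => hf _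
    have hp : (fun k : Fin (s + 1) → ℕ => ∏ i, f i (k i)) ∘ (Fin.consEquiv fun _ => ℕ) =
        fun z : ℕ × (Fin s → ℕ) => f 0 z.1 * ∏ i : Fin s, f i.succ (z.2 i) := by
      ext z
      simp [Fin.consEquiv, Fin.prod_univ_succ]
    constructor
    · rw [← (Fin.consEquiv fun _ : Fin (s + 1) => ℕ).summable_iff]
      have := Summable.mul_norm (hf 0) h1
      refine this.congr fun z => ?_
      rw [← congrFun hp z]
      rfl
    · rw [← (Fin.consEquiv fun _ : Fin (s + 1) => ℕ).tsum_eq, Fin.prod_univ_succ, ← h2,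
        tsum_mul_tsum_of_summable_norm (hf 0) h1]
      exact tsum_congr fun z => congrFun hp z

theorem hasSum_prod_apply {s : ℕ} {f : Fin s → ℕ → ℝ} (hf : ∀ i, Summable fun k => ‖f i k‖) :
    HasSum (fun k : Fin s → ℕ => ∏ i, f i (k i)) (∏ i, ∑' k, f i k) :=
  (summable_norm_prod_apply hf).2 ▸ (summable_norm_prod_apply hf).1.of_norm.hasSum

/-- The rearrangements of strictly decreasing tuples of positive integers. -/
def rearrange (s : ℕ) (z : SumsOfSquares.DecTuple s × Perm (Fin s)) : Fin s → ℕ := z.1.1 ∘ z.2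

theorem rearrange_injective (s : ℕ) : Function.Injective (rearrange s) := by
  rintro ⟨⟨k, hk, _⟩, τ⟩ ⟨⟨k', hk', _⟩, τ'⟩ h
  simp only [rearrange] at h
  have hr : Set.range (OrderDual.toDual ∘ k) = Set.range (OrderDual.toDual ∘ k') := by
    rw [← τ.surjective.range_comp (OrderDual.toDual ∘ k),
      ← τ'.surjective.range_comp (OrderDual.toDual ∘ k'), Function.comp_assoc, h]
    rfl
  have e : k = k' := (hk.dual_right.range_inj hk'.dual_right).1 hr
  subst e
  have : τ = τ' := Equiv.ext fun i => hk.injective (congrFun h i)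
  rw [this]

theorem mem_range_rearrange {s : ℕ} {k : Fin s → ℕ} (hk : Function.Injective k)
    (h1 : ∀ i, 1 ≤ k i) : k ∈ Set.range (rearrange s) := by
  have hm := Tuple.monotone_sort k
  have hs : StrictMono (k ∘ Tuple.sort k) :=
    hm.strictMono_of_injective (hk.comp (Tuple.sort k).injective)
  refine ⟨⟨⟨k ∘ Tuple.sort k ∘ Fin.rev, fun i j hij => hs (Fin.rev_lt_rev.2 hij), fun _ => h1 _⟩,
    (Fin.revPerm.trans (Tuple.sort k)).symm⟩, ?_⟩
  ext i
  simp [rearrange]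

/-- Where F does not vanish the entries are distinct and positive, and such a tuple rearranges
exactly one decreasing tuple; each decreasing tuple has s! rearrangements. -/
theorem factorial_mul_tsum_decTuple {s : ℕ} {F : (Fin s → ℕ) → ℝ} (hF : Summable F)
    (hτ : ∀ k (τ : Perm (Fin s)), F (k ∘ τ) = F k)
    (h0 : ∀ k, ¬Function.Injective k → F k = 0) (h1 : ∀ k i, k i = 0 → F k = 0) :
    s.factorial * ∑' k : SumsOfSquares.DecTuple s, F k.1 = ∑' k, F k := by
  have hsupp : Function.support F ⊆ Set.range (rearrange s) := by
    intro k hk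
    refine mem_range_rearrange ?_ fun i => ?_
    · by_contra h
      exact hk (h0 k h)
    · by_contra h
      exact hk (h1 k i (by omega))
  rw [← (rearrange_injective s).tsum_eq hsupp]
  have hs : Summable fun z => F (rearrange s z) := hF.comp_injective (rearrange_injective s)
  rw [hs.tsum_prod, ← tsum_mul_left]
  refine tsum_congr fun k => ?_
  simp only [rearrange, hτ]
  rw [tsum_fintype]
  simp [Finset.card_univ, Fintype.card_perm]

variable {ι : Type*} {v : ι → ℝ}

theorem mixed_comp_perm {s u : ℕ} (U : Fin s → ι → ι → ℝ) (τ : Perm (Fin s)) :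
    mixed v (s + u) (U ∘ τ) =
      mixed v (s + u) U ∘ finSumFinEquiv.permCongr (Perm.sumCongr τ (1 : Perm (Fin u))) := by
  ext i : 1
  induction i using Fin.addCases with
  | left i => simp [mixed, Equiv.permCongr_apply]
  | right i => simp [mixed, Equiv.permCongr_apply]

theorem pairing_mixed {s u n : ℕ} (h : 2 * (s + u) ≤ n) (U : Fin s → ι → ι → ℝ) (y : Fin n → ι) :
    pairing h (mixed v (s + u) U) y =
      (∏ i : Fin s, U i (y ⟨2 * i, by omega⟩) (y ⟨2 * i + 1, by omega⟩)) *
      ∏ i : Fin u, schurKernel v (y ⟨2 * (s + i), by omega⟩) (y ⟨2 * (s + i) + 1, by omega⟩) := by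
  unfold pairing
  rw [Fin.prod_univ_add]
  simp [mixed]

/-- The power series `∑ c k (v a / v b) ^ k`. -/
noncomputable def ratioSeries (v : ι → ℝ) (c : ℕ → ℝ) (a b : ι) : ℝ :=
  ∑' k, c k * ratioPow v k a b

/-- Repeated exponents give 0 by `alt_pairing_eq_zero` and the exponent 0 has coefficient 0, so the
ordered sum may be extended to all tuples. The unrestricted sum factors over the pairs. -/
theorem tsum_decTuple_alt {s u m n : ℕ} (hm : m = s + u) (h : 2 * m ≤ n) {c : ℕ → ℝ} (hc0 : c 0 = 0)
    (hc : ∀ a b, Summable fun k => ‖c k * ratioPow v k a b‖) (x : Fin n → ι) :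
    s.factorial * ∑' k : SumsOfSquares.DecTuple s, (∏ i, c (k.1 i)) *
      alt (pairing h (mixed v m fun i => ratioPow v (k.1 i))) x =
      alt (pairing h (mixed v m fun _ : Fin s => ratioSeries v c)) x := by
  subst hm
  set F : (Fin s → ℕ) → ℝ := fun k => (∏ i, c (k i)) *
      alt (pairing h (mixed v (s + u) fun i => ratioPow v (k i))) x with hF
  have hsum : HasSum F (alt (pairing h (mixed v (s + u) fun _ : Fin s => ratioSeries v c)) x) := by
    have e : F = fun k => ∑ σ : Perm (Fin n), ((Perm.sign σ : ℤ) : ℝ) *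
        ((∏ i : Fin s, c (k i) * ratioPow v (k i) ((x ∘ σ) ⟨2 * i, by omega⟩)
          ((x ∘ σ) ⟨2 * i + 1, by omega⟩)) *
        ∏ i : Fin u, schurKernel v ((x ∘ σ) ⟨2 * (s + i), by omega⟩)
          ((x ∘ σ) ⟨2 * (s + i) + 1, by omega⟩)) := by
      ext k
      rw [hF]
      simp only [alt, Finset.mul_sum]
      refine Finset.sum_congr rfl fun σ _ => ?_
      rw [pairing_mixed, Finset.prod_mul_distrib]
      ring
    rw [e]
    unfold alt
    refine hasSum_sum fun σ _ => HasSum.mul_left _ ?_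
    rw [pairing_mixed]
    refine HasSum.mul_right _ ?_
    have key : ∀ a b : Fin s → ι, HasSum (fun k : Fin s → ℕ =>
        ∏ i, c (k i) * ratioPow v (k i) (a i) (b i)) (∏ i, ratioSeries v c (a i) (b i)) :=
      fun a b => hasSum_prod_apply fun i => hc (a i) (b i)
    exact key (fun i => (x ∘ σ) ⟨2 * i, by omega⟩) (fun i => (x ∘ σ) ⟨2 * i + 1, by omega⟩)
  rw [← hsum.tsum_eq]
  refine factorial_mul_tsum_decTuple hsum.summable ?_ ?_ ?_
  · intro k τ
    simp only [hF, Function.comp]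
    rw [Equiv.prod_comp τ fun i => c (k i)]
    congr 1
    have := mixed_comp_perm (v := v) (u := u) (fun i => ratioPow v (k i)) τ
    rw [show (fun i => ratioPow v (k (τ i))) = (fun i => ratioPow v (k i)) ∘ τ from rfl, this,
      alt_pairing_perm]
  · intro k hk
    simp only [Function.Injective, not_forall] at hk
    obtain ⟨i, j, hij, hne⟩ := hk
    simp only [hF]
    rw [alt_pairing_eq_zero h (i := Fin.castAdd u i) (j := Fin.castAdd u j), mul_zero]
    · simpa [Fin.ext_iff] using hne
    · intro a b a' b'
      simp only [mixed, Fin.val_castAdd, Fin.is_lt, dif_pos, Fin.eta, hij, ratioPow]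
      rw [← mul_pow, ← mul_pow]
      ring
  · intro k i hi
    simp only [hF]
    rw [Finset.prod_eq_zero (Finset.mem_univ i) (by rw [hi, hc0]), zero_mul]

/-- With m = s + u, the constants δ^s/2^s, 4^s/(2^u u!) and 1/s! multiply to C(m,s) (4δ)^s/(2^m m!),
so the sum over s is the binomial expansion for Schur's kernel plus 4δ times the ratio series.
Antisymmetrizing turns 4δ into 2δ. -/
theorem sum_tsum_schurQ [DecidableEq ι] {m n e : ℕ} (he : e ≤ 1) (hn : n = 2 * m + e)
    (hv : ∀ a, 0 < v a) (hi : Function.Injective v) {x : Fin n → ι} (hx : Function.Injective x)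
    {c : ℕ → ℝ} (hc0 : c 0 = 0) (hc : ∀ a b, Summable fun k => ‖c k * ratioPow v k a b‖) (δ : ℝ) :
    ∑ s : Fin (m + 1), δ ^ (s : ℕ) / 2 ^ (s : ℕ) *
      ∑' k : SumsOfSquares.DecTuple s, (∏ i, c (k.1 i)) *
        SumsOfSquares.schurQ (by omega) (SumsOfSquares.symmetrize k.1) (v ∘ x) =
      (2 ^ m * m.factorial : ℝ)⁻¹ * (pairs (schurKernel v) x)⁻¹ *
        alt (pairing (m := m) (by omega) fun _ a b => schurKernel v a b +
          2 * δ * (ratioSeries v c a b - ratioSeries v c b a)) x := by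
  have h2 : 2 * m ≤ n := by omega
  have e1 : alt (pairing h2 fun _ a b => schurKernel v a b +
      2 * δ * (ratioSeries v c a b - ratioSeries v c b a)) x =
      alt (pairing h2 fun _ a b => 4 * δ * ratioSeries v c a b + schurKernel v a b) x :=
    alt_pairing_antisymmetrize h2 (fun a b => by
      rw [schurKernel_anti b a]; ring) x
  rw [e1, alt_pairing_add, Finset.mul_sum, Finset.sum_range]
  refine Finset.sum_congr rfl fun s _ => ?_
  obtain ⟨u, hu⟩ : ∃ u, m = s + u := ⟨m - s, by omega⟩
  have e2 : alt (pairing h2 fun i => if (i : ℕ) < s then fun a b => 4 * δ * ratioSeries v c a b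
      else schurKernel v) x = (4 * δ) ^ (s : ℕ) *
      alt (pairing h2 (mixed v m fun _ : Fin (s : ℕ) => ratioSeries v c)) x := by
    rw [← alt_smul]
    refine alt_congr fun σ => ?_
    generalize (s : ℕ) = s' at hu ⊢
    subst hu
    rw [pairing_mixed]
    unfold pairing
    rw [Fin.prod_univ_add]
    simp [Finset.prod_mul_distrib, mul_assoc, mul_pow]
  have e3 : ∀ k : SumsOfSquares.DecTuple s, (∏ i, c (k.1 i)) *
      SumsOfSquares.schurQ (by omega) (SumsOfSquares.symmetrize k.1) (v ∘ x) =
      4 ^ (s : ℕ) / (2 ^ u * u.factorial) * (pairs (schurKernel v) x)⁻¹ * ((∏ i, c (k.1 i)) *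
        alt (pairing h2 (mixed v m fun i => ratioPow v (k.1 i))) x) := by
    intro k
    rw [schurQ_symmetrize (u := u) hu he hn (by omega) k.1 hv hi hx]
    ring
  rw [tsum_congr e3, tsum_mul_left, e2, ← tsum_decTuple_alt hu h2 hc0 hc x]
  have hf : (m.choose s : ℝ) * s.1.factorial * u.factorial = m.factorial := by
    have := Nat.choose_mul_factorial_mul_factorial (n := m) (k := s) (by omega)
    rw [show m - s = u by omega] at this
    exact_mod_cast this
  rw [← hf]
  have hp : (2 : ℝ) ^ m = 2 ^ (s : ℕ) * 2 ^ u := by rw [← pow_add, ← hu]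
  rw [hp, mul_pow]
  have n1 : (u.factorial : ℝ) ≠ 0 := Nat.cast_ne_zero.2 u.factorial_ne_zero
  have n2 : (s.1.factorial : ℝ) ≠ 0 := Nat.cast_ne_zero.2 s.1.factorial_ne_zero
  have n3 : (m.choose s : ℝ) ≠ 0 := Nat.cast_ne_zero.2 (Nat.choose_pos (by omega)).ne'
  field_simp

end TupleSums

/-! ### The removable singularity of Q, and uniform bounds near (1, …, 1). -/

section RemovableSingularity

open Equiv

attribute [local instance] Matrix.linftyOpNormedRing

/-- Multiplication by the variable in the rescaled Newton basis with nodes `x`. -/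
def newtonMatrix {n : ℕ} (ε : ℝ) (x : Fin n → ℝ) : Matrix (Fin n) (Fin n) ℝ :=
  Matrix.diagonal x + ε • Matrix.of fun i j : Fin n => if (i : ℕ) = j + 1 then (1 : ℝ) else 0

/-- The values of the rescaled Newton basis at its own nodes. -/
noncomputable def newtonEval {n : ℕ} (ε : ℝ) (x : Fin n → ℝ) : Matrix (Fin n) (Fin n) ℝ :=
  Matrix.of fun i k => ∏ l ∈ Finset.Iio k, (x i - x l) / ε

/-- The constant function `1` in the Newton basis. -/
def newtonOne (n : ℕ) (k : Fin n) : ℝ := if (k : ℕ) = 0 then 1 else 0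

theorem prod_Iio_succ {n : ℕ} (f : Fin n → ℝ) (k k' : Fin n) (h : (k' : ℕ) = k + 1) :
    ∏ l ∈ Finset.Iio k', f l = f k * ∏ l ∈ Finset.Iio k, f l := by
  have : Finset.Iio k' = insert k (Finset.Iio k) := by
    ext a; simp only [Finset.mem_Iio, Finset.mem_insert, Fin.lt_def, Fin.ext_iff]; omega
  rw [this, Finset.prod_insert (by simp)]

/-- For e_k(t) = ∏_{l<k} (t - x_l)/ε one has t e_k = x_k e_k + ε e_{k+1}, and after the last k the
next product vanishes at every node. So the node values form left eigenvectors. -/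
theorem newtonEval_vecMul {n : ℕ} {ε : ℝ} (hε : ε ≠ 0) (x : Fin n → ℝ) (i : Fin n) :
    Matrix.vecMul (newtonEval ε x i) (newtonMatrix ε x) = x i • newtonEval ε x i := by
  ext k
  rw [newtonMatrix, Matrix.vecMul_add, Pi.add_apply, Matrix.vecMul_diagonal, Pi.smul_apply,
    smul_eq_mul]
  have e : ∀ j : Fin n, newtonEval ε x i j *
      (ε • Matrix.of fun i j : Fin n => if (i : ℕ) = j + 1 then (1 : ℝ) else 0) j k =
      if (j : ℕ) = k + 1 then (x i - x k) * newtonEval ε x i k else 0 := by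
    intro j
    simp only [Matrix.smul_apply, Matrix.of_apply, smul_eq_mul]
    split_ifs with h
    · rw [newtonEval, Matrix.of_apply, Matrix.of_apply, prod_Iio_succ _ k j h]
      field_simp
    · simp
  simp only [Matrix.vecMul, dotProduct, e]
  by_cases hk : (k : ℕ) + 1 < n
  · rw [Finset.sum_eq_single ⟨k + 1, hk⟩]
    · simp; ring
    · intro b _ hb
      rw [if_neg fun h => hb (Fin.ext h)]
    · simp
  · rw [Finset.sum_eq_zero fun j _ => if_neg (by omega)]
    have : (x i - x k) * newtonEval ε x i k = 0 := by
      rcases eq_or_ne i k with rfl | hik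
      · simp
      · have : i < k := by
          rw [Fin.lt_def]
          have : (i : ℕ) ≠ k := fun h => hik (Fin.ext h)
          omega
        rw [newtonEval, Matrix.of_apply, Finset.prod_eq_zero (Finset.mem_Iio.2 this) (by simp),
          mul_zero]
    linarith

theorem det_newtonMatrix {n : ℕ} (ε : ℝ) (x : Fin n → ℝ) : (newtonMatrix ε x).det = ∏ i, x i := by
  rw [Matrix.det_of_isLowerTriangular]
  · simp [newtonMatrix]
  · intro i j hij
    have hij : i < j := hij
    rw [newtonMatrix, Matrix.add_apply, Matrix.diagonal_apply_ne _ hij.ne]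
    simp only [Matrix.smul_apply, Matrix.of_apply]
    rw [if_neg (by rw [Fin.lt_def] at hij; omega)]
    simp

theorem newtonEval_vecMul_zpow {n : ℕ} {ε : ℝ} (hε : ε ≠ 0) {x : Fin n → ℝ} (hx : ∀ i, x i ≠ 0)
    (i : Fin n) (μ : ℤ) :
    Matrix.vecMul (newtonEval ε x i) (newtonMatrix ε x ^ μ) = x i ^ μ • newtonEval ε x i := by
  have h1 := newtonEval_vecMul hε x i
  have hd : IsUnit (newtonMatrix ε x).det := by
    rw [det_newtonMatrix, isUnit_iff_ne_zero]
    exact Finset.prod_ne_zero_iff.2 fun i _ => hx i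
  have h2 : Matrix.vecMul (newtonEval ε x i) (newtonMatrix ε x)⁻¹ =
      (x i)⁻¹ • newtonEval ε x i := by
    have : newtonEval ε x i = (x i)⁻¹ • Matrix.vecMul (newtonEval ε x i) (newtonMatrix ε x) := by
      rw [h1, smul_smul, inv_mul_cancel₀ (hx i), one_smul]
    conv_lhs => rw [this]
    rw [Matrix.smul_vecMul, Matrix.vecMul_vecMul, Matrix.mul_nonsing_inv _ hd, Matrix.vecMul_one]
  have hpow : ∀ (M : Matrix (Fin n) (Fin n) ℝ) (a : ℝ),
      Matrix.vecMul (newtonEval ε x i) M = a • newtonEval ε x i → ∀ k : ℕ,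
      Matrix.vecMul (newtonEval ε x i) (M ^ k) = a ^ k • newtonEval ε x i := by
    intro M a h k
    induction k with
    | zero => simp
    | succ k ih =>
      rw [pow_succ, ← Matrix.vecMul_vecMul, ih, Matrix.smul_vecMul, h, smul_smul, pow_succ]
  obtain ⟨k, rfl | rfl⟩ := Int.eq_nat_or_neg μ
  · rw [zpow_natCast, zpow_natCast, hpow _ _ h1]
  · rw [Matrix.zpow_neg_natCast, zpow_neg, zpow_natCast, ← Matrix.inv_pow', ← inv_pow,
      hpow _ _ h2]

/-- A matrix with entries x_i^{μ_j} thus factors into `newtonEval`, whose determinant carries the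
whole Vandermonde product, and a matrix that stays regular when nodes coincide. -/
theorem zpow_eq_sum_newton {n : ℕ} {ε : ℝ} (hε : ε ≠ 0) {x : Fin n → ℝ} (hx : ∀ i, x i ≠ 0)
    (i : Fin n) (μ : ℤ) :
    x i ^ μ = ∑ k, newtonEval ε x i k * ((newtonMatrix ε x ^ μ).mulVec (newtonOne n)) k := by
  have h1 : newtonEval ε x i ⬝ᵥ newtonOne n = 1 := by
    have hn : 0 < n := i.pos
    rw [dotProduct, Finset.sum_eq_single ⟨0, hn⟩]
    · rw [newtonEval, Matrix.of_apply, Finset.prod_eq_one]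
      · simp [newtonOne]
      · intro l hl
        simp [Fin.lt_def] at hl
    · intro b _ hb
      rw [newtonOne, if_neg fun h => hb (Fin.ext h), mul_zero]
    · simp
  change _ = newtonEval ε x i ⬝ᵥ _
  rw [Matrix.dotProduct_mulVec, newtonEval_vecMul_zpow hε hx, smul_dotProduct, h1, smul_eq_mul,
    mul_one]

/-- The ratio of the determinant of `newtonEval` and the product of the differences. -/
noncomputable def newtonDet (n : ℕ) (ε : ℝ) : ℝ :=
  ∏ i : Fin n, ∏ _j ∈ Finset.Ioi i, (-ε⁻¹)

theorem det_newtonEval {n : ℕ} (ε : ℝ) (x : Fin n → ℝ) :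
    (newtonEval ε x).det = newtonDet n ε * pairs (fun a b => a - b) x := by
  rw [Matrix.det_of_isLowerTriangular, newtonDet, pairs, ← Finset.prod_mul_distrib]
  · simp only [newtonEval, Matrix.of_apply]
    rw [Finset.prod_comm' (t' := Finset.univ) (s' := fun l => Finset.Ioi l) (by simp)]
    refine Finset.prod_congr rfl fun i _ => ?_
    rw [← Finset.prod_mul_distrib]
    refine Finset.prod_congr rfl fun j _ => ?_
    ring
  · intro i j hij
    have hij : i < j := hij
    rw [newtonEval, Matrix.of_apply, Finset.prod_eq_zero (Finset.mem_Iio.2 hij) (by simp)]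

/-- The numerator of a term of `Q`, apart from the monomial. -/
noncomputable def schurNumerator {r n : ℕ} (h : r ≤ n) : MvPolynomial (Fin n) ℝ :=
  (∏ i : Fin r, ∏ j ∈ Finset.Ioi (Fin.castLE h i),
    (MvPolynomial.X (Fin.castLE h i) + MvPolynomial.X j)) *
  ∏ i ∈ Finset.univ.filter fun i : Fin n => r ≤ (i : ℕ), ∏ j ∈ Finset.Ioi i,
    (MvPolynomial.X i - MvPolynomial.X j)

theorem eval_schurNumerator {r n : ℕ} (h : r ≤ n) {y : Fin n → ℝ} (hy : Function.Injective y) :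
    ∏ i : Fin r, ∏ j ∈ Finset.Ioi (Fin.castLE h i),
      (y (Fin.castLE h i) + y j) / (y (Fin.castLE h i) - y j) =
      (pairs (fun a b => a - b) y)⁻¹ * MvPolynomial.eval y (schurNumerator h) := by
  have e1 : pairs (fun a b => a - b) y = (∏ i : Fin r, ∏ j ∈ Finset.Ioi (Fin.castLE h i),
      (y (Fin.castLE h i) - y j)) * ∏ i ∈ Finset.univ.filter fun i : Fin n => r ≤ (i : ℕ),
        ∏ j ∈ Finset.Ioi i, (y i - y j) := by
    unfold pairs
    rw [← Finset.prod_filter_mul_prod_filter_not Finset.univ fun i : Fin n => (i : ℕ) < r]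
    congr 1
    · have : (Finset.univ.filter fun i : Fin n => (i : ℕ) < r) =
          Finset.univ.image (Fin.castLE h) := by
        ext i
        simp only [Finset.mem_filter, Finset.mem_univ, true_and, Finset.mem_image]
        exact ⟨fun hi => ⟨⟨i, hi⟩, rfl⟩, by rintro ⟨j, rfl⟩; exact j.2⟩
      rw [this, Finset.prod_image (Fin.castLE_injective h).injOn]
    · exact Finset.prod_congr (by ext; simp) fun _ _ => rfl
  have hne : pairs (fun a b => a - b) y ≠ 0 :=
    pairs_ne_zero (g := fun a b : ℝ => a - b) (fun _ _ hab => sub_ne_zero.2 hab) hy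
  rw [e1] at hne ⊢
  have n1 := left_ne_zero_of_mul hne
  have n2 := right_ne_zero_of_mul hne
  simp only [schurNumerator, map_mul, map_prod, map_add, map_sub, MvPolynomial.eval_X,
    Finset.prod_div_distrib]
  field_simp

/-- The exponent of the variable `j` in a monomial of the numerator of `Q`. -/
def exponent {r n : ℕ} (lam : Fin r → ℤ) (α : Fin n →₀ ℕ) (j : Fin n) : ℤ :=
  (if h : (j : ℕ) < r then lam ⟨j, h⟩ else 0) + α j

/-- The expansion of `Q` into determinants without singularities. -/
noncomputable def schurQRegular {r n : ℕ} (h : r ≤ n) (lam : Fin r → ℤ) (ε : ℝ) (x : Fin n → ℝ) :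
    ℝ :=
  2 ^ r / (n - r).factorial * newtonDet n ε *
    ∑ α ∈ (schurNumerator h).support, (schurNumerator h).coeff α *
      (Matrix.of fun k j =>
        ((newtonMatrix ε x ^ exponent lam α j).mulVec (newtonOne n)) k).det

/-- Over the common denominator ∏(x_i - x_j), which is alternating, each monomial of the numerator
contributes a determinant of powers of the nodes; its Vandermonde factor cancels the denominator. -/
theorem schurQ_eq_regular {r n : ℕ} (h : r ≤ n) (lam : Fin r → ℤ) {ε : ℝ} (hε : ε ≠ 0)
    {x : Fin n → ℝ} (hx : ∀ i, x i ≠ 0) (hi : Function.Injective x) :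
    SumsOfSquares.schurQ h lam x = schurQRegular h lam ε x := by
  set D := pairs (fun a b : ℝ => a - b) x with hD
  have hne : D ≠ 0 :=
    pairs_ne_zero (g := fun a b : ℝ => a - b) (fun _ _ hab => sub_ne_zero.2 hab) hi
  have hmon : ∀ y : Fin n → ℝ, (∀ i, y i ≠ 0) → ∀ α : Fin n →₀ ℕ,
      (∏ i : Fin r, y (Fin.castLE h i) ^ lam i) * ∏ i, y i ^ α i =
        ∏ i, y i ^ exponent lam α i := by
    intro y hy α
    have : ∏ i : Fin r, y (Fin.castLE h i) ^ lam i =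
        ∏ i : Fin n, y i ^ (if h : (i : ℕ) < r then lam ⟨i, h⟩ else 0) := by
      obtain ⟨k, rfl⟩ := Nat.exists_eq_add_of_le h
      rw [Fin.prod_univ_add]
      simp
      rfl
    rw [this, ← Finset.prod_mul_distrib]
    refine Finset.prod_congr rfl fun i _ => ?_
    rw [exponent, zpow_add₀ (hy i), zpow_natCast]
  have hterm : ∀ σ : Perm (Fin n), SumsOfSquares.schurQTerm h lam (fun i => x (σ i)) =
      D⁻¹ * ∑ α ∈ (schurNumerator h).support, (schurNumerator h).coeff α *
        (((Perm.sign σ : ℤ) : ℝ) * ∏ i, x (σ i) ^ exponent lam α i) := by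
    intro σ
    unfold SumsOfSquares.schurQTerm
    have e := eval_schurNumerator h (y := fun i => x (σ i)) (hi.comp σ.injective)
    rw [e]
    have e2 : pairs (fun a b : ℝ => a - b) (fun i => x (σ i)) = ((Perm.sign σ : ℤ) : ℝ) * D :=
      pairs_comp (g := fun a b : ℝ => a - b) (fun a b => by ring) x σ
    have hs : (((Perm.sign σ : ℤ) : ℝ))⁻¹ = ((Perm.sign σ : ℤ) : ℝ) := by
      rcases Int.units_eq_one_or (Perm.sign σ) with h | h <;> simp [h]
    rw [e2, mul_inv, hs, MvPolynomial.eval_eq', Finset.mul_sum, Finset.mul_sum, Finset.mul_sum]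
    refine Finset.sum_congr rfl fun α _ => ?_
    rw [← hmon (fun i => x (σ i)) (fun i => hx _) α]
    ring
  have hdet : ∀ α : Fin n →₀ ℕ,
      ∑ σ : Perm (Fin n), ((Perm.sign σ : ℤ) : ℝ) * ∏ i, x (σ i) ^ exponent lam α i =
      newtonDet n ε * D * (Matrix.of fun k j =>
        ((newtonMatrix ε x ^ exponent lam α j).mulVec (newtonOne n)) k).det := by
    intro α
    rw [← det_newtonEval, ← Matrix.det_mul, Matrix.det_apply']
    refine Finset.sum_congr rfl fun σ _ => ?_
    congr 1
    refine Finset.prod_congr rfl fun i _ => ?_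
    rw [Matrix.mul_apply, zpow_eq_sum_newton hε hx]
    rfl
  unfold SumsOfSquares.schurQ schurQRegular
  rw [Finset.sum_congr rfl fun σ _ => hterm σ, ← Finset.mul_sum, Finset.sum_comm]
  simp only [← Finset.mul_sum, hdet]
  have : ∀ α, (schurNumerator h).coeff α * (newtonDet n ε * D * (Matrix.of fun k j =>
      ((newtonMatrix ε x ^ exponent lam α j).mulVec (newtonOne n)) k).det) =
      (newtonDet n ε * D) * ((schurNumerator h).coeff α * (Matrix.of fun k j =>
      ((newtonMatrix ε x ^ exponent lam α j).mulVec (newtonOne n)) k).det) := fun α => by ring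
  simp only [this, ← Finset.mul_sum]
  field_simp

theorem continuous_newtonMatrix {n : ℕ} (ε : ℝ) :
    Continuous fun x : Fin n → ℝ => newtonMatrix ε x := by
  unfold newtonMatrix
  fun_prop

theorem continuousAt_newtonMatrix_zpow {n : ℕ} (ε : ℝ) (μ : ℤ) {x : Fin n → ℝ}
    (hx : ∀ i, x i ≠ 0) : ContinuousAt (fun x : Fin n → ℝ => newtonMatrix ε x ^ μ) x := by
  have hc := continuous_newtonMatrix (n := n) ε
  obtain ⟨k, rfl | rfl⟩ := Int.eq_nat_or_neg μ
  · simp only [zpow_natCast]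
    exact (hc.pow k).continuousAt
  · simp only [Matrix.zpow_neg_natCast, Matrix.inv_def, Ring.inverse_eq_inv']
    have h1 : Continuous fun x : Fin n → ℝ => (newtonMatrix ε x ^ k).det := (hc.pow k).matrix_det
    have h2 : Continuous fun x : Fin n → ℝ => (newtonMatrix ε x ^ k).adjugate :=
      (hc.pow k).matrix_adjugate
    refine (h1.continuousAt.inv₀ ?_).smul h2.continuousAt
    rw [Matrix.det_pow, det_newtonMatrix]
    exact pow_ne_zero _ (Finset.prod_ne_zero_iff.2 fun i _ => hx i)

theorem continuousAt_schurQRegular {r n : ℕ} (h : r ≤ n) (lam : Fin r → ℤ) (ε : ℝ)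
    {x : Fin n → ℝ} (hx : ∀ i, x i ≠ 0) : ContinuousAt (schurQRegular h lam ε) x := by
  unfold schurQRegular
  refine ContinuousAt.const_mul ?_ _
  refine tendsto_finsetSum _ fun α _ => Tendsto.const_mul _ ?_
  have hdet : Continuous fun M : Matrix (Fin n) (Fin n) ℝ => M.det := continuous_id.matrix_det
  refine hdet.continuousAt.comp (f := fun x : Fin n → ℝ => (Matrix.of fun k j =>
    ((newtonMatrix ε x ^ exponent lam α j).mulVec (newtonOne n)) k)) ?_
  refine continuousAt_pi.2 fun k => continuousAt_pi.2 fun j => ?_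
  have := continuousAt_newtonMatrix_zpow ε (exponent lam α j) hx
  refine (Continuous.continuousAt (f := fun M : Matrix (Fin n) (Fin n) ℝ =>
    (M.mulVec (newtonOne n)) k) ?_).comp this
  exact (continuous_apply k).comp (continuous_id.matrix_mulVec continuous_const)

theorem eventually_nearOne {n : ℕ} {δ : ℝ} (hδ : 0 < δ) :
    ∀ᶠ x in SumsOfSquares.nearOne n, (∀ i, |x i - 1| < δ) ∧ Function.Injective x := by
  refine (Filter.Eventually.filter_mono nhdsWithin_le_nhds ?_).and self_mem_nhdsWithin
  refine Filter.eventually_all.2 fun i => ?_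
  have : Tendsto (fun x : Fin n → ℝ => |x i - 1|) (𝓝 fun _ => 1) (𝓝 |(1 : ℝ) - 1|) :=
    (Continuous.tendsto (by fun_prop) _)
  rw [sub_self, abs_zero] at this
  exact this.eventually_lt_const hδ

theorem tendsto_schurQ {r n : ℕ} (h : r ≤ n) (lam : Fin r → ℤ) :
    Tendsto (SumsOfSquares.schurQ h lam) (SumsOfSquares.nearOne n)
      (𝓝 (SumsOfSquares.schurQOne h lam)) := by
  refine tendsto_nhds_limUnder ⟨schurQRegular h lam 1 fun _ => 1, ?_⟩
  have := (continuousAt_schurQRegular h lam 1 (x := fun _ : Fin n => (1 : ℝ)) (by simp)).tendsto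
  refine (this.mono_left nhdsWithin_le_nhds).congr' ?_
  filter_upwards [eventually_nearOne (n := n) one_pos] with x hx
  refine (schurQ_eq_regular h lam one_ne_zero (fun i hi => ?_) hx.2).symm
  have := hx.1 i
  rw [hi] at this
  norm_num at this

/-- This is the purpose of the rescaling: diagonal and subdiagonal each deviate from those of the
identity by at most ε, even when nodes coincide. -/
theorem norm_newtonMatrix_sub_one_le {n : ℕ} {ε : ℝ} (hε : 0 ≤ ε) {x : Fin n → ℝ}
    (hx : ∀ i, |x i - 1| ≤ ε) : ‖newtonMatrix ε x - 1‖ ≤ ε + ε := by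
  have e : newtonMatrix ε x - 1 = Matrix.diagonal (fun i => x i - 1) +
      ε • Matrix.of fun i j : Fin n => if (i : ℕ) = j + 1 then (1 : ℝ) else 0 := by
    rw [newtonMatrix, ← Matrix.diagonal_one, add_sub_right_comm, Matrix.diagonal_sub]
  rw [e]
  refine (norm_add_le _ _).trans (add_le_add ?_ ?_)
  · rw [Matrix.linfty_opNorm_diagonal, pi_norm_le_iff_of_nonneg hε]
    exact hx
  · rw [Matrix.linfty_opNorm_def]
    obtain ⟨E, hE⟩ : ∃ E : NNReal, (E : ℝ) = ε := ⟨⟨ε, hε⟩, rfl⟩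
    rw [← hE]
    refine NNReal.coe_le_coe.2 (Finset.sup_le fun i _ => ?_)
    rw [hE, ← NNReal.coe_le_coe, NNReal.coe_sum]
    have : ∀ j : Fin n, ((‖(ε • Matrix.of fun i j : Fin n =>
        if (i : ℕ) = j + 1 then (1 : ℝ) else 0) i j‖₊ : NNReal) : ℝ) =
        if (i : ℕ) = j + 1 then ε else 0 := by
      intro j
      simp only [Matrix.smul_apply, Matrix.of_apply, coe_nnnorm]
      split_ifs <;> simp [abs_of_nonneg hε]
    simp only [this]
    rw [Finset.sum_ite, Finset.sum_const, Finset.sum_const_zero, add_zero, nsmul_eq_mul]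
    have hc : (Finset.univ.filter fun j : Fin n => (i : ℕ) = j + 1).card ≤ 1 := by
      refine Finset.card_le_one.2 fun a ha b hb => Fin.ext ?_
      simp only [Finset.mem_filter, Finset.mem_univ, true_and] at ha hb
      omega
    have hc' : ((Finset.univ.filter fun j : Fin n => (i : ℕ) = j + 1).card : ℝ) ≤ 1 := by
      exact_mod_cast hc
    rw [hE]
    exact mul_le_of_le_one_left hε hc'

/-- Only an inequality, because the norm is 0 when n = 0. -/
theorem norm_one_matrix_le (n : ℕ) : ‖(1 : Matrix (Fin n) (Fin n) ℝ)‖ ≤ 1 := by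
  rw [← Matrix.diagonal_one, Matrix.linfty_opNorm_diagonal,
    pi_norm_le_iff_of_nonneg zero_le_one]
  simp

/-- A Neumann-type estimate: a matrix within 2ε of the identity and its inverse both have norm at
most 1/(1 - 2ε) ≤ ρ. -/
theorem norm_newtonMatrix_zpow_le {n : ℕ} {ε ρ : ℝ} (hε : 0 ≤ ε) (hρ : 1 ≤ (1 - (ε + ε)) * ρ)
    (hε1 : ε + ε < 1) {x : Fin n → ℝ} (hx0 : ∀ i, x i ≠ 0) (hx : ∀ i, |x i - 1| ≤ ε) (μ : ℤ) :
    ‖newtonMatrix ε x ^ μ‖ ≤ ρ ^ μ.natAbs := by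
  have h1 := norm_newtonMatrix_sub_one_le hε hx
  have h0 := norm_one_matrix_le n
  set C := newtonMatrix ε x with hC
  have hρ1 : 1 ≤ ρ := by nlinarith
  have hd : IsUnit C.det := by
    rw [hC, det_newtonMatrix, isUnit_iff_ne_zero]
    exact Finset.prod_ne_zero_iff.2 fun i _ => hx0 i
  have hCn : ‖C‖ ≤ ρ := by
    have : C = (C - 1) + 1 := by abel
    have h2 : ‖C‖ ≤ ‖C - 1‖ + ‖(1 : Matrix (Fin n) (Fin n) ℝ)‖ := by
      conv_lhs => rw [this]
      exact norm_add_le _ _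
    nlinarith
  have hCi : ‖C⁻¹‖ ≤ ρ := by
    have : C⁻¹ = 1 - (C - 1) * C⁻¹ := by
      rw [sub_mul, Matrix.mul_nonsing_inv _ hd]; simp
    have h2 : ‖C⁻¹‖ ≤ ‖(1 : Matrix (Fin n) (Fin n) ℝ)‖ + ‖C - 1‖ * ‖C⁻¹‖ := by
      conv_lhs => rw [this]
      exact (norm_sub_le _ _).trans (add_le_add le_rfl (norm_mul_le _ _))
    have h3 : ‖C⁻¹‖ * (1 - (ε + ε)) ≤ 1 := by
      nlinarith [norm_nonneg C⁻¹]
    by_contra hlt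
    push Not at hlt
    nlinarith
  have hpow : ∀ (M : Matrix (Fin n) (Fin n) ℝ), ‖M‖ ≤ ρ → ∀ k : ℕ, ‖M ^ k‖ ≤ ρ ^ k := by
    intro M hM k
    induction k with
    | zero => simpa using h0
    | succ k ih =>
      rw [pow_succ, pow_succ]
      exact (norm_mul_le _ _).trans (mul_le_mul ih hM (norm_nonneg _) (by positivity))
  obtain ⟨k, rfl | rfl⟩ := Int.eq_nat_or_neg μ
  · rw [zpow_natCast, Int.natAbs_natCast]
    exact hpow C hCn k
  · rw [Matrix.zpow_neg_natCast, ← Matrix.inv_pow', Int.natAbs_neg, Int.natAbs_natCast]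
    exact hpow _ hCi k

theorem abs_det_le {n : ℕ} (M : Matrix (Fin n) (Fin n) ℝ) {b : Fin n → ℝ}
    (hM : ∀ i j, |M i j| ≤ b j) : |M.det| ≤ n.factorial * ∏ j, b j := by
  rw [Matrix.det_apply']
  refine (Finset.abs_sum_le_sum_abs _ _).trans ?_
  have : ∀ σ ∈ (Finset.univ : Finset (Perm (Fin n))),
      |((Perm.sign σ : ℤ) : ℝ) * ∏ i, M (σ i) i| ≤ ∏ j, b j := by
    intro σ _
    have hs : |((Perm.sign σ : ℤ) : ℝ)| = 1 := by
      rcases Int.units_eq_one_or (Perm.sign σ) with h | h <;> simp [h]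
    rw [abs_mul, hs, one_mul, Finset.abs_prod]
    exact Finset.prod_le_prod (fun _ _ => abs_nonneg _) fun i _ => hM _ _
  refine (Finset.sum_le_card_nsmul _ _ _ this).trans ?_
  simp [Finset.card_univ, Fintype.card_perm]

/-- `Q_λ` grows at most geometrically in `λ`, uniformly near `(1, …, 1)`. -/
theorem exists_schurQ_bound {r n : ℕ} (h : r ≤ n) {ρ : ℝ} (hρ : 1 < ρ) :
    ∃ K : ℝ, ∀ᶠ x in SumsOfSquares.nearOne n, ∀ lam : Fin r → ℤ,
      |SumsOfSquares.schurQ h lam x| ≤ K * ρ ^ ∑ i, (lam i).natAbs := by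
  -- This choice makes 1 - 2ε = ρ⁻¹.
  set ε : ℝ := (1 - ρ⁻¹) / 2 with hε
  have hρ0 : 0 < ρ := by linarith
  have hinv : ρ⁻¹ < 1 := inv_lt_one_of_one_lt₀ hρ
  have hinv0 : 0 < ρ⁻¹ := inv_pos.2 hρ0
  have hε0 : 0 < ε := by rw [hε]; linarith
  have hε1 : ε + ε < 1 := by rw [hε]; linarith
  have hρε : 1 ≤ (1 - (ε + ε)) * ρ := by
    have : 1 - (ε + ε) = ρ⁻¹ := by rw [hε]; ring
    rw [this, inv_mul_cancel₀ hρ0.ne']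
  refine ⟨|2 ^ r / (n - r).factorial * newtonDet n ε| *
    ∑ α ∈ (schurNumerator h).support, |(schurNumerator h).coeff α| *
      (n.factorial * ∏ j, ρ ^ α j), ?_⟩
  filter_upwards [eventually_nearOne (n := n) hε0] with x hx lam
  have hx0 : ∀ i, x i ≠ 0 := by
    intro i hi
    have := hx.1 i
    rw [hi] at this
    norm_num at this
    linarith
  rw [schurQ_eq_regular h lam hε0.ne' hx0 hx.2, schurQRegular, abs_mul, mul_assoc]
  refine mul_le_mul_of_nonneg_left ?_ (abs_nonneg _)
  refine (Finset.abs_sum_le_sum_abs _ _).trans ?_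
  rw [Finset.sum_mul]
  refine Finset.sum_le_sum fun α _ => ?_
  rw [abs_mul, mul_assoc]
  refine mul_le_mul_of_nonneg_left ?_ (abs_nonneg _)
  set Λ : Fin n → ℤ := fun j => if h : (j : ℕ) < r then lam ⟨j, h⟩ else 0 with hΛ
  refine (abs_det_le _ (b := fun j => ρ ^ (Λ j).natAbs * ρ ^ α j) fun k j => ?_).trans ?_
  · rw [Matrix.of_apply]
    have h1 : ‖(newtonMatrix ε x ^ exponent lam α j).mulVec (newtonOne n)‖ ≤
        ρ ^ (exponent lam α j).natAbs * 1 := by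
      refine (Matrix.linfty_opNorm_mulVec _ _).trans (mul_le_mul
        (norm_newtonMatrix_zpow_le hε0.le hρε hε1 hx0 (fun i => (hx.1 i).le) _) ?_
        (norm_nonneg _) (by positivity))
      rw [pi_norm_le_iff_of_nonneg zero_le_one]
      intro i
      unfold newtonOne
      split_ifs <;> simp
    refine (norm_le_pi_norm _ k).trans (h1.trans ?_)
    rw [mul_one, ← pow_add]
    refine pow_le_pow_right₀ hρ.le ?_
    simp only [exponent, hΛ]
    exact (Int.natAbs_add_le _ _).trans (by simp)
  · rw [Finset.prod_mul_distrib, Finset.prod_pow_eq_pow_sum]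
    have : ∑ j, (Λ j).natAbs = ∑ i, (lam i).natAbs := by
      obtain ⟨k, rfl⟩ := Nat.exists_eq_add_of_le h
      rw [Fin.sum_univ_add]
      simp [hΛ]
    rw [this]
    exact le_of_eq (by ring)

end RemovableSingularity

/-! ### Lambert-type series on an annulus. -/

section LambertSeries

/-- The antisymmetric Lambert-type series `(1 + y) / (2 (1 - y)) + ∑ a k (y ^ k - y ^ (-k))`. -/
noncomputable def lambert (a : ℕ → ℂ) (y : ℂ) : ℂ :=
  (1 + y) / (1 - y) / 2 + ∑' k : ℕ, a k * (y ^ (k + 1) - y⁻¹ ^ (k + 1))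

/-- The annulus of convergence. -/
def annulus (r : ℝ) : Set ℂ := {y | r < ‖y‖ ∧ r * ‖y‖ < 1}

theorem norm_pos_of_mem_annulus {r : ℝ} (hr : 0 < r) {y : ℂ} (hy : y ∈ annulus r) : 0 < ‖y‖ :=
  hr.trans hy.1

theorem inv_mem_annulus {r : ℝ} (hr : 0 < r) {y : ℂ} (hy : y ∈ annulus r) : y⁻¹ ∈ annulus r := by
  have h0 := norm_pos_of_mem_annulus hr hy
  refine ⟨?_, ?_⟩
  · rw [norm_inv, lt_inv_comm₀ hr h0, ← one_div, lt_div_iff₀ hr, mul_comm]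
    exact hy.2
  · rw [norm_inv, ← div_eq_mul_inv, div_lt_one h0]
    exact hy.1

theorem neg_mem_annulus {r : ℝ} {y : ℂ} (hy : y ∈ annulus r) : -y ∈ annulus r := by
  simpa [annulus] using hy

theorem mem_annulus_of_lt_one {r : ℝ} (hr1 : r < 1) {y : ℂ} (h : r < ‖y‖) (h1 : ‖y‖ < 1) :
    y ∈ annulus r := ⟨h, by nlinarith [norm_nonneg y]⟩

theorem lambert_inv {a : ℕ → ℂ} {y : ℂ} (hy : y ≠ 0) (hy1 : y ≠ 1) :
    lambert a y⁻¹ = -lambert a y := by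
  have h1 : 1 - y ≠ 0 := sub_ne_zero.2 hy1.symm
  have h2 : 1 - y⁻¹ ≠ 0 := sub_ne_zero.2 fun e => hy1 (by rw [← inv_inv y, ← e, inv_one])
  have h3 : y - 1 ≠ 0 := sub_ne_zero.2 hy1
  unfold lambert
  rw [inv_inv, neg_add, ← tsum_neg]
  congr 1
  · field_simp
    ring
  · exact tsum_congr fun k => by ring

theorem lambert_neg_one (a : ℕ → ℂ) : lambert a (-1) = 0 := by
  have : ((-1 : ℂ))⁻¹ = -1 := by norm_num
  simp [lambert, this]

/-- Geometric decay of the coefficients. -/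
def GeometricDecay (r : ℝ) (a : ℕ → ℂ) : Prop := ∃ C, ∀ k, ‖a k‖ ≤ C * r ^ (k + 1)

theorem summable_mul_pow {r : ℝ} {a : ℕ → ℂ} (ha : GeometricDecay r a) (hr : 0 ≤ r) {y : ℂ}
    (hy : r * ‖y‖ < 1) : Summable fun k : ℕ => a k * y ^ (k + 1) := by
  obtain ⟨C, hC⟩ := ha
  have hs : Summable fun k : ℕ => C * (r * ‖y‖) ^ (k + 1) :=
    ((summable_nat_add_iff 1).2
      (summable_geometric_of_lt_one (by positivity) hy)).mul_left C
  refine Summable.of_norm_bounded hs fun k => ?_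
  rw [norm_mul, norm_pow, mul_pow, ← mul_assoc]
  exact mul_le_mul_of_nonneg_right (hC k) (by positivity)

/-- Weierstrass's test on a smaller annulus ρ < |w| < R around y, where positive and negative powers
have separate geometric majorants. -/
theorem differentiableAt_lambert_tsum {r : ℝ} {a : ℕ → ℂ} (ha : GeometricDecay r a) (hr : 0 < r)
    {y : ℂ} (hy : y ∈ annulus r) :
    DifferentiableAt ℂ (fun y => ∑' k : ℕ, a k * (y ^ (k + 1) - y⁻¹ ^ (k + 1))) y := by
  obtain ⟨ρ, hρ, hρy⟩ := exists_between hy.1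
  have hy2 : ‖y‖ < r⁻¹ := by rw [← one_div, lt_div_iff₀ hr, mul_comm]; exact hy.2
  obtain ⟨R, hR, hRr⟩ := exists_between hy2
  have hρ0 : 0 < ρ := hr.trans hρ
  have hR0 : 0 < R := (norm_nonneg y).trans_lt hR
  obtain ⟨C, hC⟩ := ha
  have hC0 : 0 ≤ C := by
    have := (norm_nonneg _).trans (hC 0)
    exact nonneg_of_mul_nonneg_left this (by positivity)
  set U : Set ℂ := {w | ρ < ‖w‖ ∧ ‖w‖ < R} with hU
  have hUo : IsOpen U :=
    (isOpen_lt continuous_const continuous_norm).inter (isOpen_lt continuous_norm continuous_const)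
  have hs : Summable fun k : ℕ => C * (r * R) ^ (k + 1) + C * (r * ρ⁻¹) ^ (k + 1) := by
    refine Summable.add (Summable.mul_left _ ?_) (Summable.mul_left _ ?_)
    · refine (summable_nat_add_iff 1).2 (summable_geometric_of_lt_one (by positivity) ?_)
      rwa [lt_inv_comm₀ hR0 hr, ← one_div, lt_div_iff₀ hR0] at hRr
    · refine (summable_nat_add_iff 1).2 (summable_geometric_of_lt_one (by positivity) ?_)
      rwa [← div_eq_mul_inv, div_lt_one hρ0]
  refine (Complex.differentiableOn_tsum_of_summable_norm hs (fun k => ?_) hUo ?_).differentiableAt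
    (hUo.mem_nhds ⟨hρy, hR⟩)
  · intro w hw
    have : w ≠ 0 := norm_pos_iff.1 (hρ0.trans hw.1)
    refine DifferentiableAt.differentiableWithinAt ?_
    fun_prop (disch := assumption)
  · intro k w hw
    have hw0 : 0 < ‖w‖ := hρ0.trans hw.1
    rw [norm_mul]
    refine (mul_le_mul (hC k) (norm_sub_le _ _) (norm_nonneg _) (by positivity)).trans ?_
    rw [norm_pow, norm_pow, norm_inv, mul_add, mul_pow, mul_pow, mul_assoc, mul_assoc]
    have e1 : ‖w‖ ^ (k + 1) ≤ R ^ (k + 1) := pow_le_pow_left₀ hw0.le hw.2.le _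
    have e2 : ‖w‖⁻¹ ^ (k + 1) ≤ ρ⁻¹ ^ (k + 1) :=
      pow_le_pow_left₀ (by positivity) (inv_anti₀ hρ0 hw.1.le) _
    gcongr

theorem differentiableAt_lambert {r : ℝ} {a : ℕ → ℂ} (ha : GeometricDecay r a) (hr : 0 < r)
    {y : ℂ} (hy : y ∈ annulus r) (hy1 : y ≠ 1) : DifferentiableAt ℂ (lambert a) y := by
  have h1 : 1 - y ≠ 0 := sub_ne_zero.2 hy1.symm
  unfold lambert
  refine DifferentiableAt.add ?_ (differentiableAt_lambert_tsum ha hr hy)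
  fun_prop (disch := assumption)

/-- The residue at `1`. -/
theorem tendsto_one_sub_mul_lambert {r : ℝ} {a : ℕ → ℂ} (ha : GeometricDecay r a) (hr : 0 < r)
    (hr1 : r < 1) : Tendsto (fun y => (1 - y) * lambert a y) (𝓝[≠] 1) (𝓝 1) := by
  have hd := (differentiableAt_lambert_tsum ha hr (y := 1) (by simp [annulus, hr1])).continuousAt
  have h : ContinuousAt (fun y : ℂ => (1 + y) / 2 +
      (1 - y) * ∑' k : ℕ, a k * (y ^ (k + 1) - y⁻¹ ^ (k + 1))) 1 := by
    refine ContinuousAt.add (by fun_prop) (ContinuousAt.mul (by fun_prop) hd)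
  have := h.tendsto.mono_left (nhdsWithin_le_nhds (s := {1}ᶜ))
  simp only [sub_self, zero_mul, add_zero] at this
  rw [show ((1 : ℂ) + 1) / 2 = 1 by norm_num] at this
  refine this.congr' ?_
  filter_upwards [self_mem_nhdsWithin] with y hy
  have h1 : 1 - y ≠ 0 := sub_ne_zero.2 (Ne.symm hy)
  unfold lambert
  field_simp

/-- For |y| < 1 the rational part is 1/2 + ∑_{k>0} y^k, so the function is a two-sided Laurent
series. The term f 0 is left free: it is 1/2 for `ellK` and 0 for `ellL`. -/
theorem hasSum_lambert {r : ℝ} {a : ℕ → ℂ} (ha : GeometricDecay r a) (hr : 0 < r)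
    {y : ℂ} (hy : r < ‖y‖) (hr1 : r < 1) (hy1 : ‖y‖ < 1) {f : ℤ → ℂ}
    (hp : ∀ k : ℕ, f (k + 1) = y ^ (k + 1) + a k * y ^ (k + 1))
    (hn : ∀ k : ℕ, f (-(k + 1)) = -(a k * y⁻¹ ^ (k + 1))) :
    HasSum f (lambert a y - 1 / 2 + f 0) := by
  have hya := mem_annulus_of_lt_one hr1 hy hy1
  have h1 : 1 - y ≠ 0 := sub_ne_zero.2 fun e => by simp [← e] at hy1
  have sp := summable_mul_pow ha hr.le hya.2
  have sm := summable_mul_pow ha hr.le (inv_mem_annulus hr hya).2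
  have geo : HasSum (fun k : ℕ => y ^ (k + 1)) ((1 - y)⁻¹ - 1) := by
    have := (hasSum_nat_add_iff' (f := fun k : ℕ => y ^ k) 1).2
      (hasSum_geometric_of_norm_lt_one hy1)
    simpa using this
  have hnat : HasSum (fun n : ℕ => f n)
      ((1 - y)⁻¹ - 1 + ∑' k, a k * y ^ (k + 1) + f 0) := by
    have h : HasSum (fun k : ℕ => f ((k + 1 : ℕ) : ℤ)) ((1 - y)⁻¹ - 1 + ∑' k, a k * y ^ (k + 1)) := by
      refine (geo.add sp.hasSum).congr_fun fun k => ?_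
      rw [← hp]
      push_cast
      rfl
    have := (hasSum_nat_add_iff (f := fun n : ℕ => f n) 1).1 h
    simpa using this
  have hneg : HasSum (fun n : ℕ => f (-(n + 1))) (-∑' k, a k * y⁻¹ ^ (k + 1)) := by
    simp only [hn]
    exact sm.hasSum.neg
  have := HasSum.of_nat_of_neg_add_one hnat hneg
  convert this using 1
  have e : lambert a y = (1 + y) / (1 - y) / 2 +
      (∑' k, a k * y ^ (k + 1) - ∑' k, a k * y⁻¹ ^ (k + 1)) := by
    rw [lambert, ← sp.tsum_sub sm]
    simp only [mul_sub]
  rw [e]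
  field_simp
  ring

end LambertSeries

/-! ### The elliptic kernels and their addition formulas. -/

section EllipticFunctions

variable {p : ℂ}

theorem norm_pow_succ_lt_one (hp1 : ‖p‖ < 1) (k : ℕ) : ‖p ^ (k + 1)‖ < 1 := by
  rw [norm_pow]
  exact pow_lt_one₀ (norm_nonneg _) hp1 (by omega)

theorem one_add_pow_ne_zero (hp1 : ‖p‖ < 1) (k : ℕ) : 1 + p ^ (k + 1) ≠ 0 := by
  intro h
  have := norm_pow_succ_lt_one hp1 k
  rw [eq_neg_of_add_eq_zero_right h, norm_neg, norm_one] at this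
  exact lt_irrefl _ this

theorem one_sub_pow_ne_zero (hp1 : ‖p‖ < 1) (k : ℕ) : 1 - p ^ (k + 1) ≠ 0 := by
  intro h
  have := norm_pow_succ_lt_one hp1 k
  rw [← sub_eq_zero.1 h, norm_one] at this
  exact lt_irrefl _ this

theorem one_add_zpow_ne_zero (hp0 : p ≠ 0) (hp1 : ‖p‖ < 1) (k : ℤ) : 1 + p ^ k ≠ 0 := by
  obtain ⟨n, rfl | rfl⟩ := Int.eq_nat_or_neg k
  · rcases n with _ | n
    · norm_num
    · rw [zpow_natCast]; exact one_add_pow_ne_zero hp1 n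
  · rcases n with _ | n
    · norm_num
    · rw [zpow_neg, zpow_natCast]
      have := one_add_pow_ne_zero hp1 n
      have h2 : p ^ (n + 1) ≠ 0 := pow_ne_zero _ hp0
      intro h
      field_simp at h
      exact this (by linear_combination h)

theorem one_sub_zpow_ne_zero (hp0 : p ≠ 0) (hp1 : ‖p‖ < 1) {k : ℤ} (hk : k ≠ 0) :
    1 - p ^ k ≠ 0 := by
  obtain ⟨n, rfl | rfl⟩ := Int.eq_nat_or_neg k
  · rcases n with _ | n
    · simp at hk
    · rw [zpow_natCast]; exact one_sub_pow_ne_zero hp1 n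
  · rcases n with _ | n
    · simp at hk
    · rw [zpow_neg, zpow_natCast]
      have := one_sub_pow_ne_zero hp1 n
      have h2 : p ^ (n + 1) ≠ 0 := pow_ne_zero _ hp0
      intro h
      field_simp at h
      exact this (by linear_combination -h)

theorem geometricDecay_div {b : ℂ} (hb : b = 1 ∨ b = -1) (hp1 : ‖p‖ < 1) :
    GeometricDecay ‖p‖ fun k => p ^ (k + 1) / (1 + b * p ^ (k + 1)) := by
  refine ⟨(1 - ‖p‖)⁻¹, fun k => ?_⟩
  have h1 : 1 - ‖p‖ ≤ ‖1 + b * p ^ (k + 1)‖ := by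
    have hb' : ‖b * p ^ (k + 1)‖ ≤ ‖p‖ := by
      rw [norm_mul, norm_pow]
      have : ‖b‖ = 1 := by rcases hb with rfl | rfl <;> simp
      rw [this, one_mul, pow_succ]
      exact mul_le_of_le_one_left (norm_nonneg _) (pow_le_one₀ (norm_nonneg _) hp1.le)
    have := norm_sub_norm_le (1 : ℂ) (-(b * p ^ (k + 1)))
    rw [norm_neg, norm_one, sub_neg_eq_add] at this
    linarith
  rw [norm_div, norm_pow, div_eq_mul_inv, mul_comm]
  have h0 : 0 < 1 - ‖p‖ := by linarith
  gcongr

/-- The function with expansion `∑ y ^ k / (1 + p ^ k)` in `|p| < |y| < 1`. -/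
noncomputable def ellK (p : ℂ) : ℂ → ℂ := lambert fun k => -(p ^ (k + 1) / (1 + p ^ (k + 1)))

/-- The function with expansion `1 / 2 + ∑ y ^ k / (1 - p ^ k)` in `|p| < |y| < 1`. -/
noncomputable def ellL (p : ℂ) : ℂ → ℂ := lambert fun k => p ^ (k + 1) / (1 - p ^ (k + 1))

theorem decay_ellK (hp1 : ‖p‖ < 1) :
    GeometricDecay ‖p‖ fun k => -(p ^ (k + 1) / (1 + p ^ (k + 1))) := by
  obtain ⟨C, hC⟩ := geometricDecay_div (p := p) (Or.inl rfl) hp1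
  exact ⟨C, fun k => by simpa using hC k⟩

theorem decay_ellL (hp1 : ‖p‖ < 1) :
    GeometricDecay ‖p‖ fun k => p ^ (k + 1) / (1 - p ^ (k + 1)) := by
  obtain ⟨C, hC⟩ := geometricDecay_div (p := p) (Or.inr rfl) hp1
  exact ⟨C, fun k => by simpa [sub_eq_add_neg] using hC k⟩

theorem hasSum_ellK (hp0 : p ≠ 0) (hp1 : ‖p‖ < 1) {y : ℂ} (hy : ‖p‖ < ‖y‖) (hy1 : ‖y‖ < 1) :
    HasSum (fun k : ℤ => y ^ k / (1 + p ^ k)) (ellK p y) := by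
  have h0 : y ≠ 0 := norm_pos_iff.1 ((norm_nonneg p).trans_lt hy)
  have := hasSum_lambert (decay_ellK hp1) (norm_pos_iff.2 hp0) hy hp1 hy1
    (f := fun k : ℤ => y ^ k / (1 + p ^ k)) (fun k => ?_) (fun k => ?_)
  · simp only [zpow_zero] at this
    rw [show lambert (fun k => -(p ^ (k + 1) / (1 + p ^ (k + 1)))) y - 1 / 2 + 1 / (1 + 1) =
      ellK p y by rw [ellK]; norm_num] at this
    exact this
  · have h1 := one_add_pow_ne_zero hp1 k
    rw [show ((k : ℤ) + 1) = ((k + 1 : ℕ) : ℤ) by push_cast; rfl, zpow_natCast, zpow_natCast]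
    field_simp
    ring
  · have h1 := one_add_pow_ne_zero hp1 k
    have h2 : p ^ (k + 1) ≠ 0 := pow_ne_zero _ hp0
    have h3 : y ^ (k + 1) ≠ 0 := pow_ne_zero _ h0
    have h4 : p ^ (k + 1) + 1 ≠ 0 := by rwa [add_comm]
    rw [show (-((k : ℤ) + 1)) = -((k + 1 : ℕ) : ℤ) by push_cast; rfl, zpow_neg, zpow_neg,
      zpow_natCast, zpow_natCast, inv_pow]
    field_simp
    ring

/-- The term k = 0 is a division by zero, hence 0; this accounts for the constant -1/2. -/
theorem hasSum_ellL (hp0 : p ≠ 0) (hp1 : ‖p‖ < 1) {y : ℂ} (hy : ‖p‖ < ‖y‖) (hy1 : ‖y‖ < 1) :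
    HasSum (fun k : ℤ => y ^ k / (1 - p ^ k)) (ellL p y - 1 / 2) := by
  have h0 : y ≠ 0 := norm_pos_iff.1 ((norm_nonneg p).trans_lt hy)
  have := hasSum_lambert (decay_ellL hp1) (norm_pos_iff.2 hp0) hy hp1 hy1
    (f := fun k : ℤ => y ^ k / (1 - p ^ k)) (fun k => ?_) (fun k => ?_)
  · simpa [ellL] using this
  · have h1 := one_sub_pow_ne_zero hp1 k
    rw [show ((k : ℤ) + 1) = ((k + 1 : ℕ) : ℤ) by push_cast; rfl, zpow_natCast, zpow_natCast]
    field_simp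
    ring
  · have h1 := one_sub_pow_ne_zero hp1 k
    have h2 : p ^ (k + 1) ≠ 0 := pow_ne_zero _ hp0
    have h3 : y ^ (k + 1) ≠ 0 := pow_ne_zero _ h0
    have h4 : p ^ (k + 1) - 1 ≠ 0 := by rw [← neg_ne_zero, neg_sub]; exact h1
    rw [show (-((k : ℤ) + 1)) = -((k + 1 : ℕ) : ℤ) by push_cast; rfl, zpow_neg, zpow_neg,
      zpow_natCast, zpow_natCast, inv_pow]
    field_simp
    ring

/-- The product of two values of `ellK`, up to a term depending on the quotient only. -/
theorem exists_ellK_mul_ellK (hp0 : p ≠ 0) (hp1 : ‖p‖ < 1) {w : ℂ} (hw : ‖p‖ < ‖w‖)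
    (hw1 : ‖w‖ < 1) : ∃ M : ℂ, ∀ z, ‖p‖ < ‖w * z‖ → ‖z‖ < 1 →
      ellK p (w * z) * ellK p z = ellK p w * (ellL p z - ellL p (w * z)) + M := by
  refine ⟨∑' k : ℤ, w ^ k / ((1 + p ^ k) * (1 + p ^ (0 - k))), fun z hwz hz1 => ?_⟩
  have hw0 : w ≠ 0 := norm_pos_iff.1 ((norm_nonneg p).trans_lt hw)
  have hwz0 : w * z ≠ 0 := norm_pos_iff.1 ((norm_nonneg p).trans_lt hwz)
  have hz0 : z ≠ 0 := right_ne_zero_of_mul hwz0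
  have hwzz : ‖w * z‖ < ‖z‖ := by
    rw [norm_mul]; exact mul_lt_of_lt_one_left (norm_pos_iff.2 hz0) hw1
  have hz : ‖p‖ < ‖z‖ := hwz.trans hwzz
  have hwz1 : ‖w * z‖ < 1 := hwzz.trans hz1
  have hKy := hasSum_ellK hp0 hp1 hwz hwz1
  have hKz := hasSum_ellK hp0 hp1 hz hz1
  have hKw := hasSum_ellK hp0 hp1 hw hw1
  set f : ℤ → ℤ → ℂ := fun N k => z ^ N * (w ^ k / ((1 + p ^ k) * (1 + p ^ (N - k)))) with hf
  have hprod : HasSum (fun x : ℤ × ℤ => f x.1 x.2) (ellK p (w * z) * ellK p z) := by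
    have hs := summable_mul_of_summable_norm hKy.summable.norm hKz.summable.norm
    have h1 := hs.hasSum
    rw [← tsum_mul_tsum_of_summable_norm hKy.summable.norm hKz.summable.norm, hKy.tsum_eq,
      hKz.tsum_eq] at h1
    let e : ℤ × ℤ ≃ ℤ × ℤ :=
      ⟨fun x => (x.2, x.1 - x.2), fun x => (x.1 + x.2, x.1), fun x => by simp, fun x => by simp⟩
    refine ((e.hasSum_iff).2 h1).congr_fun fun x => ?_
    simp only [hf, e, Function.comp, Equiv.coe_fn_mk]
    have h3 := one_add_zpow_ne_zero hp0 hp1 x.2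
    have h4 := one_add_zpow_ne_zero hp0 hp1 (x.1 - x.2)
    rw [mul_zpow, div_mul_div_comm, mul_assoc, ← zpow_add₀ hz0]
    rw [show x.2 + (x.1 - x.2) = x.1 by ring]
    ring
  have hfib : ∀ N : ℤ, HasSum (f N) (if N = 0 then
      ∑' k : ℤ, w ^ k / ((1 + p ^ k) * (1 + p ^ (0 - k))) else
      (z ^ N / (1 - p ^ N) - (w * z) ^ N / (1 - p ^ N)) * ellK p w) := by
    intro N
    split_ifs with hN
    · subst hN
      have := (hprod.summable.prod_factor 0).hasSum
      simpa [hf] using this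
    -- For N ≠ 0, (1 - p^N)/((1 + p^k)(1 + p^(N-k))) = 1/(1 + p^k) - 1/(1 + p^(k-N)). So the
    -- coefficient of z^N is a difference of two copies of the series of `ellK p w`, one shifted by
    -- N.
    · have h1 := ((Equiv.subRight N).hasSum_iff).2 hKw
      have h2 := (hKw.sub (h1.mul_left (w ^ N))).mul_left (z ^ N / (1 - p ^ N))
      have hv : z ^ N / (1 - p ^ N) * (ellK p w - w ^ N * ellK p w) =
          (z ^ N / (1 - p ^ N) - (w * z) ^ N / (1 - p ^ N)) * ellK p w := by
        rw [mul_zpow]; ring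
      rw [hv] at h2
      refine h2.congr_fun fun k => ?_
      simp only [hf, Function.comp, Equiv.subRight_apply]
      have h3 := one_add_zpow_ne_zero hp0 hp1 k
      have h4 := one_add_zpow_ne_zero hp0 hp1 (N - k)
      have h5 := one_add_zpow_ne_zero hp0 hp1 (k - N)
      have h6 := one_sub_zpow_ne_zero hp0 hp1 hN
      have h7 : w ^ N * (w ^ (k - N) / (1 + p ^ (k - N))) = w ^ k / (1 + p ^ (k - N)) := by
        rw [← mul_div_assoc, ← zpow_add₀ hw0]; congr 2; ring
      rw [h7]
      have hpN : p ^ N = p ^ k * p ^ (N - k) := by rw [← zpow_add₀ hp0]; congr 1; ring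
      have hpi : p ^ (k - N) = (p ^ (N - k))⁻¹ := by rw [← zpow_neg]; congr 1; ring
      have h8 : p ^ (N - k) ≠ 0 := zpow_ne_zero _ hp0
      rw [hpi] at h5 ⊢
      rw [hpN] at h6 ⊢
      set A := p ^ k
      set B := p ^ (N - k)
      have h9 : B + 1 ≠ 0 := by rwa [add_comm]
      field_simp
      ring
  have hN := hprod.prod_fiberwise hfib
  have hLz := hasSum_ellL hp0 hp1 hz hz1
  have hLy := hasSum_ellL hp0 hp1 hwz hwz1
  have hd := hN.sub ((hLz.sub hLy).mul_right (ellK p w))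
  have h0 := hasSum_ite_eq (0 : ℤ) (∑' k : ℤ, w ^ k / ((1 + p ^ k) * (1 + p ^ (0 - k))))
  have := hd.unique (h0.congr_fun fun N => ?_)
  · linear_combination this
  · split_ifs with hN0
    · subst hN0; simp
    · ring

theorem tendsto_neg_ofReal_one : Tendsto (fun t : ℝ => -(t : ℂ)) (𝓝[<] 1) (𝓝 (-1)) := by
  have : Tendsto (fun t : ℝ => -(t : ℂ)) (𝓝 1) (𝓝 (-((1 : ℝ) : ℂ))) :=
    Continuous.tendsto (by fun_prop) _
  simpa using this.mono_left nhdsWithin_le_nhds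

theorem continuousAt_ellK (hp0 : p ≠ 0) (hp1 : ‖p‖ < 1) {y : ℂ} (hy : y ∈ annulus ‖p‖)
    (hy1 : y ≠ 1) : ContinuousAt (ellK p) y :=
  (differentiableAt_lambert (decay_ellK hp1) (norm_pos_iff.2 hp0) hy hy1).continuousAt

theorem continuousAt_ellL (hp0 : p ≠ 0) (hp1 : ‖p‖ < 1) {y : ℂ} (hy : y ∈ annulus ‖p‖)
    (hy1 : y ≠ 1) : ContinuousAt (ellL p) y :=
  (differentiableAt_lambert (decay_ellL hp1) (norm_pos_iff.2 hp0) hy hy1).continuousAt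

theorem ne_one_of_norm_lt {y : ℂ} (hy : ‖y‖ < 1) : y ≠ 1 := by
  rintro rfl; simp at hy

theorem neg_one_mem_annulus (hp1 : ‖p‖ < 1) : (-1 : ℂ) ∈ annulus ‖p‖ := by
  simp [annulus, hp1]

/-- The constant of `exists_ellK_mul_ellK` is found by letting z tend to -1, where both `ellK` and
`ellL` vanish. -/
theorem ellK_mul_ellK (hp0 : p ≠ 0) (hp1 : ‖p‖ < 1) {w z : ℂ} (hw1 : ‖w‖ < 1)
    (hwz : ‖p‖ < ‖w * z‖) (hz1 : ‖z‖ < 1) :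
    ellK p (w * z) * ellK p z = ellK p w * (ellL p z - ellL p (w * z) + ellL p (-w)) := by
  have hw : ‖p‖ < ‖w‖ := by
    refine hwz.trans_le ?_
    rw [norm_mul]; exact mul_le_of_le_one_right (norm_nonneg _) hz1.le
  obtain ⟨M, hM⟩ := exists_ellK_mul_ellK hp0 hp1 hw hw1
  have hwa := neg_mem_annulus (mem_annulus_of_lt_one hp1 hw hw1)
  have hw1' : -w ≠ 1 := ne_one_of_norm_lt (by rwa [norm_neg])
  have hn1 := neg_one_mem_annulus hp1
  have hn1' : (-1 : ℂ) ≠ 1 := by norm_num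
  have l1 := tendsto_neg_ofReal_one
  have l2 : Tendsto (fun t : ℝ => w * -(t : ℂ)) (𝓝[<] 1) (𝓝 (-w)) := by
    simpa using l1.const_mul w
  have hK1 := (continuousAt_ellK hp0 hp1 hn1 hn1').tendsto.comp l1
  have hL1 := (continuousAt_ellL hp0 hp1 hn1 hn1').tendsto.comp l1
  have hK2 := (continuousAt_ellK hp0 hp1 hwa hw1').tendsto.comp l2
  have hL2 := (continuousAt_ellL hp0 hp1 hwa hw1').tendsto.comp l2
  have e1 := hK2.mul hK1
  have e2 := ((hL1.sub hL2).const_mul (ellK p w)).add_const M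
  have e3 := tendsto_nhds_unique_of_eventuallyEq e1 e2 (by
    have l3 : ∀ᶠ t : ℝ in 𝓝[<] 1, ‖p‖ < ‖w * -(t : ℂ)‖ :=
      (l2.norm).eventually_const_lt (by rwa [norm_neg])
    filter_upwards [l3, self_mem_nhdsWithin, Ioo_mem_nhdsLT (zero_lt_one' ℝ)] with t h1 h2 h3
    refine hM _ h1 ?_
    rw [norm_neg, Complex.norm_real, Real.norm_eq_abs, abs_of_pos h3.1]
    exact h3.2)
  have hKn : ellK p (-1) = 0 := lambert_neg_one _
  have hLn : ellL p (-1) = 0 := lambert_neg_one _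
  rw [hKn, hLn] at e3
  rw [hM z hwz hz1]
  linear_combination -e3

/-- The value of `ellK p z * ellK p (-z)`. -/
noncomputable def ellConst (p : ℂ) : ℂ := deriv (ellK p) (-1)

theorem hasDerivAt_ellK (hp0 : p ≠ 0) (hp1 : ‖p‖ < 1) :
    HasDerivAt (ellK p) (ellConst p) (-1) :=
  (differentiableAt_lambert (decay_ellK hp1) (norm_pos_iff.2 hp0) (neg_one_mem_annulus hp1)
    (by norm_num)).hasDerivAt

/-- In `ellK_mul_ellK` let w = -t with t → 1. The factor `ellK p (-t)` vanishes while `ellL p t` has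
a simple pole, and their product tends to the derivative at -1. -/
theorem ellK_mul_ellK_neg (hp0 : p ≠ 0) (hp1 : ‖p‖ < 1) {z : ℂ} (hz : ‖p‖ < ‖z‖)
    (hz1 : ‖z‖ < 1) : ellK p (-z) * ellK p z = ellConst p := by
  have hza := neg_mem_annulus (mem_annulus_of_lt_one hp1 hz hz1)
  have hz1' : -z ≠ 1 := ne_one_of_norm_lt (by rwa [norm_neg])
  have hn1 := neg_one_mem_annulus hp1
  have l1 := tendsto_neg_ofReal_one
  have l2 : Tendsto (fun t : ℝ => -(t : ℂ) * z) (𝓝[<] 1) (𝓝 (-z)) := by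
    simpa using l1.mul_const z
  have l3 : Tendsto (fun t : ℝ => (t : ℂ)) (𝓝[<] 1) (𝓝[≠] 1) := by
    refine tendsto_nhdsWithin_iff.2 ⟨by simpa using l1.neg, ?_⟩
    filter_upwards [self_mem_nhdsWithin] with t ht
    simpa using ne_of_lt ht
  have l4 : Tendsto (fun t : ℝ => -(t : ℂ)) (𝓝[<] 1) (𝓝[≠] (-1)) := by
    refine tendsto_nhdsWithin_iff.2 ⟨l1, ?_⟩
    filter_upwards [self_mem_nhdsWithin] with t ht
    simpa using ne_of_lt ht
  have hK2 := (continuousAt_ellK hp0 hp1 hza hz1').tendsto.comp l2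
  have hL2 := (continuousAt_ellL hp0 hp1 hza hz1').tendsto.comp l2
  have hK1 := (continuousAt_ellK hp0 hp1 hn1 (by norm_num)).tendsto.comp l1
  have hKn : ellK p (-1) = 0 := lambert_neg_one _
  have hres := (tendsto_one_sub_mul_lambert (decay_ellL hp1) (norm_pos_iff.2 hp0) hp1).comp l3
  have hslope := (hasDerivAt_iff_tendsto_slope.1 (hasDerivAt_ellK hp0 hp1)).comp l4
  have e1 := hK2.mul_const (ellK p z)
  have e2 := (hK1.mul (hL2.const_sub (ellL p z))).add (hslope.mul hres)
  rw [hKn, zero_mul, zero_add, mul_one] at e2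
  refine tendsto_nhds_unique_of_eventuallyEq e1 e2 ?_
  have l5 : ∀ᶠ t : ℝ in 𝓝[<] 1, ‖p‖ < ‖-(t : ℂ) * z‖ :=
    (l2.norm).eventually_const_lt (by rwa [norm_neg])
  filter_upwards [l5, Ioo_mem_nhdsLT (zero_lt_one' ℝ)] with t h1 h3
  have ht : ‖-(t : ℂ)‖ < 1 := by
    rw [norm_neg, Complex.norm_real, Real.norm_eq_abs, abs_of_pos h3.1]
    exact h3.2
  have := ellK_mul_ellK hp0 hp1 ht h1 hz1
  have hne : (1 : ℂ) - t ≠ 0 := by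
    rw [sub_ne_zero]
    exact_mod_cast h3.2.ne'
  simp only [Function.comp, slope_def_field, hKn]
  rw [this, neg_neg, ellL, show -(t : ℂ) - -1 = 1 - t by ring]
  field_simp
  ring

theorem ellK_inv {y : ℂ} (hy : y ≠ 0) (hy1 : y ≠ 1) : ellK p y⁻¹ = -ellK p y :=
  lambert_inv hy hy1

theorem ellL_inv {y : ℂ} (hy : y ≠ 0) (hy1 : y ≠ 1) : ellL p y⁻¹ = -ellL p y :=
  lambert_inv hy hy1

theorem ellK_mul_ellK_neg_of_ne (hp0 : p ≠ 0) (hp1 : ‖p‖ < 1) {z : ℂ} (hz : z ∈ annulus ‖p‖)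
    (hz1 : ‖z‖ ≠ 1) : ellK p (-z) * ellK p z = ellConst p := by
  have hp := norm_pos_iff.2 hp0
  rcases lt_or_gt_of_ne hz1 with h | h
  · exact ellK_mul_ellK_neg hp0 hp1 hz.1 h
  · have h0 : z ≠ 0 := norm_pos_iff.1 (by linarith)
    have hi := inv_mem_annulus hp hz
    have := ellK_mul_ellK_neg hp0 hp1 hi.1 (by rw [norm_inv]; exact inv_lt_one_of_one_lt₀ h)
    rw [← inv_neg, ellK_inv h0, ellK_inv (neg_ne_zero.2 h0), neg_mul_neg] at this
    · exact this
    · rintro e; rw [← norm_neg, e, norm_one] at h; exact lt_irrefl _ h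
    · rintro e; rw [e, norm_one] at h; exact lt_irrefl _ h

/-- Points whose quotient lies in the annulus off the unit circle. -/
def Apart (r : ℝ) (a b : ℂ) : Prop := a ≠ 0 ∧ b ≠ 0 ∧ ‖a‖ ≠ ‖b‖ ∧ a / b ∈ annulus r

theorem Apart.symm {r : ℝ} (hr : 0 < r) {a b : ℂ} (h : Apart r a b) : Apart r b a :=
  ⟨h.2.1, h.1, h.2.2.1.symm, by rw [← inv_div]; exact inv_mem_annulus hr h.2.2.2⟩

theorem Apart.neg_right {r : ℝ} {a b : ℂ} (h : Apart r a b) : Apart r a (-b) :=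
  ⟨h.1, neg_ne_zero.2 h.2.1, by rw [norm_neg]; exact h.2.2.1,
    by rw [div_neg]; exact neg_mem_annulus h.2.2.2⟩

theorem Apart.norm_div_ne_one {r : ℝ} {a b : ℂ} (h : Apart r a b) : ‖a / b‖ ≠ 1 := by
  rw [norm_div, Ne, div_eq_one_iff_eq (norm_ne_zero_iff.2 h.2.1)]
  exact h.2.2.1

theorem Apart.neg_div_ne_one {r : ℝ} {a b : ℂ} (h : Apart r a b) : -(a / b) ≠ 1 := by
  intro e
  apply h.norm_div_ne_one
  rw [← norm_neg, e, norm_one]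

theorem Apart.neg_div_ne_zero {r : ℝ} {a b : ℂ} (h : Apart r a b) : -(a / b) ≠ 0 :=
  neg_ne_zero.2 (div_ne_zero h.1 h.2.1)

theorem ellK_swap {r : ℝ} {a b : ℂ} (h : Apart r a b) :
    ellK p (-(b / a)) = -ellK p (-(a / b)) := by
  rw [← ellK_inv h.neg_div_ne_zero h.neg_div_ne_one, inv_neg, inv_div]

theorem ellL_swap {r : ℝ} {a b : ℂ} (h : Apart r a b) :
    ellL p (-(b / a)) = -ellL p (-(a / b)) := by
  rw [← ellL_inv h.neg_div_ne_zero h.neg_div_ne_one, inv_neg, inv_div]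

/-- `ellK_mul_ellK` with w = a/b and z = -b/c, multiplied by `ellK p (-(a / b))` so that the factor
at a/b becomes `ellConst p`. The ordering of the norms keeps the arguments inside the unit disc. -/
theorem ell_addition_of_lt (hp0 : p ≠ 0) (hp1 : ‖p‖ < 1) {a b c : ℂ} (hab : Apart ‖p‖ a b)
    (hac : Apart ‖p‖ a c) (h1 : ‖a‖ < ‖b‖) (h2 : ‖b‖ < ‖c‖) :
    ellK p (-(a / b)) * ellK p (-(b / c)) * ellK p (-(a / c)) =
      ellConst p * (ellL p (-(a / b)) + ellL p (-(b / c)) - ellL p (-(a / c))) := by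
  have hb : b ≠ 0 := hab.2.1
  have hc : c ≠ 0 := hac.2.1
  have hw1 : ‖a / b‖ < 1 := by rw [norm_div, div_lt_one (norm_pos_iff.2 hb)]; exact h1
  have hz1 : ‖-(b / c)‖ < 1 := by
    rw [norm_neg, norm_div, div_lt_one (norm_pos_iff.2 hc)]; exact h2
  have e : a / b * -(b / c) = -(a / c) := by field_simp
  have := ellK_mul_ellK hp0 hp1 hw1 (z := -(b / c)) (by rw [e, norm_neg]; exact hac.2.2.2.1) hz1
  rw [e] at this
  have h3 := ellK_mul_ellK_neg hp0 hp1 hab.2.2.2.1 hw1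
  linear_combination ellK p (-(a / b)) * this + (ellL p (-(b / c)) - ellL p (-(a / c)) +
    ellL p (-(a / b))) * h3

/-- Both sides are alternating in a, b, c, which reduces every ordering of the norms to the previous
one. -/
theorem ell_addition (hp0 : p ≠ 0) (hp1 : ‖p‖ < 1) {a b c : ℂ} (hab : Apart ‖p‖ a b)
    (hbc : Apart ‖p‖ b c) (hac : Apart ‖p‖ a c) :
    ellK p (-(a / b)) * ellK p (-(b / c)) * ellK p (-(a / c)) =
      ellConst p * (ellL p (-(a / b)) + ellL p (-(b / c)) - ellL p (-(a / c))) := by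
  have hp := norm_pos_iff.2 hp0
  have hba := hab.symm hp
  have hcb := hbc.symm hp
  have hca := hac.symm hp
  have k1 := ellK_swap (p := p) hab
  have k2 := ellK_swap (p := p) hbc
  have k3 := ellK_swap (p := p) hac
  have l1 := ellL_swap (p := p) hab
  have l2 := ellL_swap (p := p) hbc
  have l3 := ellL_swap (p := p) hac
  rcases lt_or_gt_of_ne hab.2.2.1 with h1 | h1 <;> rcases lt_or_gt_of_ne hbc.2.2.1 with h2 | h2 <;>
    rcases lt_or_gt_of_ne hac.2.2.1 with h3 | h3
  · exact ell_addition_of_lt hp0 hp1 hab hac h1 h2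
  · linarith
  · have := ell_addition_of_lt hp0 hp1 hac hab h3 h2
    rw [k2, l2] at this
    linear_combination -this
  · have := ell_addition_of_lt hp0 hp1 hca hcb h3 h1
    rw [k2, l2, k3, l3] at this
    linear_combination this
  · have := ell_addition_of_lt hp0 hp1 hba hbc h1 h3
    rw [k1, l1] at this
    linear_combination -this
  · have := ell_addition_of_lt hp0 hp1 hbc hba h2 h3
    rw [k1, l1, k3, l3] at this
    linear_combination this
  · linarith
  · have := ell_addition_of_lt hp0 hp1 hcb hca h2 h1
    rw [k1, l1, k2, l2, k3, l3] at this
    linear_combination -this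

/-- The expansion of `ellK` at a pair of points with respect to a third point. -/
theorem ell_base_change (hp0 : p ≠ 0) (hp1 : ‖p‖ < 1) (hE : ellConst p ≠ 0) {a b c : ℂ}
    (hab : Apart ‖p‖ a b) (hbc : Apart ‖p‖ b c) (hac : Apart ‖p‖ a c) :
    ellConst p * ellK p (-(a / b)) = ellK p (-(a / c)) * ellK p (-(b / c)) *
      (ellL p (-(a / b)) + ellL p (b / c) - ellL p (a / c)) := by
  -- The addition formula with -c for c; the values at a/c and b/c are then eliminated because the
  -- product of the values at z and -z is `ellConst p`.
  have h := ell_addition hp0 hp1 hab hbc.neg_right hac.neg_right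
  simp only [div_neg, neg_neg] at h
  have h1 := ellK_mul_ellK_neg_of_ne hp0 hp1 hac.2.2.2 hac.norm_div_ne_one
  have h2 := ellK_mul_ellK_neg_of_ne hp0 hp1 hbc.2.2.2 hbc.norm_div_ne_one
  refine mul_left_cancel₀ hE ?_
  linear_combination (ellK p (-(a / c)) * ellK p (-(b / c))) * h -
    ellK p (-(a / b)) * (ellK p (-(b / c)) * ellK p (b / c)) * h1 -
    ellK p (-(a / b)) * ellConst p * h2

/-- Expand the kernel at each pair among a, b, c with respect to x. The terms in `ellL` involving x
cancel cyclically, and what remains is the right side of the addition formula for a, b, c. -/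
theorem ell_four_term (hp0 : p ≠ 0) (hp1 : ‖p‖ < 1) (hE : ellConst p ≠ 0) {x a b c : ℂ}
    (hxa : Apart ‖p‖ x a) (hxb : Apart ‖p‖ x b) (hxc : Apart ‖p‖ x c) (hab : Apart ‖p‖ a b)
    (hbc : Apart ‖p‖ b c) (hac : Apart ‖p‖ a c) :
    ellConst p ^ 2 * (ellK p (-(x / a)) * ellK p (-(b / c)) - ellK p (-(x / b)) * ellK p (-(a / c))
      + ellK p (-(x / c)) * ellK p (-(a / b))) =
      ellK p (-(x / a)) * ellK p (-(x / b)) * ellK p (-(x / c)) * ellK p (-(a / b)) *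
        ellK p (-(a / c)) * ellK p (-(b / c)) := by
  have hp := norm_pos_iff.2 hp0
  have h1 := ell_base_change hp0 hp1 hE hab (hxb.symm hp) (hxa.symm hp)
  have h2 := ell_base_change hp0 hp1 hE hbc (hxc.symm hp) (hxb.symm hp)
  have h3 := ell_base_change hp0 hp1 hE hac (hxc.symm hp) (hxa.symm hp)
  have h4 := ell_addition hp0 hp1 hab hbc hac
  rw [ellK_swap hxa, ellK_swap hxb] at h1
  rw [ellK_swap hxb, ellK_swap hxc] at h2
  rw [ellK_swap hxa, ellK_swap hxc] at h3
  linear_combination ellConst p * (ellK p (-(x / a)) * h2 - ellK p (-(x / b)) * h3 +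
    ellK p (-(x / c)) * h1) -
    ellK p (-(x / a)) * ellK p (-(x / b)) * ellK p (-(x / c)) * h4

end EllipticFunctions

/-! ### Theta constants and the two-square identity. -/

section ThetaConstant

variable {p : ℂ}

/-- The theta constant `∑ p ^ (n ^ 2)`. -/
noncomputable def phi (p : ℂ) : ℂ := ∑' n : ℤ, p ^ (n.natAbs ^ 2)

theorem pow_natAbs_sq (p : ℂ) (n : ℤ) : p ^ (n.natAbs ^ 2) = p ^ (n * n) := by
  rw [← zpow_natCast]
  congr 1
  push_cast
  rw [sq_abs, sq]

theorem summable_pow_natAbs {r : ℝ} (hr : 0 ≤ r) (hr1 : r < 1) :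
    Summable fun n : ℤ => r ^ n.natAbs := by
  have := summable_geometric_of_lt_one hr hr1
  exact Summable.of_nat_of_neg (by simpa using this) (by simpa using this)

theorem summable_phi (hp1 : ‖p‖ < 1) : Summable fun n : ℤ => ‖p ^ (n * n)‖ := by
  refine Summable.of_nonneg_of_le (fun _ => norm_nonneg _) (fun n => ?_)
    (summable_pow_natAbs (norm_nonneg p) hp1)
  rw [← pow_natAbs_sq, norm_pow]
  exact pow_le_pow_of_le_one (norm_nonneg _) hp1.le (Nat.le_self_pow two_ne_zero _)

theorem hasSum_phi (hp1 : ‖p‖ < 1) : HasSum (fun n : ℤ => p ^ (n * n)) (phi p) := by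
  have : phi p = ∑' n : ℤ, p ^ (n * n) := tsum_congr fun n => pow_natAbs_sq p n
  rw [this]
  exact (summable_phi hp1).of_norm.hasSum

theorem hasSum_phi_mul {a b : ℂ} (ha : ‖a‖ < 1) (hb : ‖b‖ < 1) :
    HasSum (fun x : ℤ × ℤ => a ^ (x.1 * x.1) * b ^ (x.2 * x.2)) (phi a * phi b) := by
  have h := (summable_mul_of_summable_norm (summable_phi ha) (summable_phi hb)).hasSum
  rw [← tsum_mul_tsum_of_summable_norm (summable_phi ha) (summable_phi hb),
    (hasSum_phi ha).tsum_eq, (hasSum_phi hb).tsum_eq] at h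
  exact h

/-- The pairs (x + y, x - y) are exactly those with entries of equal parity. -/
theorem hasSum_diagonal {F : ℤ × ℤ → ℂ} {s : ℂ} (hF : HasSum F s)
    (h0 : ∀ a b, ¬Even (a + b) → F (a, b) = 0) :
    HasSum (fun x : ℤ × ℤ => F (x.1 + x.2, x.1 - x.2)) s := by
  have hinj : Function.Injective fun x : ℤ × ℤ => (x.1 + x.2, x.1 - x.2) := by
    rintro ⟨a, b⟩ ⟨c, d⟩ h
    simp only [Prod.mk.injEq] at h ⊢
    omega
  refine (hinj.hasSum_iff ?_).2 hF
  rintro ⟨a, b⟩ hab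
  refine h0 a b fun he => hab ?_
  obtain ⟨c, hc⟩ := he
  exact ⟨(c, a - c), by simp only [Prod.mk.injEq]; omega⟩

theorem even_mul_self {n : ℤ} (h : Even n) : Even (n * n) := h.mul_left n

theorem odd_mul_self {n : ℤ} (h : Odd n) : Odd (n * n) := h.mul h

theorem norm_neg_lt_one (hp1 : ‖p‖ < 1) : ‖-p‖ < 1 := by rwa [norm_neg]

theorem norm_sq_lt_one (hp1 : ‖p‖ < 1) : ‖p ^ 2‖ < 1 := norm_pow_succ_lt_one hp1 1

/-- Adding the series for p and -p removes the pairs of mixed parity; on the others (x+y)² + (x-y)²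
= 2(x² + y²). -/
theorem phi_sq_add (hp0 : p ≠ 0) (hp1 : ‖p‖ < 1) :
    phi p ^ 2 + phi (-p) ^ 2 = 2 * phi (p ^ 2) ^ 2 := by
  have h1 := (hasSum_phi_mul hp1 hp1).add
    (hasSum_phi_mul (norm_neg_lt_one hp1) (norm_neg_lt_one hp1))
  have h2 := hasSum_diagonal h1 fun a b hab => by
    rcases Int.even_or_odd a with ha | ha <;> rcases Int.even_or_odd b with hb | hb
    · exact absurd (ha.add hb) hab
    · simp only [(even_mul_self ha).neg_zpow, (odd_mul_self hb).neg_zpow]; ring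
    · simp only [(odd_mul_self ha).neg_zpow, (even_mul_self hb).neg_zpow]; ring
    · exact absurd (ha.add_odd hb) hab
  have h3 := (hasSum_phi_mul (norm_sq_lt_one hp1) (norm_sq_lt_one hp1)).mul_left 2
  have := h2.unique (h3.congr_fun fun x => ?_)
  · linear_combination this
  · have e : ∀ z : ℂ, z ≠ 0 → z ^ ((x.1 + x.2) * (x.1 + x.2)) * z ^ ((x.1 - x.2) * (x.1 - x.2)) =
        (z ^ 2) ^ (x.1 * x.1) * (z ^ 2) ^ (x.2 * x.2) := by
      intro z hz
      rw [← zpow_natCast, ← zpow_mul, ← zpow_mul, ← zpow_add₀ hz, ← zpow_add₀ hz]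
      congr 1
      push_cast
      ring
    simp only [e p hp0, e (-p) (neg_ne_zero.2 hp0), neg_sq]
    ring

/-- Symmetrizing the double series in its two indices removes the pairs of mixed parity; the
remaining sign (-1)^(x-y) equals (-1)^(x²+y²). -/
theorem phi_mul_phi_neg (hp0 : p ≠ 0) (hp1 : ‖p‖ < 1) :
    phi p * phi (-p) = phi (-p ^ 2) ^ 2 := by
  have h1 := (hasSum_phi_mul hp1 (norm_neg_lt_one hp1))
  have h1' := h1.add ((Equiv.prodComm ℤ ℤ).hasSum_iff.2 h1)
  have h2 := hasSum_diagonal h1' fun a b hab => by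
    simp only [Function.comp, Equiv.prodComm_apply, Prod.swap]
    rcases Int.even_or_odd a with ha | ha <;> rcases Int.even_or_odd b with hb | hb
    · exact absurd (ha.add hb) hab
    · simp only [(even_mul_self ha).neg_zpow, (odd_mul_self hb).neg_zpow]; ring
    · simp only [(odd_mul_self ha).neg_zpow, (even_mul_self hb).neg_zpow]; ring
    · exact absurd (ha.add_odd hb) hab
  have hn : ‖-p ^ 2‖ < 1 := norm_neg_lt_one (norm_sq_lt_one hp1)
  have h3 := (hasSum_phi_mul hn hn).mul_left 2
  have := h2.unique (h3.congr_fun fun x => ?_)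
  · linear_combination this / 2
  · have e : p ^ ((x.1 + x.2) * (x.1 + x.2)) * p ^ ((x.1 - x.2) * (x.1 - x.2)) =
        (p ^ 2) ^ (x.1 * x.1) * (p ^ 2) ^ (x.2 * x.2) := by
      rw [← zpow_natCast, ← zpow_mul, ← zpow_mul, ← zpow_add₀ hp0, ← zpow_add₀ hp0]
      congr 1
      push_cast
      ring
    simp only [Function.comp, Equiv.prodComm_apply, Prod.swap]
    rcases Int.even_or_odd x.1 with ha | ha <;> rcases Int.even_or_odd x.2 with hb | hb
    · simp only [(even_mul_self ha).neg_zpow, (even_mul_self hb).neg_zpow,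
        (even_mul_self (ha.add hb)).neg_zpow, (even_mul_self (ha.sub hb)).neg_zpow]
      linear_combination 2 * e
    · simp only [(even_mul_self ha).neg_zpow, (odd_mul_self hb).neg_zpow,
        (odd_mul_self (ha.add_odd hb)).neg_zpow, (odd_mul_self (ha.sub_odd hb)).neg_zpow]
      linear_combination -2 * e
    · simp only [(odd_mul_self ha).neg_zpow, (even_mul_self hb).neg_zpow,
        (odd_mul_self (ha.add_even hb)).neg_zpow, (odd_mul_self (ha.sub_even hb)).neg_zpow]
      linear_combination -2 * e
    · simp only [(odd_mul_self ha).neg_zpow, (odd_mul_self hb).neg_zpow,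
        (even_mul_self (ha.add_odd hb)).neg_zpow, (even_mul_self (ha.sub_odd hb)).neg_zpow]
      linear_combination 2 * e

theorem tendsto_phi : Tendsto phi (𝓝 0) (𝓝 1) := by
  have h0 : ∑' n : ℤ, (0 : ℂ) ^ (n.natAbs ^ 2) = 1 := by
    rw [tsum_eq_single 0]
    · simp
    · intro n hn
      simp [hn]
  rw [← h0]
  refine tendsto_tsum_of_dominated_convergence
    (summable_pow_natAbs (r := 1 / 2) (by norm_num) (by norm_num)) (fun n => ?_) ?_
  · exact Continuous.tendsto (by fun_prop) _
  · filter_upwards [Metric.ball_mem_nhds (0 : ℂ) (by norm_num : (0 : ℝ) < 1 / 2)] with p hp n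
    rw [mem_ball_zero_iff] at hp
    rw [norm_pow]
    refine (pow_le_pow_of_le_one (norm_nonneg _) (hp.le.trans (by norm_num))
      (Nat.le_self_pow two_ne_zero _)).trans ?_
    exact pow_le_pow_left₀ (norm_nonneg _) hp.le _

theorem tendsto_pow_two_pow (hp1 : ‖p‖ < 1) : Tendsto (fun n : ℕ => p ^ 2 ^ n) atTop (𝓝 0) :=
  (tendsto_pow_atTop_nhds_zero_of_norm_lt_one hp1).comp
    (tendsto_pow_atTop_atTop_of_one_lt (by norm_num))

/-- By `phi_mul_phi_neg` a zero at p propagates to -p², then to -p⁴ and so on, against the limit 1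
at the origin. -/
theorem phi_ne_zero (hp0 : p ≠ 0) (hp1 : ‖p‖ < 1) : phi p ≠ 0 := by
  intro h
  have key : ∀ n : ℕ, phi (-p ^ 2 ^ (n + 1)) = 0 := by
    intro n
    induction n with
    | zero =>
      have := phi_mul_phi_neg hp0 hp1
      rw [h, zero_mul] at this
      simpa using this.symm
    | succ n ih =>
      have h0 : -p ^ 2 ^ (n + 1) ≠ 0 := neg_ne_zero.2 (pow_ne_zero _ hp0)
      have h1 : ‖-p ^ 2 ^ (n + 1)‖ < 1 := by
        rw [norm_neg, norm_pow]
        exact pow_lt_one₀ (norm_nonneg _) hp1 (by positivity)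
      have := phi_mul_phi_neg h0 h1
      rw [ih, zero_mul, neg_sq, ← pow_mul, ← pow_succ] at this
      simpa using this.symm
  have h1 : Tendsto (fun n : ℕ => phi (-p ^ 2 ^ (n + 1))) atTop (𝓝 1) := by
    refine tendsto_phi.comp ?_
    simpa using ((tendsto_pow_two_pow hp1).comp (tendsto_add_atTop_nat 1)).neg
  simp only [key] at h1
  exact zero_ne_one (tendsto_nhds_unique tendsto_const_nhds h1)

/-- The coefficients `1 / (p ^ k + p ^ (-k))`. -/
noncomputable def sechCoeff (p : ℂ) (k : ℤ) : ℂ := p ^ k / (1 + (p ^ 2) ^ k)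

/-- The series `∑ 1 / (p ^ k + p ^ (-k))`. -/
noncomputable def sechSum (p : ℂ) : ℂ := ellK (p ^ 2) p

theorem norm_sq_lt (hp0 : p ≠ 0) (hp1 : ‖p‖ < 1) : ‖p ^ 2‖ < ‖p‖ := by
  rw [norm_pow, sq]
  exact mul_lt_of_lt_one_left (norm_pos_iff.2 hp0) hp1

theorem hasSum_sech (hp0 : p ≠ 0) (hp1 : ‖p‖ < 1) : HasSum (sechCoeff p) (sechSum p) :=
  hasSum_ellK (pow_ne_zero 2 hp0) (norm_sq_lt_one hp1) (norm_sq_lt hp0 hp1) hp1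

theorem sechCoeff_mul (hp0 : p ≠ 0) (hp1 : ‖p‖ < 1) (k : ℤ) :
    sechCoeff p k * (p ^ k + p ^ (-k)) = 1 := by
  have h := one_add_zpow_ne_zero (pow_ne_zero 2 hp0) (norm_sq_lt_one hp1) k
  have h2 : p ^ k ≠ 0 := zpow_ne_zero _ hp0
  have e : (p ^ 2) ^ k = (p ^ k) ^ 2 := by
    rw [← zpow_natCast, ← zpow_natCast, ← zpow_mul, ← zpow_mul, mul_comm]
  unfold sechCoeff
  rw [e] at h ⊢
  rw [zpow_neg, div_mul_eq_mul_div, div_eq_one_iff_eq h, mul_add, mul_inv_cancel₀ h2]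
  ring

theorem theta_succ (hp0 : p ≠ 0) (n : ℤ) :
    (-p) ^ ((n + 1) * (n + 1)) = -((-p) ^ (n * n) * p ^ (2 * n + 1)) := by
  have h0 : -p ≠ 0 := neg_ne_zero.2 hp0
  have : (-p) ^ (2 * n + 1) = -p ^ (2 * n + 1) := Odd.neg_zpow (⟨n, rfl⟩ : Odd (2 * n + 1)) p
  rw [← mul_neg, ← this, ← zpow_add₀ h0]
  congr 1
  ring

/-- The coefficients of the Laurent expansion of a theta function. -/
noncomputable def thetaConv (p : ℂ) (N : ℤ) : ℂ := ∑' n : ℤ, (-p) ^ (n * n) * sechCoeff p (N - n)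

theorem hasSum_theta_sech (hp0 : p ≠ 0) (hp1 : ‖p‖ < 1) :
    HasSum (fun x : ℤ × ℤ => (-p) ^ (x.2 * x.2) * sechCoeff p (x.1 - x.2))
      (phi (-p) * sechSum p) := by
  have hs1 := summable_phi (norm_neg_lt_one hp1)
  have hs2 := (hasSum_sech hp0 hp1).summable.norm
  have h := (summable_mul_of_summable_norm hs1 hs2).hasSum
  rw [← tsum_mul_tsum_of_summable_norm hs1 hs2, (hasSum_phi (norm_neg_lt_one hp1)).tsum_eq,
    (hasSum_sech hp0 hp1).tsum_eq] at h
  let e : ℤ × ℤ ≃ ℤ × ℤ :=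
    ⟨fun x => (x.2, x.1 - x.2), fun x => (x.1 + x.2, x.1), fun x => by simp, fun x => by simp⟩
  exact e.hasSum_iff.2 h

theorem hasSum_thetaConv (hp0 : p ≠ 0) (hp1 : ‖p‖ < 1) (N : ℤ) :
    HasSum (fun n : ℤ => (-p) ^ (n * n) * sechCoeff p (N - n)) (thetaConv p N) :=
  ((hasSum_theta_sech hp0 hp1).summable.prod_factor N).hasSum

/-- Inserting 1 = `sechCoeff p k` · (p^k + p^(-k)), with k = N - n, into ∑ (-p)^(n²) p^n expresses
that sum through two consecutive convolutions. The sum vanishes because n ↦ -1 - n changes the sign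
of its terms. -/
theorem thetaConv_succ (hp0 : p ≠ 0) (hp1 : ‖p‖ < 1) (N : ℤ) :
    thetaConv p (N + 1) = p ^ (2 * N + 1) * thetaConv p N := by
  have h1 := (hasSum_thetaConv hp0 hp1 N).mul_left (p ^ N)
  have h2 := ((Equiv.addRight (1 : ℤ)).hasSum_iff.2
    (hasSum_thetaConv hp0 hp1 (N + 1))).mul_left (p ^ (-N - 1))
  have h3 : HasSum (fun n : ℤ => (-p) ^ (n * n) * p ^ n)
      (p ^ N * thetaConv p N - p ^ (-N - 1) * thetaConv p (N + 1)) := by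
    refine (h1.sub h2).congr_fun fun n => ?_
    simp only [Function.comp, Equiv.coe_addRight, add_sub_add_right_eq_sub]
    rw [theta_succ hp0]
    have e := sechCoeff_mul hp0 hp1 (N - n)
    have e1 : p ^ N = p ^ n * p ^ (N - n) := by rw [← zpow_add₀ hp0]; congr 1; ring
    have e2 : p ^ (-N - 1) * p ^ (2 * n + 1) = p ^ n * p ^ (-(N - n)) := by
      rw [← zpow_add₀ hp0, ← zpow_add₀ hp0]; congr 1; ring
    rw [e1]
    linear_combination (-(-p) ^ (n * n) * p ^ n) * e -
      ((-p) ^ (n * n) * sechCoeff p (N - n)) * e2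
  have h4 : HasSum (fun n : ℤ => (-p) ^ (n * n) * p ^ n)
      (-(p ^ N * thetaConv p N - p ^ (-N - 1) * thetaConv p (N + 1))) := by
    refine ((Equiv.subLeft (-1 : ℤ)).hasSum_iff.2 h3).neg.congr_fun fun n => ?_
    simp only [Function.comp, Equiv.subLeft_apply]
    rw [show (-1 - n) * (-1 - n) = (n + 1) * (n + 1) by ring, theta_succ hp0, neg_mul, neg_neg,
      mul_assoc, ← zpow_add₀ hp0]
    congr 2
    ring
  have h5 := self_eq_neg.1 (h3.unique h4)
  have e : p ^ (2 * N + 1) * p ^ (-N - 1) = p ^ N := by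
    rw [← zpow_add₀ hp0]; congr 1; ring
  have h6 : p ^ (-N - 1) ≠ 0 := zpow_ne_zero _ hp0
  refine mul_left_cancel₀ h6 ?_
  linear_combination -h5 - thetaConv p N * e

theorem thetaConv_eq (hp0 : p ≠ 0) (hp1 : ‖p‖ < 1) (N : ℤ) :
    thetaConv p N = p ^ (N * N) * thetaConv p 0 := by
  induction N using Int.induction_on with
  | zero => simp
  | succ N ih =>
    rw [thetaConv_succ hp0 hp1, ih, ← mul_assoc, ← zpow_add₀ hp0]
    congr 2
    ring
  | pred N ih =>
    have := thetaConv_succ hp0 hp1 (-(N : ℤ) - 1)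
    rw [show -(N : ℤ) - 1 + 1 = -N by ring, ih] at this
    refine mul_left_cancel₀ (zpow_ne_zero (2 * (-(N : ℤ) - 1) + 1) hp0) ?_
    rw [← this, ← mul_assoc, ← zpow_add₀ hp0]
    congr 2
    ring

/-- The double series is summed along convolutions, whose values are p^(N²) times the one at 0. -/
theorem phi_neg_mul_sechSum (hp0 : p ≠ 0) (hp1 : ‖p‖ < 1) :
    phi (-p) * sechSum p = phi p * thetaConv p 0 := by
  have h := (hasSum_theta_sech hp0 hp1).prod_fiberwise (hasSum_thetaConv hp0 hp1)
  refine h.unique (((hasSum_phi hp1).mul_right _).congr_fun fun N => ?_)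
  exact thetaConv_eq hp0 hp1 N

theorem thetaConv_neg (p : ℂ) : thetaConv (-p) 0 = thetaConv p 0 := by
  unfold thetaConv
  refine tsum_congr fun n => ?_
  simp only [sechCoeff, neg_neg, neg_sq]
  rcases Int.even_or_odd n with h | h
  · rw [(even_mul_self h).neg_zpow, (Even.neg_zpow (by simpa using h))]
  · rw [(odd_mul_self h).neg_zpow, (Odd.neg_zpow (by simpa using h))]
    ring

theorem sechSum_neg_mul (hp0 : p ≠ 0) (hp1 : ‖p‖ < 1) :
    sechSum (-p) * phi p ^ 2 = sechSum p * phi (-p) ^ 2 := by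
  have h1 := phi_neg_mul_sechSum hp0 hp1
  have h2 := phi_neg_mul_sechSum (neg_ne_zero.2 hp0) (norm_neg_lt_one hp1)
  rw [thetaConv_neg, neg_neg] at h2
  linear_combination phi p * h2 - phi (-p) * h1

theorem sechSum_add_neg (hp0 : p ≠ 0) (hp1 : ‖p‖ < 1) :
    sechSum p + sechSum (-p) = 2 * sechSum (p ^ 2) := by
  have h1 := (hasSum_sech hp0 hp1).add (hasSum_sech (neg_ne_zero.2 hp0) (norm_neg_lt_one hp1))
  have hinj : Function.Injective fun k : ℤ => 2 * k := fun a b h => by simpa using h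
  have h2 := (hinj.hasSum_iff ?_).2 h1
  · refine h2.unique (((hasSum_sech (pow_ne_zero 2 hp0) (norm_sq_lt_one hp1)).mul_left 2).congr_fun
      fun k => ?_)
    simp only [Function.comp, sechCoeff, neg_sq]
    rw [(even_two_mul k).neg_zpow, zpow_mul p, zpow_mul (p ^ 2)]
    norm_cast
    ring
  · intro k hk
    have : Odd k := by
      rw [← Int.not_even_iff_odd]
      rintro ⟨j, hj⟩
      exact hk ⟨j, by simp only; omega⟩
    simp only [sechCoeff, neg_sq, this.neg_zpow]
    ring

/-- Says that `sechSum / phi ^ 2` is the same at p and p². By `sechSum_neg_mul` this quotient is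
unchanged under p ↦ -p, and numerator and denominator have the same duplication formula. -/
theorem sechSum_mul_phi_sq (hp0 : p ≠ 0) (hp1 : ‖p‖ < 1) :
    sechSum p * phi (p ^ 2) ^ 2 = sechSum (p ^ 2) * phi p ^ 2 := by
  have h1 := sechSum_neg_mul hp0 hp1
  have h2 := sechSum_add_neg hp0 hp1
  have h3 := phi_sq_add hp0 hp1
  linear_combination (phi p ^ 2 / 2) * h2 - (sechSum p / 2) * h3 - h1 / 2

/-- A form without negative powers, which still makes sense at p = 0 and allows the limit there. -/
theorem sechCoeff_natAbs (hp0 : p ≠ 0) (hp1 : ‖p‖ < 1) (k : ℤ) :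
    sechCoeff p k = p ^ k.natAbs / (1 + (p ^ 2) ^ k.natAbs) := by
  obtain ⟨n, rfl | rfl⟩ := Int.eq_nat_or_neg k
  · simp [sechCoeff]
  · have h1 := sechCoeff_mul hp0 hp1 (-(n : ℤ))
    have h2 := sechCoeff_mul hp0 hp1 n
    have : sechCoeff p (-(n : ℤ)) = sechCoeff p n := by
      rw [neg_neg] at h1
      have h3 : p ^ (n : ℤ) + p ^ (-(n : ℤ)) ≠ 0 := right_ne_zero_of_mul (h2.trans_ne one_ne_zero)
      refine mul_right_cancel₀ h3 ?_
      rw [h2, ← h1, add_comm]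
    rw [this]
    simp [sechCoeff]

theorem tendsto_sechSum : Tendsto sechSum (𝓝[≠] 0) (𝓝 (1 / 2)) := by
  have h0 : ∑' n : ℤ, (0 : ℂ) ^ n.natAbs / (1 + (0 ^ 2) ^ n.natAbs) = 1 / 2 := by
    rw [tsum_eq_single 0]
    · norm_num
    · intro n hn
      simp [hn]
  rw [← h0]
  have h1 : ∀ᶠ p : ℂ in 𝓝[≠] 0, p ≠ 0 ∧ ‖p‖ < 1 / 2 := by
    refine eventually_nhdsWithin_iff.2 ?_
    filter_upwards [Metric.ball_mem_nhds (0 : ℂ) (by norm_num : (0 : ℝ) < 1 / 2)] with p hp hp'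
    rw [mem_ball_zero_iff] at hp
    exact ⟨hp', hp⟩
  have h2 : Tendsto (fun p : ℂ => ∑' n : ℤ, p ^ n.natAbs / (1 + (p ^ 2) ^ n.natAbs)) (𝓝[≠] 0)
      (𝓝 (∑' n : ℤ, (0 : ℂ) ^ n.natAbs / (1 + (0 ^ 2) ^ n.natAbs))) := by
    refine tendsto_tsum_of_dominated_convergence
      ((summable_pow_natAbs (r := 1 / 2) (by norm_num) (by norm_num)).mul_left 4) (fun n => ?_) ?_
    · refine Tendsto.mono_left ?_ nhdsWithin_le_nhds
      refine ContinuousAt.tendsto (f := fun p : ℂ => p ^ n.natAbs / (1 + (p ^ 2) ^ n.natAbs)) ?_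
      refine ContinuousAt.div (by fun_prop) (by fun_prop) ?_
      rcases eq_or_ne n.natAbs 0 with h | h
      · rw [h]; norm_num
      · simp [h]
    · filter_upwards [h1] with p hp n
      have hq : ‖(p ^ 2) ^ n.natAbs‖ ≤ 1 / 4 ∨ (p ^ 2) ^ n.natAbs = 1 := by
        rcases Nat.eq_zero_or_pos n.natAbs with h | h
        · right; rw [h, pow_zero]
        · left
          rw [norm_pow, norm_pow]
          have : ‖p‖ ^ 2 ≤ 1 / 4 := by nlinarith [norm_nonneg p]
          exact (pow_le_of_le_one (by positivity) (this.trans (by norm_num)) h.ne').trans this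
      have hb : 1 / 4 ≤ ‖1 + (p ^ 2) ^ n.natAbs‖ := by
        rcases hq with h | h
        · have := norm_sub_norm_le (1 : ℂ) (-(p ^ 2) ^ n.natAbs)
          rw [norm_neg, norm_one, sub_neg_eq_add] at this
          linarith
        · rw [h]; norm_num
      rw [norm_div, norm_pow, div_le_iff₀ (by linarith)]
      have hle : ‖p‖ ^ n.natAbs ≤ (1 / 2) ^ n.natAbs :=
        pow_le_pow_left₀ (norm_nonneg _) hp.2.le _
      have : 0 ≤ (1 / 2 : ℝ) ^ n.natAbs := by positivity
      nlinarith
  refine h2.congr' ?_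
  filter_upwards [h1] with p hp
  have hp1 : ‖p‖ < 1 := hp.2.trans (by norm_num)
  rw [← (hasSum_sech hp.1 hp1).tsum_eq]
  exact tsum_congr fun k => (sechCoeff_natAbs hp.1 hp1 k).symm

/-- The two-square identity `1 + 4 ∑ ... = φ ^ 2` in the form of a Lambert series. -/
theorem sechSum_eq (hp0 : p ≠ 0) (hp1 : ‖p‖ < 1) : sechSum p = phi p ^ 2 / 2 := by
  have hP : ∀ n : ℕ, p ^ 2 ^ n ≠ 0 ∧ ‖p ^ 2 ^ n‖ < 1 := fun n =>
    ⟨pow_ne_zero _ hp0, by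
      rw [norm_pow]; exact pow_lt_one₀ (norm_nonneg _) hp1 (by positivity)⟩
  -- Iterating p ↦ p² preserves `sechSum / phi ^ 2` and drives p to 0, where the quotient tends to
  -- 1/2.
  have key : ∀ n : ℕ, sechSum p * phi (p ^ 2 ^ n) ^ 2 = sechSum (p ^ 2 ^ n) * phi p ^ 2 := by
    intro n
    induction n with
    | zero => simp
    | succ n ih =>
      have h1 := sechSum_mul_phi_sq (hP n).1 (hP n).2
      have h2 := phi_ne_zero (hP n).1 (hP n).2
      rw [← pow_mul, ← pow_succ] at h1
      refine mul_left_cancel₀ (pow_ne_zero 2 h2) ?_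
      linear_combination phi (p ^ 2 ^ (n + 1)) ^ 2 * ih + phi p ^ 2 * h1
  have l1 := tendsto_pow_two_pow hp1
  have l2 : Tendsto (fun n : ℕ => p ^ 2 ^ n) atTop (𝓝[≠] 0) :=
    tendsto_nhdsWithin_iff.2 ⟨l1, Eventually.of_forall fun n => (hP n).1⟩
  have e1 := ((tendsto_phi.comp l1).pow 2).const_mul (sechSum p)
  have e2 := (tendsto_sechSum.comp l2).mul_const (phi p ^ 2)
  have := tendsto_nhds_unique_of_eventuallyEq e1 e2 (Eventually.of_forall key)
  linear_combination this

/-- With p = z², the values of `ellK p` at z and -z are `sechSum z` and `sechSum (-z)`. Their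
product is `ellConst p`, and the two-square identity with `phi_mul_phi_neg` evaluates it. -/
theorem ellConst_eq (hp0 : p ≠ 0) (hp1 : ‖p‖ < 1) : ellConst p = phi (-p) ^ 4 / 4 := by
  obtain ⟨z, hz⟩ := IsAlgClosed.exists_pow_nat_eq p (n := 2) (by norm_num)
  subst hz
  have hz0 : z ≠ 0 := fun e => hp0 (by rw [e]; norm_num)
  have hz1 : ‖z‖ < 1 := by
    rw [norm_pow] at hp1
    exact (pow_lt_one_iff_of_nonneg (norm_nonneg z) two_ne_zero).1 hp1
  have h1 := ellK_mul_ellK_neg hp0 hp1 (norm_sq_lt hz0 hz1) hz1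
  have h2 := sechSum_eq hz0 hz1
  have h3 := sechSum_eq (neg_ne_zero.2 hz0) (norm_neg_lt_one hz1)
  have h4 := phi_mul_phi_neg hz0 hz1
  rw [sechSum] at h2
  rw [sechSum, neg_sq] at h3
  rw [← h1, h2, h3]
  linear_combination (phi z * phi (-z) + phi (-z ^ 2) ^ 2) / 4 * h4

end ThetaConstant

/-! ### The real kernels at p = -q and their normalization. -/

section SquareKernel

/-- The coefficient `q ^ k / (1 + ε (-q) ^ k)` for `k > 0`. -/
noncomputable def squareCoeff (q ε : ℝ) (k : ℕ) : ℝ :=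
  if k = 0 then 0 else q ^ k / (1 + ε * (-q) ^ k)

theorem squareCoeff_succ (q ε : ℝ) (k : ℕ) :
    squareCoeff q ε (k + 1) = q ^ (k + 1) / (1 + ε * (-q) ^ (k + 1)) := if_neg k.succ_ne_zero

theorem exists_squareCoeff_le {q ε : ℝ} (hq : |q| < 1) (hε : ε = 1 ∨ ε = -1) :
    ∃ C, ∀ k, |squareCoeff q ε k| ≤ C * |q| ^ k := by
  have hp1 : ‖((-q : ℝ) : ℂ)‖ < 1 := by simpa using hq
  obtain ⟨C, hC⟩ := geometricDecay_div (b := (ε : ℂ)) (by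
    rcases hε with rfl | rfl <;> simp) hp1
  refine ⟨max C 0, fun k => ?_⟩
  rcases k with _ | k
  · simp [squareCoeff]
  · have e : |squareCoeff q ε (k + 1)| =
        ‖((-q : ℝ) : ℂ) ^ (k + 1) / (1 + (ε : ℂ) * ((-q : ℝ) : ℂ) ^ (k + 1))‖ := by
      rw [squareCoeff_succ]
      norm_cast
      simp [abs_div]
    rw [e]
    refine (hC k).trans ?_
    simp only [Complex.norm_real, Real.norm_eq_abs, abs_neg]
    gcongr
    exact le_max_left _ _

/-- The antisymmetric kernel with coefficients `squareCoeff q ε`. -/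
noncomputable def squareKernel (q ε y : ℝ) : ℝ :=
  (y - 1) / (y + 1) +
    2 * ε * ∑' k : ℕ, squareCoeff q ε (k + 1) * (y ^ (k + 1) - y⁻¹ ^ (k + 1))

theorem squareKernel_inv (q ε : ℝ) {y : ℝ} (hy : 0 < y) :
    squareKernel q ε y⁻¹ = -squareKernel q ε y := by
  unfold squareKernel
  rw [inv_inv, neg_add, ← mul_neg, ← tsum_neg]
  congr 1
  · field_simp
    ring
  · congr 1
    exact tsum_congr fun k => by ring

/-- The signs (-1)^(k+1) coming from -q in the numerator and from -y cancel, which leaves the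
coefficients q^k of the theorem. -/
theorem lambert_neg_eq (q ε y : ℝ) {a : ℕ → ℂ}
    (ha : ∀ k, a k = -ε * ((-q) ^ (k + 1) / (1 + ε * (-q) ^ (k + 1)))) :
    lambert a (-y) = -(squareKernel q ε y : ℂ) / 2 := by
  have h : ∑' k, a k * ((-y : ℂ) ^ (k + 1) - (-y : ℂ)⁻¹ ^ (k + 1)) =
      -ε * ((∑' k : ℕ, squareCoeff q ε (k + 1) * (y ^ (k + 1) - y⁻¹ ^ (k + 1)) : ℝ) : ℂ) := by
    rw [Complex.ofReal_tsum, ← tsum_mul_left]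
    refine tsum_congr fun k => ?_
    rw [ha, squareCoeff_succ, inv_neg, neg_pow (y : ℂ), neg_pow (y : ℂ)⁻¹, neg_pow (q : ℂ)]
    push_cast
    rw [neg_pow (q : ℂ)]
    have : ((-1 : ℂ) ^ (k + 1)) * (-1) ^ (k + 1) = 1 := by
      rw [← mul_pow]; norm_num
    linear_combination (-ε * (q : ℂ) ^ (k + 1) / (1 + ε * ((-1) ^ (k + 1) * (q : ℂ) ^ (k + 1))) *
      ((y : ℂ) ^ (k + 1) - (y : ℂ)⁻¹ ^ (k + 1))) * this
  unfold lambert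
  rw [h, squareKernel]
  push_cast
  ring

theorem ellK_neg_eq (q y : ℝ) : ellK (-q) (-y) = -(squareKernel q 1 y : ℂ) / 2 :=
  lambert_neg_eq q 1 y fun k => by push_cast; ring

theorem ellL_neg_eq (q y : ℝ) : ellL (-q) (-y) = -(squareKernel q (-1) y : ℂ) / 2 :=
  lambert_neg_eq q (-1) y fun k => by push_cast; ring

theorem phi_ofReal (q : ℝ) : phi q = (SumsOfSquares.square q : ℂ) := by
  rw [phi, SumsOfSquares.square, Complex.ofReal_tsum]
  exact tsum_congr fun n => by push_cast; rfl

variable {q : ℝ}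

theorem norm_neg_ofReal_lt_one (hq : |q| < 1) : ‖(-q : ℂ)‖ < 1 := by simpa using hq

theorem ellConst_neg_eq (hq0 : q ≠ 0) (hq : |q| < 1) :
    ellConst (-q) = ((SumsOfSquares.square q ^ 2 : ℝ) : ℂ) ^ 2 / 4 := by
  rw [ellConst_eq (neg_ne_zero.2 (Complex.ofReal_ne_zero.2 hq0)) (norm_neg_ofReal_lt_one hq),
    neg_neg, phi_ofReal]
  push_cast
  ring

theorem square_zero : SumsOfSquares.square 0 = 1 := by
  rw [SumsOfSquares.square, tsum_eq_single 0]
  · simp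
  · intro n hn
    simp [hn]

theorem square_ne_zero (hq : |q| < 1) : SumsOfSquares.square q ≠ 0 := by
  rcases eq_or_ne q 0 with rfl | hq0
  · rw [square_zero]; exact one_ne_zero
  · have := phi_ne_zero (Complex.ofReal_ne_zero.2 hq0) (by simpa using hq)
    rwa [phi_ofReal, Complex.ofReal_ne_zero] at this

theorem squareKernel_zero (ε y : ℝ) : squareKernel 0 ε y = (y - 1) / (y + 1) := by
  simp [squareKernel, squareCoeff]

/-- The points whose quotients lie in the interval of convergence. -/
def ratioDomain (r : ℝ) : Set ℝ := {a | 0 < a ∧ r < a ^ 2 ∧ r * a ^ 2 < 1}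

theorem mul_lt_of_mem_ratioDomain {r a b : ℝ} (hr : 0 ≤ r) (ha : a ∈ ratioDomain r)
    (hb : b ∈ ratioDomain r) : r * b < a := by
  refine lt_of_pow_lt_pow_left₀ 2 ha.1.le ?_
  have h1 := hb.2.2
  have h2 := ha.2.1
  calc (r * b) ^ 2 = r * (r * b ^ 2) := by ring
    _ ≤ r * 1 := by gcongr
    _ < a ^ 2 := by rwa [mul_one]

theorem eventually_mem_ratioDomain (n : ℕ) {r : ℝ} (hr1 : r < 1) :
    ∀ᶠ x in SumsOfSquares.nearOne n, ∀ i, x i ∈ ratioDomain r := by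
  refine Filter.Eventually.filter_mono nhdsWithin_le_nhds (Filter.eventually_all.2 fun i => ?_)
  have hc : Continuous fun x : Fin n → ℝ => x i := continuous_apply i
  refine ((hc.tendsto _).eventually_const_lt zero_lt_one).and
    ((((hc.pow 2).tendsto _).eventually_const_lt (by simpa)).and
      ((((hc.pow 2).const_mul r).tendsto _).eventually_lt_const (by simpa)))

theorem apart_of_mem {a b : ℝ} (ha : a ∈ ratioDomain |q|)
    (hb : b ∈ ratioDomain |q|) (hab : a ≠ b) : Apart ‖(-q : ℂ)‖ (a : ℂ) (b : ℂ) := by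
  have h1 := mul_lt_of_mem_ratioDomain (abs_nonneg q) ha hb
  have h2 := mul_lt_of_mem_ratioDomain (abs_nonneg q) hb ha
  have ha0 := ha.1
  have hb0 := hb.1
  refine ⟨Complex.ofReal_ne_zero.2 ha0.ne', Complex.ofReal_ne_zero.2 hb0.ne', ?_, ?_, ?_⟩
  · simpa [abs_of_pos, ha0, hb0] using hab
  · simp only [norm_neg, norm_div, Complex.norm_real, Real.norm_eq_abs, abs_of_pos ha0,
      abs_of_pos hb0]
    rwa [lt_div_iff₀ hb0]
  · simp only [norm_neg, norm_div, Complex.norm_real, Real.norm_eq_abs, abs_of_pos ha0,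
      abs_of_pos hb0]
    rwa [← mul_div_assoc, div_lt_one hb0]

/-- The kernel of the even case, normalized. -/
noncomputable def evenKernel (q : ℝ) (a b : ratioDomain |q|) : ℝ :=
  squareKernel q 1 (a / b) / SumsOfSquares.square q ^ 2

/-- The kernel of the odd case, normalized. -/
noncomputable def oddKernel (q : ℝ) (a b : ratioDomain |q|) : ℝ :=
  squareKernel q (-1) (a / b) / SumsOfSquares.square q ^ 2

theorem oddKernel_anti (a b : ratioDomain |q|) : oddKernel q a b = -oddKernel q b a := by
  unfold oddKernel
  rw [← neg_div, ← squareKernel_inv _ _ (div_pos b.2.1 a.2.1), inv_div]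

/-- Division by □(q)² absorbs `ellConst`: in the unnormalized kernels the addition formula carries
the factor □(q)^4 and the four-term relation the factor □(q)^8. -/
theorem addSystem_squareKernel (hq : |q| < 1) : AddSystem (evenKernel q) (oddKernel q) := by
  -- The elliptic functions were treated for p ≠ 0 only; at q = 0 both kernels are Schur's and □(0)
  -- = 1.
  rcases eq_or_ne q 0 with rfl | hq0
  · have e : ∀ ε : ℝ, (fun a b : ratioDomain |(0 : ℝ)| => squareKernel 0 ε (a / b) /
        SumsOfSquares.square 0 ^ 2) = schurKernel Subtype.val := by
      intro ε
      funext a b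
      have ha := a.2.1
      have hb := b.2.1
      rw [squareKernel_zero, square_zero, schurKernel]
      field_simp
    have := addSystem_schurKernel (v := (Subtype.val : ratioDomain |(0 : ℝ)| → ℝ))
      (fun a => a.2.1) Subtype.val_injective
    rw [show evenKernel 0 = _ from e 1, show oddKernel 0 = _ from e (-1)]
    exact this
  have hp0 : (-q : ℂ) ≠ 0 := neg_ne_zero.2 (Complex.ofReal_ne_zero.2 hq0)
  have hp1 := norm_neg_ofReal_lt_one hq
  have hE := ellConst_neg_eq hq0 hq
  have hd : SumsOfSquares.square q ^ 2 ≠ 0 := pow_ne_zero 2 (square_ne_zero hq)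
  have hE0 : ellConst (-q) ≠ 0 := by
    rw [hE]
    exact div_ne_zero (pow_ne_zero 2 (Complex.ofReal_ne_zero.2 hd)) (by norm_num)
  have hap : ∀ {a b : ratioDomain |q|}, a ≠ b → Apart ‖(-q : ℂ)‖ ((a : ℝ) : ℂ) ((b : ℝ) : ℂ) :=
    fun {a b} h => apart_of_mem a.2 b.2 (Subtype.val_injective.ne h)
  have hK : ∀ a b : ℝ, ellK (-q) (-((a : ℂ) / b)) = -(squareKernel q 1 (a / b) : ℂ) / 2 := by
    intro a b
    rw [← ellK_neg_eq]; push_cast; rfl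
  have hL : ∀ a b : ℝ, ellL (-q) (-((a : ℂ) / b)) = -(squareKernel q (-1) (a / b) : ℂ) / 2 := by
    intro a b
    rw [← ellL_neg_eq]; push_cast; rfl
  refine ⟨fun a b => ?_, fun a b hab => ?_, fun a b c hab hbc hac => ?_,
    fun x a b c hxa hxb hxc hab hbc hac => ?_⟩
  · unfold evenKernel
    rw [← neg_div, ← squareKernel_inv _ _ (div_pos b.2.1 a.2.1), inv_div]
  -- A zero of the kernel would contradict that the product of `ellK` at z and -z is the nonzero
  -- constant `ellConst`.
  · refine div_ne_zero (fun h => hE0 ?_) hd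
    have h1 := ellK_mul_ellK_neg_of_ne hp0 hp1 (hap hab).2.2.2 (hap hab).norm_div_ne_one
    rw [hK, h] at h1
    simpa using h1.symm
  · have h := ell_addition hp0 hp1 (hap hab) (hap hbc) (hap hac)
    rw [hK, hK, hK, hL, hL, hL, hE] at h
    have h2 : squareKernel q 1 (a / b) * squareKernel q 1 (b / c) * squareKernel q 1 (a / c) =
        (SumsOfSquares.square q ^ 2) ^ 2 * (squareKernel q (-1) (a / b) +
          squareKernel q (-1) (b / c) - squareKernel q (-1) (a / c)) := by
      have h3 : (squareKernel q 1 (a / b) : ℂ) * squareKernel q 1 (b / c) *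
          squareKernel q 1 (a / c) = ((SumsOfSquares.square q ^ 2 : ℝ) : ℂ) ^ 2 *
          (squareKernel q (-1) (a / b) + squareKernel q (-1) (b / c) -
            squareKernel q (-1) (a / c)) := by
        linear_combination -8 * h
      exact_mod_cast h3
    unfold evenKernel oddKernel
    rw [div_mul_div_comm, div_mul_div_comm, h2]
    generalize SumsOfSquares.square q ^ 2 = d at hd
    field_simp
  · have h := ell_four_term hp0 hp1 hE0 (hap hxa) (hap hxb) (hap hxc) (hap hab) (hap hbc) (hap hac)
    rw [hK, hK, hK, hK, hK, hK, hE] at h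
    unfold evenKernel
    generalize squareKernel q 1 (x / a) = k1 at h ⊢
    generalize squareKernel q 1 (x / b) = k2 at h ⊢
    generalize squareKernel q 1 (x / c) = k3 at h ⊢
    generalize squareKernel q 1 (a / b) = k4 at h ⊢
    generalize squareKernel q 1 (a / c) = k5 at h ⊢
    generalize squareKernel q 1 (b / c) = k6 at h ⊢
    generalize SumsOfSquares.square q ^ 2 = d at h hd ⊢
    have h3 : (d : ℂ) ^ 4 * (k1 * k6 - k2 * k5 + k3 * k4) = k1 * k2 * k3 * k4 * k5 * k6 := by
      linear_combination 64 * h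
    have h2 : d ^ 4 * (k1 * k6 - k2 * k5 + k3 * k4) = k1 * k2 * k3 * k4 * k5 * k6 := by
      exact_mod_cast h3
    field_simp
    linear_combination h2

/-- `ellK` vanishes at -1, so the quotient is its difference quotient there times 2(1 + u), with
limit 4 `ellConst (-q)`. -/
theorem tendsto_squareKernel_div (hq : |q| < 1) :
    Tendsto (fun u => squareKernel q 1 u / ((u - 1) / (u + 1))) (𝓝[≠] 1)
      (𝓝 ((SumsOfSquares.square q ^ 2) ^ 2)) := by
  have hpos : ∀ᶠ u : ℝ in 𝓝[≠] 1, 0 < u ∧ u ≠ 1 :=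
    ((lt_mem_nhds zero_lt_one).filter_mono nhdsWithin_le_nhds).and self_mem_nhdsWithin
  rcases eq_or_ne q 0 with rfl | hq0
  · rw [square_zero, one_pow, one_pow]
    refine tendsto_const_nhds.congr' ?_
    filter_upwards [hpos] with u hu
    rw [squareKernel_zero, div_self]
    exact div_ne_zero (sub_ne_zero.2 hu.2) (by linarith)
  have hp0 : (-q : ℂ) ≠ 0 := neg_ne_zero.2 (Complex.ofReal_ne_zero.2 hq0)
  have hp1 := norm_neg_ofReal_lt_one hq
  have hs := hasDerivAt_iff_tendsto_slope.1 (hasDerivAt_ellK hp0 hp1)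
  have l0 : Tendsto (fun u : ℝ => -(u : ℂ)) (𝓝[≠] 1) (𝓝 (-1)) := by
    have : Tendsto (fun u : ℝ => -(u : ℂ)) (𝓝 1) (𝓝 (-((1 : ℝ) : ℂ))) :=
      Continuous.tendsto (by fun_prop) _
    simpa using this.mono_left nhdsWithin_le_nhds
  have l1 : Tendsto (fun u : ℝ => -(u : ℂ)) (𝓝[≠] 1) (𝓝[≠] (-1)) := by
    refine tendsto_nhdsWithin_iff.2 ⟨l0, ?_⟩
    filter_upwards [self_mem_nhdsWithin] with u hu
    simpa using hu
  have l2 := (hs.comp l1).mul ((l0.const_sub 1).const_mul 2)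
  rw [ellConst_neg_eq hq0 hq] at l2
  have l3 := (Complex.continuous_re.tendsto _).comp l2
  have e : (((SumsOfSquares.square q ^ 2 : ℝ) : ℂ) ^ 2 / 4 * (2 * (1 - -1))).re =
      (SumsOfSquares.square q ^ 2) ^ 2 := by
    rw [show ((SumsOfSquares.square q ^ 2 : ℝ) : ℂ) ^ 2 / 4 * (2 * (1 - -1)) =
      (((SumsOfSquares.square q ^ 2) ^ 2 : ℝ) : ℂ) by push_cast; ring, Complex.ofReal_re]
  rw [e] at l3
  refine l3.congr' ?_
  filter_upwards [hpos] with u hu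
  have h1 : u - 1 ≠ 0 := sub_ne_zero.2 hu.2
  have h2 : (1 - u : ℂ) ≠ 0 := by
    rw [sub_ne_zero]; exact_mod_cast hu.2.symm
  have h3 : ((u : ℂ) - 1) ≠ 0 := by
    rw [sub_ne_zero]; exact_mod_cast hu.2
  have h4 : ((u : ℂ) + 1) ≠ 0 := by
    have : u + 1 ≠ 0 := by linarith
    exact_mod_cast this
  have hKn : ellK (-q) (-1) = 0 := lambert_neg_one _
  simp only [Function.comp, slope_def_field, hKn, ellK_neg_eq]
  rw [← Complex.ofReal_re (squareKernel q 1 u / ((u - 1) / (u + 1)))]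
  congr 1
  push_cast
  rw [show -(u : ℂ) - -1 = 1 - u by ring, ← neg_sub (u : ℂ) 1]
  field_simp
  ring

theorem summable_norm_squareCoeff_mul {ε : ℝ} (hq : |q| < 1) (hε : ε = 1 ∨ ε = -1) {y : ℝ}
    (hy : 0 ≤ y) (hqy : |q| * y < 1) : Summable fun k => ‖squareCoeff q ε k * y ^ k‖ := by
  obtain ⟨C, hC⟩ := exists_squareCoeff_le hq hε
  refine Summable.of_nonneg_of_le (fun _ => norm_nonneg _) (fun k => ?_)
    ((summable_geometric_of_lt_one (by positivity) hqy).mul_left C)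
  rw [norm_mul, norm_pow, Real.norm_eq_abs, Real.norm_eq_abs, abs_of_nonneg hy, mul_pow,
    ← mul_assoc]
  gcongr
  exact hC k

theorem summable_squareCoeff_ratioPow {ε : ℝ} (hq : |q| < 1) (hε : ε = 1 ∨ ε = -1)
    (a b : ratioDomain |q|) :
    Summable fun k => ‖squareCoeff q ε k * ratioPow Subtype.val k a b‖ := by
  have hb := b.2.1
  refine summable_norm_squareCoeff_mul hq hε (div_pos a.2.1 hb).le ?_
  rw [← mul_div_assoc, div_lt_one hb]
  exact mul_lt_of_mem_ratioDomain (abs_nonneg q) b.2 a.2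

theorem schurKernel_add_ratioSeries {ε : ℝ} (hq : |q| < 1) (hε : ε = 1 ∨ ε = -1)
    (a b : ratioDomain |q|) :
    schurKernel Subtype.val a b + 2 * ε * (ratioSeries Subtype.val (squareCoeff q ε) a b -
      ratioSeries Subtype.val (squareCoeff q ε) b a) = squareKernel q ε (a / b) := by
  have ha := a.2.1
  have hb := b.2.1
  have s1 := (summable_squareCoeff_ratioPow hq hε a b).of_norm
  have s2 := (summable_squareCoeff_ratioPow hq hε b a).of_norm
  unfold squareKernel ratioSeries schurKernel
  rw [← s1.tsum_sub s2, (s1.sub s2).tsum_eq_zero_add]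
  have h0 : squareCoeff q ε 0 = 0 := if_pos rfl
  congr 1
  · field_simp
  · rw [h0, zero_mul, zero_mul, sub_zero, zero_add, inv_div]
    congr 1
    exact tsum_congr fun k => by rw [mul_sub]; rfl

end SquareKernel

/-! ### Passage to the limit at (1, …, 1). -/

section LimitAtOne

theorem nearOne_neBot (n : ℕ) : (SumsOfSquares.nearOne n).NeBot := by
  refine mem_closure_iff_nhdsWithin_neBot.1 ?_
  refine mem_closure_of_tendsto (b := atTop)
    (f := fun (k : ℕ) (i : Fin n) => 1 + (i : ℝ) * (1 / ((k : ℝ) + 1))) ?_ ?_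
  · refine tendsto_pi_nhds.2 fun i => ?_
    simpa using (tendsto_one_div_add_atTop_nhds_zero_nat (𝕜 := ℝ)).const_mul (i : ℝ)
      |>.const_add 1
  · refine Eventually.of_forall fun k i j hij => ?_
    have hk : (1 / ((k : ℝ) + 1)) ≠ 0 := by positivity
    have : (i : ℝ) = j := mul_right_cancel₀ hk (add_left_cancel hij)
    exact Fin.ext (by exact_mod_cast this)

theorem sum_natAbs_symmetrize {s : ℕ} (k : Fin s → ℕ) :
    ∑ i, (SumsOfSquares.symmetrize k i).natAbs = ∑ i, 2 * k i := by
  rw [Fin.sum_univ_add]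
  simp only [SumsOfSquares.symmetrize, Fin.append_left, Fin.append_right, Int.natAbs_neg,
    Int.natAbs_natCast]
  rw [show ∑ i : Fin s, k i.rev = ∑ i, k i from Equiv.sum_comp Fin.revPerm k,
    ← Finset.sum_add_distrib]
  exact Finset.sum_congr rfl fun i _ => by ring

/-- Dominated convergence for the sums over strictly decreasing tuples. -/
theorem tendsto_tsum_schurQ {s n : ℕ} (h : s + s ≤ n) {c : ℕ → ℝ} {r C : ℝ} (hr : 0 ≤ r)
    (hr1 : r < 1) (hc : ∀ k, |c k| ≤ C * r ^ k) :
    (Summable fun k : SumsOfSquares.DecTuple s => (∏ i, c (k.1 i)) *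
        SumsOfSquares.schurQOne h (SumsOfSquares.symmetrize k.1)) ∧
      Tendsto (fun x => ∑' k : SumsOfSquares.DecTuple s, (∏ i, c (k.1 i)) *
        SumsOfSquares.schurQ h (SumsOfSquares.symmetrize k.1) x) (SumsOfSquares.nearOne n)
        (𝓝 (∑' k : SumsOfSquares.DecTuple s, (∏ i, c (k.1 i)) *
          SumsOfSquares.schurQOne h (SumsOfSquares.symmetrize k.1))) := by
  -- The square is needed because the absolute values of the exponents add up to 2 ∑ k_i.
  obtain ⟨ρ, hρ, hρr⟩ : ∃ ρ : ℝ, 1 < ρ ∧ r * ρ ^ 2 < 1 := by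
    have hcont : Tendsto (fun ρ : ℝ => r * ρ ^ 2) (𝓝[>] 1) (𝓝 (r * 1 ^ 2)) :=
      (Continuous.tendsto (by fun_prop) _).mono_left nhdsWithin_le_nhds
    obtain ⟨ρ, h1, h2⟩ := ((hcont.eventually_lt_const (by simpa using hr1)).and
      self_mem_nhdsWithin).exists
    exact ⟨ρ, h2, h1⟩
  obtain ⟨K, hK⟩ := exists_schurQ_bound h hρ
  have hρ0 : 0 < ρ := by linarith
  have hsum : Summable fun k => ‖|c k| * (ρ ^ 2) ^ k‖ := by
    refine Summable.of_nonneg_of_le (fun _ => norm_nonneg _) (fun k => ?_)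
      ((summable_geometric_of_lt_one (by positivity) hρr).mul_left C)
    rw [norm_mul, Real.norm_eq_abs, abs_abs, Real.norm_of_nonneg (by positivity), mul_pow, ← mul_assoc]
    gcongr
    exact hc k
  have hbound : Summable fun k : SumsOfSquares.DecTuple s =>
      K * ∏ i, |c (k.1 i)| * (ρ ^ 2) ^ (k.1 i) :=
    (((summable_norm_prod_apply fun _ : Fin s => hsum).1.of_norm).comp_injective
      Subtype.val_injective).mul_left K
  have hle : ∀ᶠ x in SumsOfSquares.nearOne n, ∀ k : SumsOfSquares.DecTuple s,
      ‖(∏ i, c (k.1 i)) * SumsOfSquares.schurQ h (SumsOfSquares.symmetrize k.1) x‖ ≤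
        K * ∏ i, |c (k.1 i)| * (ρ ^ 2) ^ (k.1 i) := by
    filter_upwards [hK] with x hx k
    rw [Finset.prod_mul_distrib, norm_mul, Real.norm_eq_abs, Real.norm_eq_abs, Finset.abs_prod,
      mul_left_comm, Finset.prod_pow_eq_pow_sum, ← pow_mul, Finset.mul_sum,
      ← sum_natAbs_symmetrize]
    exact mul_le_mul_of_nonneg_left (hx _) (Finset.prod_nonneg fun _ _ => abs_nonneg _)
  have hlim : ∀ k : SumsOfSquares.DecTuple s, Tendsto (fun x => (∏ i, c (k.1 i)) *
      SumsOfSquares.schurQ h (SumsOfSquares.symmetrize k.1) x) (SumsOfSquares.nearOne n)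
      (𝓝 ((∏ i, c (k.1 i)) * SumsOfSquares.schurQOne h (SumsOfSquares.symmetrize k.1))) :=
    fun k => (tendsto_schurQ h _).const_mul _
  have := nearOne_neBot n
  refine ⟨Summable.of_norm_bounded hbound fun k => ?_,
    tendsto_tsum_of_dominated_convergence hbound hlim hle⟩
  exact le_of_tendsto (hlim k).norm (hle.mono fun x hx => hx k)

theorem tendsto_div_nearOne {n : ℕ} {i j : Fin n} (hij : i ≠ j) :
    Tendsto (fun x : Fin n → ℝ => x i / x j) (SumsOfSquares.nearOne n) (𝓝[≠] 1) := by
  refine tendsto_nhdsWithin_iff.2 ⟨?_, ?_⟩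
  · have h : ∀ i : Fin n, Tendsto (fun x : Fin n → ℝ => x i) (SumsOfSquares.nearOne n) (𝓝 1) :=
      fun i => ((continuous_apply i).tendsto (fun _ : Fin n => (1 : ℝ))).mono_left
        nhdsWithin_le_nhds
    have := (h i).div (h j) one_ne_zero
    rwa [div_one] at this
  · filter_upwards [eventually_nearOne (n := n) one_pos] with x hx h
    have h0 : x j ≠ 0 := by
      intro e
      have := hx.1 j
      rw [e] at this
      norm_num at this
    exact hij (hx.2 ((div_eq_one_iff_eq h0).1 h))

theorem tendsto_pairs_squareKernel {q : ℝ} (hq : |q| < 1) (n : ℕ) :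
    Tendsto (fun x : Fin n → ℝ => ∏ i, ∏ j ∈ Finset.Ioi i, squareKernel q 1 (x i / x j) /
      ((x i / x j - 1) / (x i / x j + 1)) / SumsOfSquares.square q ^ 2) (SumsOfSquares.nearOne n)
      (𝓝 (∏ i : Fin n, ∏ _j ∈ Finset.Ioi i, SumsOfSquares.square q ^ 2)) := by
  refine tendsto_finsetProd _ fun i _ => tendsto_finsetProd _ fun j hj => ?_
  have hd : SumsOfSquares.square q ^ 2 ≠ 0 := pow_ne_zero 2 (square_ne_zero hq)
  have := ((tendsto_squareKernel_div hq).comp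
    (tendsto_div_nearOne (Finset.mem_Ioi.1 hj).ne)).div_const (SumsOfSquares.square q ^ 2)
  rwa [pow_two (SumsOfSquares.square q ^ 2), mul_div_assoc, div_self hd, mul_one] at this

theorem prod_Ioi_const (n : ℕ) (d : ℝ) :
    (∏ i : Fin n, ∏ _j ∈ Finset.Ioi i, d) = d ^ (n * (n - 1) / 2) := by
  simp only [Finset.prod_const, Fin.card_Ioi]
  rw [Finset.prod_pow_eq_pow_sum, Fin.sum_univ_eq_sum_range fun i => n - 1 - i,
    Finset.sum_range_reflect (fun i => i) n, Finset.sum_range_id]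

/-- The value of the sum at `(1, …, 1)`, given the evaluation of the alternating sums. -/
theorem sum_tsum_schurQOne {q ε : ℝ} (hq : |q| < 1) (hε : ε = 1 ∨ ε = -1) {m n e : ℕ} (he : e ≤ 1)
    (hn : n = 2 * m + e)
    (hval : ∀ x : Fin n → ratioDomain |q|, Function.Injective x →
      alt (pairing (m := m) (by omega) fun _ (a b : ratioDomain |q|) =>
        squareKernel q ε (a / b) / SumsOfSquares.square q ^ 2) x =
        2 ^ m * m.factorial * pairs (evenKernel q) x) :
    ∑ s : Fin (m + 1), ε ^ (s : ℕ) / 2 ^ (s : ℕ) * ∑' k : SumsOfSquares.DecTuple s,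
      (∏ i, squareCoeff q ε (k.1 i)) *
        SumsOfSquares.schurQOne (n := n) (by omega) (SumsOfSquares.symmetrize k.1) =
      SumsOfSquares.square q ^ (2 * m + 2 * (n * (n - 1) / 2)) := by
  classical
  obtain ⟨C, hC⟩ := exists_squareCoeff_le hq hε
  have hd : SumsOfSquares.square q ^ 2 ≠ 0 := pow_ne_zero 2 (square_ne_zero hq)
  have := nearOne_neBot n
  have l1 := tendsto_finsetSum (Finset.univ : Finset (Fin (m + 1))) fun s _ =>
    (tendsto_tsum_schurQ (s := s) (n := n) (by omega) (abs_nonneg q) hq hC).2.const_mul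
      (ε ^ (s : ℕ) / 2 ^ (s : ℕ))
  -- The extra m factors □(q)² undo the normalization of the kernel in a product over m pairs.
  have l2 := (tendsto_pairs_squareKernel hq n).const_mul ((SumsOfSquares.square q ^ 2) ^ m)
  rw [prod_Ioi_const, ← pow_add, ← pow_mul (SumsOfSquares.square q) 2 (m + _), mul_add] at l2
  refine tendsto_nhds_unique_of_eventuallyEq l1 l2 ?_
  filter_upwards [eventually_nearOne (n := n) one_pos, eventually_mem_ratioDomain n hq] with y hy hy2
  let x : Fin n → ratioDomain |q| := fun i => ⟨y i, hy2 i⟩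
  have hx : Function.Injective x := fun i j hij => hy.2 (congrArg Subtype.val hij)
  have key := sum_tsum_schurQ he hn (v := (Subtype.val : ratioDomain |q| → ℝ)) (fun a => a.2.1)
    Subtype.val_injective hx (c := squareCoeff q ε) (if_pos rfl)
    (summable_squareCoeff_ratioPow hq hε) ε
  refine key.trans ?_
  have ealt : alt (pairing (m := m) (by omega) fun _ (a b : ratioDomain |q|) =>
      schurKernel Subtype.val a b + 2 * ε * (ratioSeries Subtype.val (squareCoeff q ε) a b -
        ratioSeries Subtype.val (squareCoeff q ε) b a)) x =
      (SumsOfSquares.square q ^ 2) ^ m * (2 ^ m * m.factorial * pairs (evenKernel q) x) := by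
    rw [← hval x hx, ← alt_smul]
    refine alt_congr fun σ => ?_
    simp only [schurKernel_add_ratioSeries hq hε, pairing, Finset.prod_div_distrib,
      Finset.prod_const, Finset.card_univ, Fintype.card_fin]
    field_simp
  rw [ealt]
  have hf : (2 ^ m * m.factorial : ℝ) ≠ 0 := by positivity
  -- Schur's product is divided out pair by pair, so the quotient is a product of functions of
  -- x_i/x_j with known limits at 1.
  have hp : pairs (evenKernel q) x / pairs (schurKernel Subtype.val) x =
      ∏ i, ∏ j ∈ Finset.Ioi i, squareKernel q 1 (y i / y j) /
        ((y i / y j - 1) / (y i / y j + 1)) / SumsOfSquares.square q ^ 2 := by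
    unfold pairs
    simp only [← Finset.prod_div_distrib]
    refine Finset.prod_congr rfl fun i _ => Finset.prod_congr rfl fun j _ => ?_
    have hi := (hy2 i).1
    have hj := (hy2 j).1
    have : schurKernel Subtype.val (x i) (x j) = (y i / y j - 1) / (y i / y j + 1) := by
      simp only [schurKernel, x]
      field_simp
    rw [this, evenKernel, div_right_comm]
  rw [← hp]
  field_simp

end LimitAtOne

/-! ### The two formulas. -/

theorem corollary5p5 :
    (∀ (r n : ℕ) (hrn : r ≤ n) (lam : Fin r → ℤ),
      Tendsto (SumsOfSquares.schurQ hrn lam) (SumsOfSquares.nearOne n)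
        (𝓝 (SumsOfSquares.schurQOne hrn lam))) ∧
    ∀ (m : ℕ) (q : ℝ), |q| < 1 →
      ((∀ s : Fin (m + 1), Summable (SumsOfSquares.evenTerm m q s)) ∧
        SumsOfSquares.square q ^ (4 * m ^ 2) =
          ∑ s : Fin (m + 1), 1 / 2 ^ (s : ℕ) *
            ∑' k : SumsOfSquares.DecTuple s, SumsOfSquares.evenTerm m q s k) ∧
      ((∀ s : Fin (m + 1), Summable (SumsOfSquares.oddTerm m q s)) ∧
        SumsOfSquares.square q ^ (4 * m * (m + 1)) =
          ∑ s : Fin (m + 1), (-1) ^ (s : ℕ) / 2 ^ (s : ℕ) *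
            ∑' k : SumsOfSquares.DecTuple s, SumsOfSquares.oddTerm m q s k) := by
  refine ⟨fun r n hrn lam => tendsto_schurQ hrn lam, fun m q hq => ⟨?_, ?_⟩⟩
  · obtain ⟨C, hC⟩ := exists_squareCoeff_le hq (Or.inl rfl)
    have e : ∀ s : Fin (m + 1), SumsOfSquares.evenTerm m q s = fun k =>
        (∏ i, squareCoeff q 1 (k.1 i)) *
          SumsOfSquares.schurQOne (n := 2 * m) (by omega) (SumsOfSquares.symmetrize k.1) := by
      intro s
      funext k
      unfold SumsOfSquares.evenTerm
      congr 1
      refine Finset.prod_congr rfl fun i _ => ?_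
      have := k.2.2 i
      rw [squareCoeff, if_neg (by omega), one_mul]
    simp only [e]
    refine ⟨fun s => (tendsto_tsum_schurQ _ (abs_nonneg q) hq hC).1, ?_⟩
    have := sum_tsum_schurQOne hq (Or.inl rfl) (m := m) (n := 2 * m) (Nat.zero_le 1) rfl
      fun x hx => (addSystem_squareKernel hq).alt_pairing_even m rfl x hx
    simp only [one_pow] at this
    rw [this]
    congr 1
    -- The exponent 2m + n(n-1) at n = 2m; m = 0 is split off because of the truncated 2m - 1.
    rw [mul_assoc 2 m, Nat.mul_div_cancel_left _ two_pos]
    rcases m with _ | m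
    · rfl
    · rw [show 2 * (m + 1) - 1 = 2 * m + 1 by omega]
      ring
  · obtain ⟨C, hC⟩ := exists_squareCoeff_le hq (Or.inr rfl)
    have e : ∀ s : Fin (m + 1), SumsOfSquares.oddTerm m q s = fun k =>
        (∏ i, squareCoeff q (-1) (k.1 i)) *
          SumsOfSquares.schurQOne (n := 2 * m + 1) (by omega) (SumsOfSquares.symmetrize k.1) := by
      intro s
      funext k
      unfold SumsOfSquares.oddTerm
      congr 1
      refine Finset.prod_congr rfl fun i _ => ?_
      have := k.2.2 i
      rw [squareCoeff, if_neg (by omega), neg_one_mul, sub_eq_add_neg]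
    simp only [e]
    refine ⟨fun s => (tendsto_tsum_schurQ _ (abs_nonneg q) hq hC).1, ?_⟩
    have := sum_tsum_schurQOne hq (Or.inr rfl) (m := m) (n := 2 * m + 1) le_rfl rfl
      fun x hx => (addSystem_squareKernel hq).alt_pairing_odd oddKernel_anti m rfl x hx
    rw [this]
    congr 1
    -- At n = 2m + 1 the exponent is 2m + 2m(2m + 1) = 4m(m + 1).
    rw [Nat.add_sub_cancel, mul_comm (2 * m + 1), mul_assoc 2 m, Nat.mul_div_cancel_left _ two_pos]
    ring
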